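/- Let $\Gamma$ be a finite group. For a prime $p$ let $G_{\mathbb{Q}_p}$ be the absolute Galois group of $\mathbb{Q}_p$ and $I_{\mathbb{Q}_p}$ its inertia subgroup. A counting function for $\Gamma$ is a function $c$ assigning an integer $c(\phi)$ to every prime $p$ and every continuous homomorphism $\phi : G_{\mathbb{Q}_p} \to \Gamma$, such that $c(\gamma\phi\gamma^{-1}) = c(\phi)$ for all $\gamma \in \Gamma$, and $c(\phi) = 0$ if $\phi$ is unramified. It is proper if $c(\phi) = c(\phi')$ for all $\phi : G_{\mathbb{Q}_p} \to \Gamma$ and $\phi' : G_{\mathbb{Q}_{p'}} \to \Gamma$ with $p, p' \nmid |\Gamma|$ (possibly $p \neq p'$) and $\phi(I_{\mathbb{Q}_p}) = \phi'(I_{\mathbb{Q}_{p'}})$. A weight function $w$ for $\Gamma$ assigns an integer $w(H,H')$ to each pair $(H,H')$ where $H$ is a subgroup of $\Gamma$ and $H'$ is a maximal subgroup of $H$. For a continuous surjection $\phi : G_{\mathbb{Q}} \to \Gamma$ with corresponding Galois extension $K/\mathbb{Q}$, let $K_H$ be the subfield of $K$ fixed by $H$, and put $$D_w(K) = \prod_{(H,H')}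 N_{K_H/\mathbb{Q}}\bigl(\operatorname{disc}(K_{H'}/K_H)\bigr)^{w(H,H')}.$$ For a continuous homomorphism $\phi : G_{\mathbb{Q}_p} \to \Gamma$ let $I_i \subseteq \Gamma$ ($i \ge 0$) be the images in $\Gamma$ of the lower-numbering ramification groups of the Galois extension of $\mathbb{Q}_p$ fixed by $\ker \phi$, and put $$c_w(\phi) = \sum_{(H,H')} w(H,H') \cdot \frac{1}{|I_0|\,|H'|} \sum_{\gamma \in \Gamma} \sum_{i \ge 0} \bigl( |\gamma I_i \gamma^{-1} \cap H| - |\gamma I_i \gamma^{-1} \cap H'| \bigr).$$ Then for every weight function $w$, $c_w$ is a counting function (in particular it is integer-valued); it is the counting function of the weighted discriminant $D_w$, that is, $D_w(K) = \prod_p p^{c_w(\phi_p)}$ for every continuous surjection $\phi : G_{\mathbb{Q}} \to \Gamma$ with corresponding extension $K$, where $\phi_p$ is the restriction of $\phi$ to $G_{\mathbb{Q}_p}$ along any embedding $\overline{\mathbb{Q}} \to \overline{\mathbb{Q}_p}$ and only finitely many factors differ from $1$; and $c_w$ is proper. -/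

import Mathlib

noncomputable section

open scoped NumberField

namespace WeightedDisc

instance factPrime (p : Nat.Primes) : Fact (p : ℕ).Prime := ⟨p.2⟩

/-- The absolute Galois group of a field `K`, with its Krull topology. -/
abbrev AbsGal (K : Type*) [Field K] : Type _ := Gal(AlgebraicClosure K/K)

section Generic

variable {K M : Type*} [Field K] [Field M] [Algebra K M]

/-- Embeddings over `K` of the algebraic closure of `K` into that of an extension `M`. -/
abbrev ClosureEmbedding (K M : Type*) [Field K] [Field M] [Algebra K M] : Type _ :=
  AlgebraicClosure K →ₐ[K] AlgebraicClosure M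

/-- Restriction of automorphisms `G_M → G_K` along an embedding `ι` of algebraic closures; it is
characterized by `ι (restrict σ x) = σ (ι x)`. -/
def restrictGal (ι : ClosureEmbedding K M) : AbsGal M →* AbsGal K :=
  letI := ι.toRingHom.toAlgebra
  haveI : IsScalarTower K (AlgebraicClosure K) (AlgebraicClosure M) :=
    IsScalarTower.of_algebraMap_eq fun x => (ι.commutes x).symm
  (AlgEquiv.restrictNormalHom (F := K) (K₁ := AlgebraicClosure M) (AlgebraicClosure K)).comp
    { toFun := fun σ => σ.restrictScalars K
      map_one' := rfl
      map_mul' := fun _ _ => rfl }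

theorem restrictGal_commutes (ι : ClosureEmbedding K M) (σ : AbsGal M) (x : AlgebraicClosure K) :
    ι (restrictGal ι σ x) = σ (ι x) := by
  let _ := ι.toRingHom.toAlgebra
  have : IsScalarTower K (AlgebraicClosure K) (AlgebraicClosure M) :=
    IsScalarTower.of_algebraMap_eq fun x => (ι.commutes x).symm
  exact AlgEquiv.restrictNormal_commutes (σ.restrictScalars K) (AlgebraicClosure K) x

theorem continuous_restrictGal (ι : ClosureEmbedding K M) : Continuous (restrictGal ι) := by
  refine continuous_of_continuousAt_one _ ?_
  rw [ContinuousAt, map_one]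
  intro s hs
  obtain ⟨E, hE, hEs⟩ := (krullTopology_mem_nhds_one_iff K (AlgebraicClosure K) s).1 hs
  let b := Module.finBasis K E
  refine (krullTopology_mem_nhds_one_iff M (AlgebraicClosure M) _).2
    ⟨IntermediateField.adjoin M (Set.range fun i => ι (b i)), ?_, fun σ hσ => hEs ?_⟩
  · exact IntermediateField.finiteDimensional_adjoin
      fun x _ => Algebra.IsIntegral.isIntegral x
  · have hb : ∀ i, restrictGal ι σ (b i) = b i := fun i => by
      apply ι.injective
      refine (restrictGal_commutes ι σ (b i)).trans ?_
      exact hσ ⟨ι (b i), IntermediateField.subset_adjoin _ _ ⟨i, rfl⟩⟩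
    have hlin : (restrictGal ι σ).toAlgHom.toLinearMap ∘ₗ E.val.toLinearMap =
        E.val.toLinearMap := b.ext fun i => hb i
    exact fun x => LinearMap.congr_fun hlin x

/-- If `f` is a continuous homomorphism from `G_K` to a finite discrete group and `H` is a
subgroup of the target, then the fixed field of `f⁻¹(H)` is a finite extension of `K`. -/
theorem finiteDimensional_fixedField [CharZero K] {Γ : Type*} [Group Γ] [TopologicalSpace Γ]
    [DiscreteTopology Γ] (f : AbsGal K →ₜ* Γ) (H : Subgroup Γ) :
    FiniteDimensional K (IntermediateField.fixedField (H.comap f.toMonoidHom)) := by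
  have ho : IsOpen (H.comap f.toMonoidHom : Set (AbsGal K)) :=
    (isOpen_discrete (H : Set Γ)).preimage f.continuous_toFun
  rw [← InfiniteGalois.isOpen_iff_finite]
  exact Subgroup.isOpen_mono
    ((IntermediateField.le_iff_le (H.comap f.toMonoidHom) _).1 le_rfl) ho

end Generic

section Ramification

variable (p : ℕ) [Fact p.Prime]

/-- The maximal ideal of the ring of integers of an algebraic extension `E` of `ℚ_p`, i.e. of the
integral closure of `ℤ_p` in `E`. This ring is local, so that its maximal ideal is its
Jacobson radical. -/
def maxIdeal (E : Type*) [Field E] [Algebra ℚ_[p] E] [Algebra ℤ_[p] E]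
    [IsScalarTower ℤ_[p] ℚ_[p] E] : Ideal (integralClosure ℤ_[p] E) :=
  Ideal.jacobson ⊥

instance smulComm (E : Type*) [Field E] [Algebra ℚ_[p] E] [Algebra ℤ_[p] E]
    [IsScalarTower ℤ_[p] ℚ_[p] E] : SMulCommClass Gal(E/ℚ_[p]) ℤ_[p] E where
  smul_comm σ r x := by
    rw [← algebraMap_smul ℚ_[p] r x, smul_comm, algebraMap_smul]

/-- The `i`-th ramification group, in the lower numbering, of an algebraic Galois extension
`E / ℚ_p`: the automorphisms acting trivially on the ring of integers modulo the `(i+1)`-st power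
of the maximal ideal. For `i = 0` this is the inertia group. -/
def galRamificationGroup (E : Type*) [Field E] [Algebra ℚ_[p] E] [Algebra ℤ_[p] E]
    [IsScalarTower ℤ_[p] ℚ_[p] E] (i : ℕ) : Subgroup Gal(E/ℚ_[p]) :=
  Ideal.inertia Gal(E/ℚ_[p]) (maxIdeal p E ^ (i + 1))

/-- The absolute inertia group of `ℚ_p`. -/
def absInertia : Subgroup (AbsGal ℚ_[p]) :=
  galRamificationGroup p (AlgebraicClosure ℚ_[p]) 0

end Ramification

section Homs

variable (Γ : Type*) [Group Γ] [TopologicalSpace Γ]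

/-- Continuous homomorphisms from the absolute Galois group of `ℚ_p` to `Γ`. -/
abbrev LocalHom (p : ℕ) [Fact p.Prime] : Type _ := AbsGal ℚ_[p] →ₜ* Γ

/-- Continuous homomorphisms from the absolute Galois group of `ℚ` to `Γ`. -/
abbrev GlobalHom : Type _ := AbsGal ℚ →ₜ* Γ

variable {Γ}

/-- The homomorphism `γ φ γ⁻¹`. -/
def LocalHom.conj [DiscreteTopology Γ] {p : ℕ} [Fact p.Prime] (γ : Γ) (φ : LocalHom Γ p) :
    LocalHom Γ p where
  toMonoidHom := (MulAut.conj γ).toMonoidHom.comp φ.toMonoidHom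
  continuous_toFun := (continuous_of_discreteTopology (f := MulAut.conj γ)).comp φ.continuous_toFun

/-- The image `φ(I_{ℚ_p})` of the absolute inertia group. -/
def LocalHom.inertiaImage {p : ℕ} [Fact p.Prime] (φ : LocalHom Γ p) : Subgroup Γ :=
  (absInertia p).map φ.toMonoidHom

/-- The Galois extension of `ℚ_p` cut out by `φ`. -/
abbrev LocalHom.field {p : ℕ} [Fact p.Prime] (φ : LocalHom Γ p) :
    IntermediateField ℚ_[p] (AlgebraicClosure ℚ_[p]) :=
  IntermediateField.fixedField φ.toMonoidHom.ker

/-- The `i`-th lower ramification group of `φ`, as a subgroup of `Γ`: the image under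
`Gal(L/ℚ_p) ≃ φ(G_{ℚ_p}) ≤ Γ` of the `i`-th ramification group of `L / ℚ_p`, where `L` is the
extension cut out by `φ`. -/
def LocalHom.ramificationGroup {p : ℕ} [Fact p.Prime] (φ : LocalHom Γ p) (i : ℕ) : Subgroup Γ :=
  ((galRamificationGroup p φ.field i).comap
    (AlgEquiv.restrictNormalHom φ.field)).map φ.toMonoidHom

/-- The restriction `φ_p` of `φ : G_ℚ → Γ` to `G_{ℚ_p}`, along an embedding `ι` of the algebraic
closure of `ℚ` into that of `ℚ_p`. -/
def GlobalHom.restrict {p : ℕ} [Fact p.Prime] (φ : GlobalHom Γ) (ι : ClosureEmbedding ℚ ℚ_[p]) :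
    LocalHom Γ p :=
  φ.comp ⟨restrictGal ι, continuous_restrictGal ι⟩

/-- The field `K_H`: the subfield fixed by `H` of the `Γ`-extension `K` of `ℚ` cut out by `φ`. -/
abbrev GlobalHom.fixedField (φ : GlobalHom Γ) (H : Subgroup Γ) :
    IntermediateField ℚ (AlgebraicClosure ℚ) :=
  IntermediateField.fixedField (H.comap φ.toMonoidHom)

instance GlobalHom.numberField [DiscreteTopology Γ] (φ : GlobalHom Γ) (H : Subgroup Γ) :
    NumberField (φ.fixedField H) where
  to_charZero := charZero_of_injective_algebraMap (algebraMap ℚ (φ.fixedField H)).injective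
  to_finiteDimensional := by
    have h := finiteDimensional_fixedField φ H
    have e : (IntermediateField.algebra' _ : Algebra ℚ (φ.fixedField H)) =
      DivisionRing.toRatAlgebra := Subsingleton.elim _ _
    rw [← e]
    exact h

theorem GlobalHom.fixedField_le (φ : GlobalHom Γ) {H H' : Subgroup Γ} (h : H' ≤ H) :
    φ.fixedField H ≤ φ.fixedField H' :=
  IntermediateField.fixedField_antitone (Subgroup.comap_mono h)

end Homs

section CountingFunctions

variable (Γ : Type*) [Group Γ] [TopologicalSpace Γ] [DiscreteTopology Γ]

/-- A counting function for `Γ`: an integer-valued function on the continuous homomorphisms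
`G_{ℚ_p} → Γ`, for all primes `p`, that is invariant under conjugation by `Γ` and vanishes on
unramified homomorphisms. -/
structure CountingFunction where
  toFun : ∀ (p : ℕ) [Fact p.Prime], LocalHom Γ p → ℤ
  map_conj : ∀ (p : ℕ) [Fact p.Prime] (γ : Γ) (φ : LocalHom Γ p),
    toFun p (φ.conj γ) = toFun p φ
  map_unramified : ∀ (p : ℕ) [Fact p.Prime] (φ : LocalHom Γ p),
    φ.inertiaImage = ⊥ → toFun p φ = 0

variable {Γ}

/-- At primes not dividing `|Γ|`, the value depends only on the image of inertia, even for
two different primes. -/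
def CountingFunction.IsProper (c : CountingFunction Γ) : Prop :=
  ∀ (p p' : ℕ) [Fact p.Prime] [Fact p'.Prime] (φ : LocalHom Γ p) (φ' : LocalHom Γ p'),
    ¬ p ∣ Nat.card Γ → ¬ p' ∣ Nat.card Γ → φ.inertiaImage = φ'.inertiaImage →
      c.toFun p φ = c.toFun p' φ'

end CountingFunctions

section Weights

/-- The pairs `(H, H')` with `H` a subgroup of `Γ` and `H'` a maximal (proper) subgroup of `H`. -/
abbrev MaxPair (Γ : Type*) [Group Γ] : Type _ := {P : Subgroup Γ × Subgroup Γ // P.2 ⋖ P.1}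

/-- A weight function assigns an integer to each pair `(H, H')`. -/
abbrev WeightFunction (Γ : Type*) [Group Γ] : Type _ := MaxPair Γ → ℤ

/-- The relative discriminant of an extension `F / E` of number fields: the ideal of `𝓞 E`
generated by the discriminants of the families of `[F : E]` elements of `𝓞 F`
(only bases contribute, other families having discriminant zero). -/
def relDiscr (E F : Type*) [Field E] [Field F] [Algebra E F] : Ideal (𝓞 E) :=
  Ideal.span {d | ∃ b : Fin (Module.finrank E F) → 𝓞 F,
    (d : E) = Algebra.discr E fun i => (b i : F)}

variable {Γ : Type*} [Group Γ] [TopologicalSpace Γ] [DiscreteTopology Γ]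

/-- The weighted discriminant
`D_w(K) = ∏_{(H,H')} N_{K_H/ℚ}(disc(K_{H'}/K_H)) ^ w(H,H')`. -/
def weightedDisc (w : WeightFunction Γ) (φ : GlobalHom Γ) : ℚ :=
  ∏ᶠ P : MaxPair Γ, (Ideal.absNorm (relDiscr (φ.fixedField P.1.1)
    (IntermediateField.extendScalars (φ.fixedField_le P.2.le))) : ℚ) ^ w P

/-- The quantity
`c_{H,H'}(φ) = 1/(|I_0||H'|) ∑_{γ ∈ Γ} ∑_{i ≥ 0} (|γ I_i γ⁻¹ ∩ H| - |γ I_i γ⁻¹ ∩ H'|)`,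
where `I_i` is the `i`-th ramification group of `φ`; for finite `Γ` the sum is finite,
because `I_i` is trivial for large `i`. -/
def pairCount {p : ℕ} [Fact p.Prime] (H H' : Subgroup Γ) (φ : LocalHom Γ p) : ℚ :=
  1 / (Nat.card (φ.ramificationGroup 0) * Nat.card H') *
    ∑ᶠ γ : Γ, ∑ᶠ i : ℕ,
      ((Nat.card ↥((φ.ramificationGroup i).map (MulAut.conj γ).toMonoidHom ⊓ H) : ℚ) -
        Nat.card ↥((φ.ramificationGroup i).map (MulAut.conj γ).toMonoidHom ⊓ H'))

/-- The value `c_w(φ) = ∑_{(H,H')} c_{H,H'}(φ) w(H,H')`. -/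
def weightedCount (w : WeightFunction Γ) {p : ℕ} [Fact p.Prime] (φ : LocalHom Γ p) : ℚ :=
  ∑ᶠ P : MaxPair Γ, pairCount P.1.1 P.1.2 φ * w P

end Weights

end WeightedDisc

end

open WeightedDisc

section

open Polynomial Pointwise

/-! ### Multiplicities and approximation at a prime of a Dedekind domain -/

section PrimeMultiplicity

variable {B : Type*} [CommRing B] [IsDedekindDomain B] {P : Ideal B} [P.IsPrime]

/-! The heart of the matter is one factor of `D_w`: for `H' ≤ H`, `pairCount` at `φ_p` is the
exponent of `p` in the norm of disc(K_{H'}/K_H) (`pairCount_restrict`). The discriminant ideal is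
the norm of the different (`relNorm_differentIdeal_eq_span_discr`). By Hilbert's formula
(`sum_card_inertia_eq_multiplicity_differentIdeal_add`) a prime Q of K occurs in the different of
K/K_H with exponent ∑_i (|G_i(Q) ∩ H| - 1). Now let Q run over the primes γP above p. Since G_i(γP)
= γ G_i(P) γ⁻¹, and each prime occurs for |D_P| = |I_0| f elements γ, the sum over Γ is |I_0| times
the exponent of p in the norm of that different. The terms -1 cancel between H and H', and
transitivity of the different in K_H ⊆ K_{H'} ⊆ K leaves |I_0| |H'| times the wanted exponent, with
|H'| = [K : K_{H'}] coming from the norm of an extended ideal.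

The definition of c_w uses local ramification groups, the formula above global ones. They agree
(`map_galRamificationGroup`): 𝓞 K is dense in the local ring of integers, and the local Galois group
is the whole decomposition group because e and f are the same on both sides.

Integrality concerns every local φ, whether or not it comes from a global one. Let G be the local
Galois group, embedded in Γ, and S_γ ≤ G the preimage of γ⁻¹Hγ. The same ramification formula over
ℤ_p expresses the γ-term through |S_γ| d(S_γ), where d(S) is the discriminant exponent of the field
fixed by S. The group H × G acts on Γ with stabilizers S_γ, so ∑_γ |S_γ| d(S_γ) is |H| |G| times an
integer, a sum over the double cosets H\Γ/G. The denominators cancel (`exists_int_eq_pairCount`).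

For properness, I_0 is the image of absolute inertia (`inertiaImage_eq`), and for p not dividing |Γ|
all I_i with i ≥ 1 are trivial (`ramificationGroup_eq_bot_of_not_dvd`). Vanishing on unramified
homomorphisms also follows from the first fact, and invariance under conjugation is a reindexing of
the sum over Γ. -/

theorem Ideal.finiteMultiplicity_of_isPrime (hP : P ≠ ⊥) {I : Ideal B} (hI : I ≠ ⊥) :
    FiniteMultiplicity P I :=
  .of_prime_left (Ideal.prime_of_isPrime hP ‹_›) hI

theorem Ideal.le_pow_iff_le_multiplicity (hP : P ≠ ⊥) {I : Ideal B} (hI : I ≠ ⊥) {n : ℕ} :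
    I ≤ P ^ n ↔ n ≤ multiplicity P I := by
  rw [← Ideal.dvd_iff_le, (Ideal.finiteMultiplicity_of_isPrime hP hI).pow_dvd_iff_le_multiplicity]

theorem Ideal.mem_pow_iff_le_multiplicity (hP : P ≠ ⊥) {x : B} (hx : x ≠ 0) {n : ℕ} :
    x ∈ P ^ n ↔ n ≤ multiplicity P (Ideal.span {x}) := by
  rw [← Ideal.le_pow_iff_le_multiplicity hP (by simpa using hx), Ideal.span_singleton_le_iff_mem]

theorem Ideal.multiplicity_mul_of_isPrime (hP : P ≠ ⊥) {I J : Ideal B} (hI : I ≠ ⊥) (hJ : J ≠ ⊥) :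
    multiplicity P (I * J) = multiplicity P I + multiplicity P J :=
  _root_.multiplicity_mul (Ideal.prime_of_isPrime hP ‹_›)
    (Ideal.finiteMultiplicity_of_isPrime hP (mul_ne_zero hI hJ))

theorem Ideal.multiplicity_span_pow (hP : P ≠ ⊥) {x : B} (hx : x ≠ 0) (n : ℕ) :
    multiplicity P (Ideal.span {x ^ n}) = n * multiplicity P (Ideal.span {x}) := by
  rw [← Ideal.span_singleton_pow]
  exact FiniteMultiplicity.multiplicity_pow (Ideal.prime_of_isPrime hP ‹_›)
    (Ideal.finiteMultiplicity_of_isPrime hP (by simpa using hx))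

theorem Ideal.pow_notMem_pow_succ (hP : P ≠ ⊥) {x : B} (hx : x ∈ P) (hx2 : x ∉ P ^ 2) (n : ℕ) :
    x ^ n ∉ P ^ (n + 1) := by
  have h0 : x ≠ 0 := by rintro rfl; simp at hx2
  have h1 : ¬ 2 ≤ multiplicity P (Ideal.span {x}) :=
    (Ideal.mem_pow_iff_le_multiplicity hP h0).not.1 hx2
  rw [Ideal.mem_pow_iff_le_multiplicity hP (pow_ne_zero n h0), Ideal.multiplicity_span_pow hP h0]
  nlinarith

/-- Successive approximation: an error in `P ^ n` is `x ^ n * d` modulo `P ^ (n + 1)`, and `d` may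
be replaced modulo `P` by an element of `S`. -/
theorem Ideal.exists_mem_sub_mem_pow {C : Type*} [SetLike C B] [SubringClass C B] {S : C}
    (hP : P ≠ ⊥) {x : B} (hxS : x ∈ S) (hx : x ∈ P) (hx2 : x ∉ P ^ 2)
    (h : ∀ y, ∃ c ∈ S, y - c ∈ P) (n : ℕ) (y : B) : ∃ c ∈ S, y - c ∈ P ^ n := by
  induction n with
  | zero => exact ⟨0, zero_mem S, by simp⟩
  | succ n ih =>
    obtain ⟨c, hc, hyc⟩ := ih
    obtain ⟨d, e, he, hde⟩ := Ideal.exists_mul_add_mem_pow_succ hP (x ^ n) (y - c)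
      (Ideal.pow_mem_pow hx n) (Ideal.pow_notMem_pow_succ hP hx hx2 n) hyc
    obtain ⟨c', hc', hd⟩ := h d
    refine ⟨c + x ^ n * c', add_mem hc (mul_mem (pow_mem hxS n) hc'), ?_⟩
    have : y - (c + x ^ n * c') = x ^ n * (d - c') + e := by linear_combination -hde
    rw [this]
    exact add_mem (pow_succ P n ▸ Ideal.mul_mem_mul (Ideal.pow_mem_pow hx n) hd) he

/-- There is a generator of the residue field at `P` whose lift `α` produces a uniformizer
`α ^ q - α`, and which can be chosen divisible by finitely many other primes. -/
theorem Ideal.exists_residue_generator [P.IsMaximal] [Finite (B ⧸ P)] (hP : P ≠ ⊥)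
    (S : Finset (Ideal B)) (hS : ∀ Q ∈ S, Q.IsPrime ∧ Q ≠ ⊥) :
    ∃ (α : B) (q : ℕ), α ∉ P ∧ (∀ Q ∈ S, Q ≠ P → α ∈ Q) ∧ α ^ q - α ∈ P ∧ α ^ q - α ∉ P ^ 2 ∧
      ∀ x, ∃ c ∈ Algebra.adjoin ℤ {α}, x - c ∈ P := by
  classical
  let _ : Field (B ⧸ P) := Ideal.Quotient.field P
  have := Fintype.ofFinite (B ⧸ P)
  obtain ⟨θ, hθ⟩ := IsCyclic.exists_generator (α := (B ⧸ P)ˣ)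
  obtain ⟨α₀, hα₀⟩ := Ideal.Quotient.mk_surjective (θ : B ⧸ P)
  set q := Fintype.card (B ⧸ P) with hq
  have hqP : (q : B) ∈ P := by
    rw [← Ideal.Quotient.eq_zero_iff_mem, map_natCast]
    exact FiniteField.cast_card_eq_zero _
  have hq1 : 1 < q := Fintype.one_lt_card
  have hpow (x : B) : x ^ q - x ∈ P := by
    rw [← Ideal.Quotient.eq_zero_iff_mem, map_sub, map_pow, FiniteField.pow_card, sub_self]
  obtain ⟨π, hπ, hπ2⟩ : ∃ π ∈ P, π ∉ P ^ 2 := by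
    have : P ^ 2 < P ^ 1 := Ideal.pow_right_strictAnti P hP (Ideal.IsPrime.ne_top ‹_›) one_lt_two
    rw [pow_one] at this
    exact SetLike.exists_of_lt this
  -- As `q ∈ P`, passing from `α₀` to `α₀ + π` changes `α₀ ^ q - α₀` by `-π` modulo `P ^ 2`, so one
  -- of these two lifts works.
  obtain ⟨α₁, hα₁, hα₁'⟩ : ∃ α₁, α₁ - α₀ ∈ P ∧ α₁ ^ q - α₁ ∉ P ^ 2 := by
    by_cases h0 : α₀ ^ q - α₀ ∈ P ^ 2
    · refine ⟨α₀ + π, by simpa using hπ, fun h1 => hπ2 ?_⟩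
      obtain ⟨k, hk⟩ := Polynomial.powAddExpansion α₀ π q
      have : π = (α₀ ^ q - α₀) - ((α₀ + π) ^ q - (α₀ + π)) + q * π * α₀ ^ (q - 1)
          + k * π ^ 2 := by rw [hk]; ring
      rw [this]
      refine add_mem (add_mem (sub_mem h0 h1) (Ideal.mul_mem_right _ _ ?_))
        (Ideal.mul_mem_left _ _ (Ideal.pow_mem_pow hπ 2))
      rw [pow_two]
      exact Ideal.mul_mem_mul hqP hπ
    · exact ⟨α₀, by simp, h0⟩
  -- Chinese remainders: a congruence modulo `P ^ 2` preserves the condition on `α ^ q - α`, and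
  -- modulo the other primes `α` is made zero.
  obtain ⟨α, hα⟩ := IsDedekindDomain.exists_forall_sub_mem_ideal (s := insert P S)
    (fun Q => Q) (fun Q => if Q = P then 2 else 1)
    (fun Q hQ => by
      rcases Finset.mem_insert.1 hQ with rfl | hQ
      · exact Ideal.prime_of_isPrime hP ‹_›
      · exact Ideal.prime_of_isPrime (hS Q hQ).2 (hS Q hQ).1)
    (fun _ _ _ _ h => h) (fun Q => if Q = P then α₁ else 0)
  have hαP : α - α₁ ∈ P ^ 2 := by simpa using hα P (Finset.mem_insert_self _ _)
  have hαP1 : α - α₁ ∈ P := Ideal.pow_le_self two_ne_zero hαP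
  have hmk : Ideal.Quotient.mk P α = θ := by
    rw [← hα₀, Ideal.Quotient.eq]
    simpa using add_mem hαP1 hα₁
  refine ⟨α, q, fun h => ?_, fun Q hQ hQP => ?_, hpow α, fun h => hα₁' ?_, fun x => ?_⟩
  · rw [← Ideal.Quotient.eq_zero_iff_mem, hmk] at h
    exact θ.ne_zero h
  · simpa [hQP] using hα Q (Finset.mem_insert_of_mem hQ)
  · have h2 : α ^ q - α₁ ^ q ∈ P ^ 2 := Ideal.mem_of_dvd _ (sub_dvd_pow_sub_pow α α₁ q) hαP
    have : α₁ ^ q - α₁ = (α ^ q - α) - (α ^ q - α₁ ^ q) + (α - α₁) := by ring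
    rw [this]
    exact add_mem (sub_mem h h2) hαP
  · by_cases hx : x ∈ P
    · exact ⟨0, zero_mem _, by simpa using hx⟩
    · have hx' : Ideal.Quotient.mk P x ≠ 0 := by rwa [Ne, Ideal.Quotient.eq_zero_iff_mem]
      obtain ⟨k, hk⟩ := mem_powers_iff_mem_zpowers.2 (hθ (Units.mk0 _ hx'))
      refine ⟨α ^ k, pow_mem (Algebra.self_mem_adjoin_singleton ℤ α) k, ?_⟩
      rw [← Ideal.Quotient.eq, map_pow, hmk]
      exact (congrArg Units.val hk).symm

end PrimeMultiplicity

/-! ### A conductor prime to a given prime -/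

section Conductor

variable {A B : Type*} [CommRing A] [CommRing B] [Algebra A B] [IsDedekindDomain B]
  [Module.Finite A B]

/-- If `α` generates `B` modulo `P ^ 2` over `A` and lies in all other primes of `B` above the
prime of `A` below `P`, then the conductor of `A[α]` is prime to `P`. -/
theorem exists_mem_conductor_notMem {P : Ideal B} [P.IsMaximal] [(P.under A).IsMaximal]
    {α ϖ : B} (hαP : α ∉ P)
    (hα : ∀ Q : Ideal B, Q.IsPrime → Q.under A = P.under A → Q ≠ P → α ∈ Q)
    (hϖ : ϖ ∈ Algebra.adjoin A {α}) (hϖP : ϖ ∈ P) (hϖP2 : ϖ ∉ P ^ 2)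
    (hsurj : ∀ x, ∃ c ∈ Algebra.adjoin A {α}, x - c ∈ P) :
    ∃ c ∈ conductor A α, c ∉ P := by
  let C := Algebra.adjoin A {α}
  let 𝔪 : Ideal C := P.under C
  have halgC (c : C) : algebraMap C B c = c := rfl
  have : Algebra.IsIntegral A B := Algebra.IsIntegral.of_finite A B
  have hmaxA : 𝔪.under A = P.under A := Ideal.under_under P
  have : 𝔪.IsPrime := inferInstance
  have : Algebra.IsIntegral A C := ⟨fun x =>
    (isIntegral_algHom_iff C.val Subtype.val_injective).1 (Algebra.IsIntegral.isIntegral (x : B))⟩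
  have hmax : 𝔪.IsMaximal := Ideal.isMaximal_of_isIntegral_of_isMaximal_comap' (algebraMap A C)
    (algebraMap_isIntegral_iff.2 inferInstance) 𝔪
    (by change (𝔪.under A).IsMaximal; rw [hmaxA]; infer_instance)
  -- The cofactor `J` of `P` in the extension of `𝔪` is trivial. A maximal ideal containing it is
  -- not `P`, since `ϖ ∉ P ^ 2`; any other one contracts to `𝔪` and contains `α`, which would force
  -- `α ∈ P`.
  have hmB : 𝔪.map (algebraMap C B) = P := by
    have hle : 𝔪.map (algebraMap C B) ≤ P := Ideal.map_le_iff_le_comap.2 le_rfl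
    have hϖm : ϖ ∈ 𝔪.map (algebraMap C B) :=
      Ideal.mem_map_of_mem (algebraMap C B) (x := ⟨ϖ, hϖ⟩) hϖP
    obtain ⟨J, hJ⟩ := Ideal.dvd_iff_le.2 hle
    suffices J = ⊤ by rw [hJ, this, Ideal.mul_top]
    by_contra hJtop
    obtain ⟨Q, hQ, hJQ⟩ := Ideal.exists_le_maximal J hJtop
    by_cases hQP : Q = P
    · refine hϖP2 ?_
      rw [pow_two]
      exact (Ideal.mul_mono_right (hJQ.trans hQP.le)) (hJ ▸ hϖm)
    · have hQm : Q.under C = 𝔪 := by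
        refine (hmax.eq_of_le (Ideal.IsPrime.under C Q).ne_top ?_).symm
        rw [Ideal.under_def, ← Ideal.map_le_iff_le_comap, hJ]
        exact Ideal.mul_le_right.trans hJQ
      have hQA : Q.under A = P.under A := by
        rw [← hmaxA, ← hQm]
        exact (Ideal.under_under (A := A) (B := C) Q).symm
      have : (⟨α, Algebra.self_mem_adjoin_singleton A α⟩ : C) ∈ Q.under C :=
        hα Q hQ.isPrime hQA hQP
      rw [hQm] at this
      exact hαP this
  let N : Submodule C B := LinearMap.range (Algebra.linearMap C B)
  have : Module.Finite C B := Module.Finite.of_restrictScalars_finite A C B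
  -- Since `B = C + 𝔪 B`, Nakayama's lemma for `B / C` gives `r`, congruent to 1 modulo `𝔪`, with `r
  -- B ⊆ C`.
  have htop : (⊤ : Submodule C (B ⧸ N)) ≤ 𝔪 • ⊤ := by
    rintro x -
    obtain ⟨x, rfl⟩ := Submodule.Quotient.mk_surjective N x
    obtain ⟨c, hc, hxc⟩ := hsurj x
    have h1 : Submodule.Quotient.mk x = (Submodule.Quotient.mk (x - c) : B ⧸ N) := by
      rw [Submodule.Quotient.eq]
      exact ⟨⟨c, hc⟩, by rw [sub_sub_cancel]; rfl⟩
    rw [h1]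
    have h2 : x - c ∈ (𝔪 • (⊤ : Submodule C B)) := by
      have := Ideal.smul_top_eq_map (R := C) (S := B) 𝔪
      rw [this, Submodule.restrictScalars_mem, hmB]
      exact hxc
    have h3 := Submodule.mem_map_of_mem (f := N.mkQ) h2
    rw [Submodule.map_smul''] at h3
    exact Submodule.smul_mono le_rfl le_top h3
  obtain ⟨r, hr, hr'⟩ := Submodule.exists_sub_one_mem_and_smul_eq_zero_of_fg_of_le_smul 𝔪 ⊤
    Module.Finite.fg_top htop
  refine ⟨r, fun b => ?_, fun hrP => ?_⟩
  · have := hr' (Submodule.Quotient.mk b) trivial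
    rw [← Submodule.Quotient.mk_smul, Submodule.Quotient.mk_eq_zero] at this
    obtain ⟨c, hc⟩ := this
    have hc' : (r : B) * b = c := hc.symm
    rw [hc']
    exact c.2
  · refine hmax.ne_top ((Ideal.eq_top_iff_one _).2 ?_)
    have : (1 : C) = r - (r - 1) := by ring
    rw [this]
    exact sub_mem hrP hr

end Conductor

/-! ### Hilbert's formula for the different -/

section Hilbert

variable {A B : Type*} [CommRing A] [CommRing B] [Algebra A B]

theorem smul_sub_mem_of_mem_adjoin {G : Type*} [Group G] [MulSemiringAction G B]
    [SMulCommClass G A B] {I : Ideal B} {g : G} {α x : B} (hα : g • α - α ∈ I)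
    (hx : x ∈ Algebra.adjoin A {α}) : g • x - x ∈ I := by
  induction hx using Algebra.adjoin_induction with
  | mem y hy => rw [Set.mem_singleton_iff.1 hy]; exact hα
  | algebraMap r => rw [smul_algebraMap, sub_self]; exact zero_mem I
  | add y z _ _ hy hz => rw [smul_add, add_sub_add_comm]; exact add_mem hy hz
  | mul y z _ _ hy hz =>
    have : g • (y * z) - y * z = (g • y - y) * g • z + y * (g • z - z) := by
      rw [smul_mul']; ring
    rw [this]
    exact add_mem (Ideal.mul_mem_right _ _ hy) (Ideal.mul_mem_left _ _ hz)

/-- An automorphism fixing `α` fixes `A[α]`, hence both `c * b` and `c`; cancelling `c` shows that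
it fixes every `b`. -/
theorem smul_eq_of_mem_conductor {G : Type*} [Group G] [MulSemiringAction G B]
    [SMulCommClass G A B] [FaithfulSMul G B] [IsDomain B] {g : G} {α c : B} (hα : g • α = α)
    (hc : c ∈ conductor A α) (hc0 : c ≠ 0) : g = 1 := by
  have key {x : B} (hx : x ∈ Algebra.adjoin A {α}) : g • x = x := by
    have := smul_sub_mem_of_mem_adjoin (I := ⊥) (g := g) (by simp [hα]) hx
    rwa [Ideal.mem_bot, sub_eq_zero] at this
  refine FaithfulSMul.eq_of_smul_eq_smul (α := B) fun b => ?_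
  have h1 := key (hc b)
  have h2 := key (by simpa using hc 1)
  rw [smul_mul', h2] at h1
  rw [one_smul]
  exact mul_left_cancel₀ hc0 h1

/-- The conjugates `g • α` are distinct, so the minimal polynomial is `∏ (X - g • α)`; in its
derivative at `α` only the term without the factor for `g = 1` survives. -/
theorem aeval_derivative_minpoly_eq_prod [IsDomain A] [IsIntegrallyClosed A] [IsDomain B]
    [Module.IsTorsionFree A B] {G : Type*} [Group G] [Fintype G] [DecidableEq G]
    [MulSemiringAction G B] [IsGaloisGroup G A B] {α : B}
    (hα : ∀ g : G, g • α = α → g = 1) :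
    aeval α (derivative (minpoly A α)) = ∏ g ∈ Finset.univ.erase (1 : G), (α - g • α) := by
  have hint : IsIntegral A α := (Algebra.IsInvariant.isIntegral A B G).isIntegral α
  have hinj : Function.Injective fun g : G => g • α := fun g h hgh => by
    have := hα (h⁻¹ * g) (by rw [mul_smul]; simp only at hgh; rw [hgh, inv_smul_smul])
    exact (inv_mul_eq_one.1 this).symm
  have hmap : (minpoly A α).map (algebraMap A B) = ∏ g : G, (X - C (g • α)) := by
    obtain ⟨f, hf, -, hf'⟩ := Polynomial.lifts_and_natDegree_eq_and_monic
      (Algebra.IsInvariant.charpoly_mem_lifts A B G α) (MulSemiringAction.monic_charpoly G α)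
    have hdvd : (minpoly A α).map (algebraMap A B) ∣ ∏ g : G, (X - C (g • α)) := by
      rw [← MulSemiringAction.charpoly_eq, ← hf]
      refine Polynomial.map_dvd _ (minpoly.isIntegrallyClosed_dvd hint ?_)
      rw [← eval_map_algebraMap, hf, MulSemiringAction.eval_charpoly]
    have hmonic := (minpoly.monic hint).map (algebraMap A B)
    have hdvd' : ∏ g : G, (X - C (g • α)) ∣ (minpoly A α).map (algebraMap A B) := by
      have h := (Multiset.prod_X_sub_C_dvd_iff_le_roots hmonic.ne_zero
        (Finset.univ.val.map fun g : G => g • α)).2 ?_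
      · simpa [Multiset.map_map] using h
      · rw [Multiset.le_iff_subset (Finset.univ.nodup.map hinj)]
        intro x hx
        obtain ⟨g, -, rfl⟩ := Multiset.mem_map.1 hx
        rw [mem_roots hmonic.ne_zero, IsRoot.def, eval_map_algebraMap]
        have := aeval_algHom_apply (MulSemiringAction.toAlgHom A B g) α (minpoly A α)
        rwa [minpoly.aeval, map_zero] at this
    exact eq_of_monic_of_associated hmonic (monic_prod_of_monic _ _ fun g _ => monic_X_sub_C _)
      (associated_of_dvd_dvd hdvd hdvd')
  rw [← eval_map_algebraMap, ← derivative_map, hmap,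
    ← Finset.mul_prod_erase Finset.univ _ (Finset.mem_univ (1 : G)), derivative_mul]
  simp [eval_prod]

variable [IsDedekindDomain A] [CharZero A] [IsDedekindDomain B] [Module.IsTorsionFree A B]
  [Module.Finite A B]

-- The conductor times the different is generated by the derivative, and the conductor is prime to
-- `P` because it contains `c`. The same `c` shows that `α` generates the fraction field: `x = c * x
-- / c`.
open FractionRing in
theorem multiplicity_differentIdeal_eq {P : Ideal B} [P.IsPrime] (hP : P ≠ ⊥) {α c : B}
    (hc : c ∈ conductor A α) (hcP : c ∉ P) (h0 : aeval α (derivative (minpoly A α)) ≠ 0) :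
    multiplicity P (differentIdeal A B) =
      multiplicity P (Ideal.span {aeval α (derivative (minpoly A α))}) := by
  let K := FractionRing A
  let L := FractionRing B
  let _ : Algebra K L := liftAlgebra A L
  have : IsScalarTower A K L := isScalarTower_liftAlgebra A L
  have : IsLocalization (Algebra.algebraMapSubmonoid B (nonZeroDivisors A)) L :=
    IsIntegralClosure.isLocalization A K L B
  have : FiniteDimensional K L := .of_isLocalization A B (nonZeroDivisors A)
  have : CharZero K := charZero_of_injective_algebraMap (IsFractionRing.injective A K)
  have hc0 : algebraMap B L c ≠ 0 := by
    rw [Ne, FaithfulSMul.algebraMap_eq_zero_iff]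
    rintro rfl
    exact hcP (zero_mem P)
  have hadj : Algebra.adjoin K {algebraMap B L α} = ⊤ := by
    rw [← IntermediateField.adjoin_simple_toSubalgebra_of_isAlgebraic
      (Algebra.IsAlgebraic.isAlgebraic _), ← IntermediateField.top_toSubalgebra]
    refine congrArg _ (eq_top_iff.2 ?_)
    have key (x : B) (hx : x ∈ Algebra.adjoin A {α}) :
        algebraMap B L x ∈ IntermediateField.adjoin K {algebraMap B L α} := by
      induction hx using Algebra.adjoin_induction with
      | mem y hy =>
        rw [Set.mem_singleton_iff.1 hy]
        exact IntermediateField.mem_adjoin_simple_self K _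
      | algebraMap r =>
        rw [← IsScalarTower.algebraMap_apply A B L, IsScalarTower.algebraMap_apply A K L]
        exact IntermediateField.algebraMap_mem _ _
      | add y z _ _ hy hz => rw [map_add]; exact add_mem hy hz
      | mul y z _ _ hy hz => rw [map_mul]; exact mul_mem hy hz
    have key' (x : B) : algebraMap B L x ∈ IntermediateField.adjoin K {algebraMap B L α} := by
      rw [← mul_div_cancel_left₀ (algebraMap B L x) hc0, ← map_mul]
      exact div_mem (key _ (hc x)) (key _ (by simpa using hc 1))
    rintro x -
    obtain ⟨y, z, -, rfl⟩ := IsFractionRing.div_surjective B x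
    exact div_mem (key' y) (key' z)
  have h := conductor_mul_differentIdeal A K L α hadj
  have hcond : conductor A α ≠ ⊥ := fun h => by
    rw [h, Ideal.mem_bot] at hc
    simp [hc] at hc0
  have hdiff : differentIdeal A B ≠ ⊥ := fun h' => by
    rw [h', Ideal.mul_bot, eq_comm, Ideal.span_singleton_eq_bot] at h
    exact h0 h
  rw [← h, Ideal.multiplicity_mul_of_isPrime hP hcond hdiff, eq_comm, Nat.add_eq_right]
  refine multiplicity_eq_zero.2 fun h => hcP (Ideal.dvd_iff_le.1 h hc)

/-- **Hilbert's different formula**. The multiplicity of a prime in the different is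
`∑ i, (|G_i| - 1)`, where `G_i` are the ramification groups in the lower numbering. -/
theorem sum_card_inertia_eq_multiplicity_differentIdeal_add (A : Type*) {B : Type*} [CommRing A]
    [CommRing B] [Algebra A B] [IsDedekindDomain A] [CharZero A] [IsDedekindDomain B]
    [Module.IsTorsionFree A B] [Module.Finite A B] (G : Type*) [Group G] [Finite G]
    [MulSemiringAction G B] [IsGaloisGroup G A B] {P : Ideal B} [P.IsMaximal] [Finite (B ⧸ P)]
    (hP : P ≠ ⊥) :
    ∀ᶠ n in Filter.atTop, ∑ i ∈ Finset.range n, Nat.card ((P ^ (i + 1)).inertia G) =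
      multiplicity P (differentIdeal A B) + n := by
  classical
  have := Fintype.ofFinite G
  have := Algebra.IsInvariant.isIntegral A B G
  have hPA : (P.under A).IsMaximal := Ideal.IsMaximal.under A P
  obtain ⟨α, q, hαP, hαQ, hϖ, hϖ2, hsurj⟩ := Ideal.exists_residue_generator hP
    (Finset.univ.image fun g : G => g • P) (by
      simp only [Finset.mem_image, Finset.mem_univ, true_and, forall_exists_index]
      rintro _ g rfl
      exact ⟨inferInstance, fun h => hP (by
        rw [← inv_smul_smul g P, h]; exact Ideal.map_bot)⟩)
  have hαg (g : G) (hg : g • P ≠ P) : α ∈ g • P := hαQ _ (by simp) hg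
  have hsurj' (x : B) : ∃ c ∈ Algebra.adjoin A {α}, x - c ∈ P := by
    obtain ⟨c, hc, h⟩ := hsurj x
    exact ⟨c, Algebra.adjoin_le (S := (Algebra.adjoin A {α}).restrictScalars ℤ)
      (by simp) hc, h⟩
  have hϖC : α ^ q - α ∈ Algebra.adjoin A {α} :=
    sub_mem (pow_mem (Algebra.self_mem_adjoin_singleton A α) q)
      (Algebra.self_mem_adjoin_singleton A α)
  obtain ⟨c, hc, hcP⟩ := exists_mem_conductor_notMem hαP (fun Q hQ hQP hne => by
      obtain ⟨g, rfl⟩ := Algebra.IsInvariant.exists_smul_of_under_eq A B G P Q hQP.symm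
      exact hαg g hne) hϖC hϖ hϖ2 hsurj'
  have hfaith : FaithfulSMul G B := IsGaloisGroup.faithful A
  have hstab (g : G) (hg : g • α = α) : g = 1 :=
    smul_eq_of_mem_conductor hg hc (fun h => hcP (h ▸ zero_mem P))
  have hne (g : G) (hg : g ∈ Finset.univ.erase (1 : G)) : α - g • α ≠ 0 := fun h =>
    (Finset.mem_erase.1 hg).1 (hstab g (sub_eq_zero.1 h).symm)
  have hprod := aeval_derivative_minpoly_eq_prod (A := A) hstab
  have hmult : multiplicity P (differentIdeal A B) =
      ∑ g ∈ Finset.univ.erase (1 : G), multiplicity P (Ideal.span {α - g • α}) := by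
    rw [multiplicity_differentIdeal_eq hP hc hcP, hprod]
    · have hs (s : Finset G) (hs : s ⊆ Finset.univ.erase 1) :
          multiplicity P (Ideal.span {∏ g ∈ s, (α - g • α)}) =
            ∑ g ∈ s, multiplicity P (Ideal.span {α - g • α}) := by
        induction s using Finset.induction_on with
        | empty =>
          simp only [Finset.prod_empty, Finset.sum_empty, Ideal.span_singleton_one]
          exact multiplicity_eq_zero.2 fun h => (Ideal.IsPrime.ne_top ‹P.IsMaximal›.isPrime)
            (top_le_iff.1 (Ideal.dvd_iff_le.1 h))
        | insert a s ha ih =>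
          rw [Finset.prod_insert ha, Finset.sum_insert ha, ← ih fun x hx => hs
            (Finset.mem_insert_of_mem hx), ← Ideal.span_singleton_mul_span_singleton]
          refine Ideal.multiplicity_mul_of_isPrime hP ?_ ?_
          · simpa using hne a (hs (Finset.mem_insert_self a s))
          · simpa [Finset.prod_eq_zero_iff] using
              fun x hx => hne x (hs (Finset.mem_insert_of_mem hx))
      exact hs _ subset_rfl
    · rw [hprod]
      exact Finset.prod_ne_zero_iff.2 hne
  -- Ramification groups can be tested on `α` alone, since every `x` agrees modulo `P ^ (i + 1)`
  -- with an element of `A[α]`.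
  have hmem (g : G) (i : ℕ) : g ∈ (P ^ (i + 1)).inertia G ↔ α - g • α ∈ P ^ (i + 1) := by
    rw [sub_mem_comm_iff]
    refine ⟨fun h => h α, fun h x => ?_⟩
    -- If `g` moved `P`, then `α ∈ g⁻¹ • P`, so `g • α`, and with it `α`, would lie in `P`.
    have hgP : g • P = P := by
      by_contra hgP
      have h1 : g⁻¹ • P ≠ P := fun h => hgP (by conv_lhs => rw [← h, smul_inv_smul])
      have h2 := Ideal.mem_inv_pointwise_smul_iff.1 (hαg g⁻¹ h1)
      have h3 := Ideal.pow_le_self (Nat.succ_ne_zero i) h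
      exact hαP (by simpa using sub_mem h2 h3)
    obtain ⟨d, hd, hxd⟩ := Ideal.exists_mem_sub_mem_pow hP hϖC hϖ hϖ2 hsurj' (i + 1) x
    have h4 : g • (x - d) ∈ P ^ (i + 1) := by
      have := Ideal.smul_mem_pointwise_smul g _ _ hxd
      rwa [smul_pow', hgP] at this
    have : g • x - x = g • (x - d) - (x - d) + (g • d - d) := by rw [smul_sub]; ring
    change g • x - x ∈ P ^ (i + 1)
    rw [this]
    exact add_mem (sub_mem h4 hxd) (smul_sub_mem_of_mem_adjoin h hd)
  filter_upwards [Filter.eventually_ge_atTop (multiplicity P (differentIdeal A B))] with n hn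
  have h1 (i : ℕ) : Nat.card ((P ^ (i + 1)).inertia G) =
      ∑ g : G, if g ∈ (P ^ (i + 1)).inertia G then 1 else 0 := by
    rw [Finset.sum_boole, Nat.card_eq_fintype_card, Fintype.card_subtype]
    rfl
  simp_rw [h1]
  -- Count pairs by `g`: the identity contributes `n`, any other `g` the multiplicity of `α - g •
  -- α`. That multiplicity is at most `n`, being a summand of the exponent of the different.
  rw [Finset.sum_comm, ← Finset.add_sum_erase _ _ (Finset.mem_univ (1 : G)), add_comm, hmult]
  congr 1
  · refine Finset.sum_congr rfl fun g hg => ?_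
    simp_rw [hmem, Ideal.mem_pow_iff_le_multiplicity hP (hne g hg)]
    rw [Finset.sum_boole]
    have hle : multiplicity P (Ideal.span {α - g • α}) ≤ n :=
      le_trans (Finset.single_le_sum (f := fun g => multiplicity P (Ideal.span {α - g • α}))
        (fun _ _ => Nat.zero_le _) hg) (hmult ▸ hn)
    have : Finset.filter (fun i => i + 1 ≤ multiplicity P (Ideal.span {α - g • α}))
        (Finset.range n) = Finset.range (multiplicity P (Ideal.span {α - g • α})) := by
      ext i
      simp only [Finset.mem_filter, Finset.mem_range]
      omega
    rw [this, Finset.card_range, Nat.cast_id]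
  · simp [one_mem]

end Hilbert

end

section

open Pointwise

/-! ### Norms of differents and ramification groups along a Galois orbit -/

section PrimeMultiplicity

variable {B : Type*} [CommRing B] [IsDedekindDomain B]

theorem Ideal.multiplicity_top {Q : Ideal B} (hQ : Q ≠ ⊤) : multiplicity Q ⊤ = 0 :=
  multiplicity_eq_zero.2 fun h => hQ (top_le_iff.1 (Ideal.dvd_iff_le.1 h))

theorem Ideal.multiplicity_eq_zero_of_ne {P Q : Ideal B} [P.IsPrime] [Q.IsMaximal]
    (h : P ≠ Q) : multiplicity P Q = 0 :=
  multiplicity_eq_zero.2 fun hd => h <|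
    (Ideal.IsMaximal.eq_of_le ‹_› (Ideal.IsPrime.ne_top ‹_›) (Ideal.dvd_iff_le.1 hd)).symm

theorem Ideal.multiplicity_pow_self {P : Ideal B} [P.IsPrime] (hP : P ≠ ⊥) (n : ℕ) :
    multiplicity P (P ^ n) = n :=
  _root_.multiplicity_pow_self hP
    (fun h => Ideal.IsPrime.ne_top ‹_› (Ideal.isUnit_iff.1 h)) n

end PrimeMultiplicity

section RelNorm

variable (R : Type*) {B : Type*} [CommRing R] [IsDedekindDomain R] [CharZero R] [CommRing B]
  [IsDedekindDomain B] [Algebra R B] [Module.Finite R B] [Module.IsTorsionFree R B]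

theorem perfectField_fractionRing (R : Type*) [CommRing R] [IsDomain R] [CharZero R] :
    PerfectField (FractionRing R) :=
  have : CharZero (FractionRing R) :=
    charZero_of_injective_algebraMap (IsFractionRing.injective R (FractionRing R))
  inferInstance

section

attribute [local instance] FractionRing.liftAlgebra FractionRing.isScalarTower_liftAlgebra

theorem isSeparable_fractionRing (R B : Type*) [CommRing R] [IsDomain R] [CharZero R] [CommRing B]
    [IsDedekindDomain B] [Algebra R B] [Module.Finite R B] [Module.IsTorsionFree R B] :
    Algebra.IsSeparable (FractionRing R) (FractionRing B) := by
  have := perfectField_fractionRing R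
  have : Algebra.IsIntegral R B := .of_finite R B
  have : IsLocalization (Algebra.algebraMapSubmonoid B (nonZeroDivisors R)) (FractionRing B) :=
    IsIntegralClosure.isLocalization R (FractionRing R) (FractionRing B) B
  have : FiniteDimensional (FractionRing R) (FractionRing B) :=
    .of_isLocalization R B (nonZeroDivisors R)
  infer_instance

theorem differentIdeal_ne_bot_of_charZero : differentIdeal R B ≠ ⊥ :=
  have := isSeparable_fractionRing R B
  differentIdeal_ne_bot

theorem differentIdeal_mul_of_charZero (A : Type*) [CommRing A] [IsDedekindDomain A] [Algebra R A]
    [Algebra A B] [IsScalarTower R A B] [Module.Finite R A] [Module.Finite A B]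
    [Module.IsTorsionFree R A] [Module.IsTorsionFree A B] :
    differentIdeal R B = differentIdeal A B * (differentIdeal R A).map (algebraMap A B) :=
  have := isSeparable_fractionRing R B
  differentIdeal_eq_differentIdeal_mul_differentIdeal R A B

end

/-- The multiplicity of `p` in the norm of an ideal. -/
theorem multiplicity_relNorm (p : Ideal R) [p.IsMaximal] (hp : p ≠ ⊥) (T : Finset (Ideal B))
    (hT : ∀ Q, Q ∈ T ↔ Q.IsPrime ∧ Q.LiesOver p) {I : Ideal B} (hI : I ≠ ⊥) :
    multiplicity p (Ideal.relNorm R I) = ∑ Q ∈ T, Q.inertiaDeg R * multiplicity Q I := by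
  have := perfectField_fractionRing R
  have hTbot {Q : Ideal B} (hQ : Q ∈ T) : Q ≠ ⊥ := by
    have := ((hT Q).1 hQ).2
    exact Ideal.ne_bot_of_liesOver_of_ne_bot hp Q
  induction I using UniqueFactorizationMonoid.induction_on_prime with
  | h₁ => exact (hI rfl).elim
  | h₂ I hI' =>
    rw [Ideal.isUnit_iff.1 hI', Ideal.relNorm_top]
    rw [Ideal.multiplicity_top Ideal.IsPrime.ne_top']
    exact (Finset.sum_eq_zero fun Q hQ => by
      rw [Ideal.multiplicity_top ((hT Q).1 hQ).1.ne_top, mul_zero]).symm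
  | h₃ I Q hI0 hQ ih =>
    have hQbot : Q ≠ ⊥ := hQ.ne_zero
    have hQprime : Q.IsPrime := Ideal.isPrime_of_prime hQ
    have hQmax : Q.IsMaximal := hQprime.isMaximal hQbot
    have hQmax' : (Q.under R).IsMaximal := Ideal.IsMaximal.under R Q
    have hQ' : Q.under R ≠ ⊥ := Ideal.under_ne_bot R hQbot
    rw [map_mul, Ideal.multiplicity_mul_of_isPrime hp (by simpa using hQbot)
      (by simpa using hI0), ih hI0, Ideal.relNorm_eq_pow_of_isMaximal Q (Q.under R)]
    have hmul (P : Ideal B) (hP : P ∈ T) : P.inertiaDeg R * multiplicity P (Q * I) =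
        P.inertiaDeg R * multiplicity P Q + P.inertiaDeg R * multiplicity P I := by
      have := ((hT P).1 hP).1
      rw [Ideal.multiplicity_mul_of_isPrime (hTbot hP) hQbot hI0, mul_add]
    rw [Finset.sum_congr rfl hmul, Finset.sum_add_distrib, Nat.add_right_cancel_iff]
    by_cases h : Q ∈ T
    · have hpQ : p = Q.under R := ((hT Q).1 h).2.over
      rw [← hpQ, Ideal.multiplicity_pow_self hp, Finset.sum_eq_single_of_mem Q h]
      · have := Ideal.multiplicity_pow_self hQbot 1
        rw [pow_one] at this
        rw [this, mul_one]
      · intro P hP hPQ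
        have := ((hT P).1 hP).1
        rw [Ideal.multiplicity_eq_zero_of_ne hPQ, mul_zero]
    · have hpQ : p ≠ Q.under R := fun hpQ => h ((hT Q).2 ⟨hQprime, ⟨hpQ⟩⟩)
      rw [Finset.sum_eq_zero, FiniteMultiplicity.multiplicity_pow (Ideal.prime_of_isPrime hp
        inferInstance) (Ideal.finiteMultiplicity_of_isPrime hp hQ'),
        Ideal.multiplicity_eq_zero_of_ne hpQ, mul_zero]
      intro P hP
      have := ((hT P).1 hP).1
      rw [Ideal.multiplicity_eq_zero_of_ne (fun hPQ : P = Q => h (hPQ ▸ hP)), mul_zero]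

end RelNorm

section Orbits

/-- The fibres of `g ↦ g • x` are cosets of the stabilizer. -/
theorem MulAction.sum_smul_eq_card_stabilizer_mul {G X : Type*} [Group G] [Fintype G]
    [MulAction G X] (x : X) (F : X → ℕ) (T : Finset X) (hT : ∀ y, y ∈ T ↔ y ∈ orbit G x) :
    ∑ g : G, F (g • x) = Nat.card (stabilizer G x) * ∑ y ∈ T, F y := by
  classical
  have himage : Finset.univ.image (fun g : G => g • x) = T := by
    ext y
    simp [hT, mem_orbit_iff]
  rw [Finset.sum_comp F, himage, Finset.mul_sum]
  refine Finset.sum_congr rfl fun y hy => ?_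
  obtain ⟨g, rfl⟩ := (hT y).1 hy
  rw [smul_eq_mul]
  congr 1
  rw [Nat.card_eq_fintype_card, Fintype.card_subtype]
  refine (Finset.card_bij (fun h _ => g * h) (fun h hh => ?_) (fun _ _ _ _ h => mul_left_cancel h)
    fun h hh => ⟨g⁻¹ * h, ?_, by simp⟩).symm
  · simp only [Finset.mem_filter, Finset.mem_univ, true_and, mem_stabilizer_iff] at hh ⊢
    rw [mul_smul, hh]
  · simp only [Finset.mem_filter, Finset.mem_univ, true_and, mem_stabilizer_iff] at hh ⊢
    rw [mul_smul, hh, inv_smul_smul]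

end Orbits

section Ramification

variable {B Γ : Type*} [CommRing B] [Group Γ] [MulSemiringAction Γ B]

theorem Ideal.inertia_smul (I : Ideal B) (γ : Γ) :
    (γ • I).inertia Γ = (I.inertia Γ).map (MulAut.conj γ).toMonoidHom := by
  ext g
  erw [Subgroup.mem_map_equiv]
  rw [MulAut.conj_symm_apply]
  change (∀ x, g • x - x ∈ γ • I) ↔ ∀ x, (γ⁻¹ * g * γ) • x - x ∈ I
  have (x : B) : (γ⁻¹ * g * γ) • x - x = γ⁻¹ • (g • γ • x - γ • x) := by
    rw [smul_sub, inv_smul_smul, mul_smul, mul_smul]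
  simp_rw [this, ← Ideal.mem_pointwise_smul_iff_inv_smul_mem]
  exact ⟨fun h x => h _, fun h x => by simpa using h (γ⁻¹ • x)⟩

theorem Ideal.card_inertia_subgroup (I : Ideal B) (H : Subgroup Γ) :
    Nat.card (I.inertia H) = Nat.card ↥(I.inertia Γ ⊓ H) := by
  have := AddSubgroup.inertia_map_subtype I.toAddSubgroup H
  change _ = Nat.card ↥(I.toAddSubgroup.inertia Γ ⊓ H)
  rw [← this]
  exact Nat.card_congr (Subgroup.equivMapOfInjective _ _ H.subtype_injective).toEquiv

/-- Let `B / R` be Galois with group `Γ`, and `A = B ^ H`. The valuation at a prime of `R` of the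
norm to `R` of the different of `B / A`, in terms of the ramification groups at a prime
of `B`. -/
theorem card_inertia_mul_multiplicity_relNorm_differentIdeal (R : Type*) [CommRing R]
    [IsDedekindDomain R] [CharZero R] [Algebra R B] [IsDedekindDomain B] [Module.Finite R B]
    [Module.IsTorsionFree R B] [Fintype Γ] [IsGaloisGroup Γ R B] {p : Ideal R} [p.IsMaximal]
    [Finite (R ⧸ p)] (hp : p ≠ ⊥) (P : Ideal B) [P.IsPrime] [P.LiesOver p] (H : Subgroup Γ)
    (A : Type*) [CommRing A] [IsDedekindDomain A] [CharZero A] [Algebra A B] [Module.Finite A B]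
    [Module.IsTorsionFree A B] [IsGaloisGroup H A B] :
    ∀ᶠ n in Filter.atTop, ∑ γ : Γ, ∑ i ∈ Finset.range n,
        Nat.card ↥(((P ^ (i + 1)).inertia Γ).map (MulAut.conj γ).toMonoidHom ⊓ H) =
      Nat.card (P.inertia Γ) * multiplicity p (Ideal.relNorm R (differentIdeal A B)) +
        Nat.card Γ * n := by
  classical
  let T : Finset (Ideal B) := Finset.univ.image fun γ : Γ => γ • P
  have hTorbit (Q : Ideal B) : Q ∈ T ↔ Q ∈ MulAction.orbit Γ P := by
    simp [T, MulAction.mem_orbit_iff]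
  have hT (Q : Ideal B) : Q ∈ T ↔ Q.IsPrime ∧ Q.LiesOver p := by
    rw [hTorbit, Algebra.IsInvariant.orbit_eq_primesOver R B Γ p P]
    rfl
  have hTmax (Q : Ideal B) (hQ : Q ∈ T) : Q.IsMaximal ∧ Q ≠ ⊥ ∧ Finite (B ⧸ Q) := by
    have h1 := ((hT Q).1 hQ).1
    have h2 := ((hT Q).1 hQ).2
    have : Q ≠ ⊥ := Ideal.ne_bot_of_liesOver_of_ne_bot hp Q
    refine ⟨h1.isMaximal this, this, ?_⟩
    have : Module.Finite (R ⧸ p) (B ⧸ Q) := inferInstance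
    exact Module.finite_of_finite (R ⧸ p)
  have hD : differentIdeal A B ≠ ⊥ := differentIdeal_ne_bot_of_charZero A
  have hev : ∀ Q ∈ T, ∀ᶠ n in Filter.atTop, ∑ i ∈ Finset.range n,
      Nat.card ↥((Q ^ (i + 1)).inertia Γ ⊓ H) = multiplicity Q (differentIdeal A B) + n := by
    intro Q hQ
    obtain ⟨h1, h2, h3⟩ := hTmax Q hQ
    simp_rw [← Ideal.card_inertia_subgroup]
    exact sum_card_inertia_eq_multiplicity_differentIdeal_add A H h2
  have hPT : P ∈ T := (hTorbit P).2 (MulAction.mem_orbit_self P)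
  have hPmax := (hTmax P hPT).1
  -- The residue degree in the order of the decomposition group turns the sum of the multiplicities
  -- of the different at the primes above `p` into the multiplicity of its norm.
  have hstab : Nat.card (MulAction.stabilizer Γ P) =
      Nat.card (P.inertia Γ) * P.inertiaDeg R := by
    have : Finite p.ResidueField := by
      have := IsFractionRing.surjective_iff_isField (R := R ⧸ p) (K := p.ResidueField) |>.2
        (Ideal.Quotient.maximal_ideal_iff_isField_quotient p |>.1 inferInstance)
      exact Finite.of_surjective _ this
    exact Ideal.card_stabilizer_eq_card_inertia_mul_finrank p P
  have hf (Q : Ideal B) (hQ : Q ∈ T) : Q.inertiaDeg R = P.inertiaDeg R := by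
    have := ((hT Q).1 hQ).1
    have := ((hT Q).1 hQ).2
    exact Ideal.inertiaDeg_eq_of_isGaloisGroup p Q P Γ
  have hsum (F : Ideal B → ℕ) := MulAction.sum_smul_eq_card_stabilizer_mul (G := Γ) P F T hTorbit
  filter_upwards [(Filter.eventually_all_finset T).2 hev] with n hn
  -- Conjugation by `γ` carries the ramification groups at `P` to those at `γ • P`, so the sum over
  -- `Γ` becomes a sum over the primes above `p`.
  have h1 (γ : Γ) (i : ℕ) : ((P ^ (i + 1)).inertia Γ).map (MulAut.conj γ).toMonoidHom =
      ((γ • P) ^ (i + 1)).inertia Γ := by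
    rw [← Ideal.inertia_smul, smul_pow']
  simp_rw [h1]
  rw [hsum fun Q => ∑ i ∈ Finset.range n, Nat.card ↥((Q ^ (i + 1)).inertia Γ ⊓ H),
    Finset.sum_congr rfl hn, Finset.sum_add_distrib, mul_add,
    multiplicity_relNorm R p hp T hT hD, hstab]
  congr 1
  · rw [mul_assoc, Finset.mul_sum]
    congr 1
    exact Finset.sum_congr rfl fun Q hQ => by rw [hf Q hQ]
  · have := hsum fun _ => 1
    rw [← hstab, Finset.sum_const, smul_eq_mul, ← mul_assoc]
    congr 1
    simpa [Nat.card_eq_fintype_card] using this.symm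

end Ramification

section Tower

variable {B Γ : Type*} [CommRing B] [Group Γ] [MulSemiringAction Γ B]

/-- Transitivity of the different; the norm to `A'` of an ideal extended from `A'` is its power with
exponent the rank of `B`. -/
theorem multiplicity_relNorm_differentIdeal_tower (R : Type*) [CommRing R]
    [IsDedekindDomain R] [CharZero R] [Algebra R B] [IsDedekindDomain B] [Module.Finite R B]
    [Module.IsTorsionFree R B] {p : Ideal R} [p.IsMaximal] (hp : p ≠ ⊥)
    (A A' : Type*) [CommRing A] [IsDedekindDomain A] [CharZero A] [Algebra A B] [Module.Finite A B]
    [Module.IsTorsionFree A B] [CommRing A'] [IsDedekindDomain A'] [Algebra A' B]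
    [Module.Finite A' B] [Module.IsTorsionFree A' B] [Algebra A A'] [IsScalarTower A A' B]
    [Module.Finite A A'] [Module.IsTorsionFree A A'] [Algebra R A'] [IsScalarTower R A' B]
    [Module.Finite R A'] [Module.IsTorsionFree R A'] :
    multiplicity p (Ideal.relNorm R (differentIdeal A B)) =
      multiplicity p (Ideal.relNorm R (differentIdeal A' B)) +
        Module.finrank A' B * multiplicity p (Ideal.relNorm R (differentIdeal A A')) := by
  have h1 : differentIdeal A B ≠ ⊥ := differentIdeal_ne_bot_of_charZero A
  have h3 : differentIdeal A A' ≠ ⊥ := differentIdeal_ne_bot_of_charZero A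
  rw [differentIdeal_mul_of_charZero A A'] at h1 ⊢
  have h2 : differentIdeal A' B ≠ ⊥ := fun h => h1 (by rw [h, Ideal.bot_mul])
  have h4 : (differentIdeal A A').map (algebraMap A' B) ≠ ⊥ := fun h =>
    h1 (by rw [h, Ideal.mul_bot])
  rw [map_mul, Ideal.multiplicity_mul_of_isPrime hp (by simpa using h2) (by simpa using h4),
    ← Ideal.relNorm_relNorm R A' (Ideal.map _ _), Ideal.relNorm_algebraMap, map_pow,
    FiniteMultiplicity.multiplicity_pow (Ideal.prime_of_isPrime hp inferInstance)
      (Ideal.finiteMultiplicity_of_isPrime hp (by simpa using h3))]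

/-- Let `B / R` be Galois with group `Γ`, and `A ≤ A'` the subrings fixed by `H' ≤ H`. The
valuation at a prime of `R` of the norm to `R` of the different of `A' / A`, in terms of the
ramification groups at a prime of `B`. -/
theorem sum_card_inertia_inf_eq (R : Type*) [CommRing R]
    [IsDedekindDomain R] [CharZero R] [Algebra R B] [IsDedekindDomain B] [Module.Finite R B]
    [Module.IsTorsionFree R B] [Fintype Γ] [IsGaloisGroup Γ R B] {p : Ideal R} [p.IsMaximal]
    [Finite (R ⧸ p)] (hp : p ≠ ⊥) (P : Ideal B) [P.IsPrime] [P.LiesOver p] (H H' : Subgroup Γ)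
    (A A' : Type*) [CommRing A] [IsDedekindDomain A] [CharZero A] [Algebra A B] [Module.Finite A B]
    [Module.IsTorsionFree A B] [IsGaloisGroup H A B] [CommRing A'] [IsDedekindDomain A']
    [CharZero A'] [Algebra A' B] [Module.Finite A' B] [Module.IsTorsionFree A' B]
    [IsGaloisGroup H' A' B] [Algebra A A'] [IsScalarTower A A' B]
    [Module.Finite A A'] [Module.IsTorsionFree A A'] [Algebra R A'] [IsScalarTower R A' B]
    [Module.Finite R A'] [Module.IsTorsionFree R A'] :
    ∀ᶠ n in Filter.atTop, ∑ γ : Γ, ∑ i ∈ Finset.range n,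
        Nat.card ↥(((P ^ (i + 1)).inertia Γ).map (MulAut.conj γ).toMonoidHom ⊓ H) =
      ∑ γ : Γ, ∑ i ∈ Finset.range n,
        Nat.card ↥(((P ^ (i + 1)).inertia Γ).map (MulAut.conj γ).toMonoidHom ⊓ H') +
      Nat.card (P.inertia Γ) * Nat.card H' *
        multiplicity p (Ideal.relNorm R (differentIdeal A A')) := by
  filter_upwards [card_inertia_mul_multiplicity_relNorm_differentIdeal R hp P H A,
    card_inertia_mul_multiplicity_relNorm_differentIdeal R hp P H' A'] with n h h'
  rw [h, h', multiplicity_relNorm_differentIdeal_tower R hp A A',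
    IsGaloisGroup.card_eq_finrank' H' A' B]
  ring

end Tower

end

section

open Module

/-! ### The discriminant ideal as the norm of the different -/

section TraceMatrix

variable {K L : Type*} [Field K] [Field L] [Algebra K L] {ι : Type*} [Fintype ι] [DecidableEq ι]

/-- The matrix is the trace matrix of `b` times the matrix of multiplication by `x`. -/
theorem Algebra.det_trace_mul_mul (b : Basis ι K L) (x : L) :
    (Matrix.of fun i j => Algebra.trace K L (x * b i * b j)).det =
      Algebra.norm K x * Algebra.discr K b := by
  rw [Algebra.norm_eq_matrix_det b, Algebra.discr_def, mul_comm, ← Matrix.det_mul]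
  congr 1
  ext i j
  simp only [Matrix.of_apply, Matrix.mul_apply, Algebra.traceMatrix_apply, Algebra.traceForm_apply,
    Algebra.leftMulMatrix_eq_repr_mul]
  calc Algebra.trace K L (x * b i * b j)
      = Algebra.trace K L (b i * ∑ k, b.repr (x * b j) k • b k) := by
        rw [b.sum_repr]; congr 1; ring
    _ = _ := by
        rw [Finset.mul_sum, map_sum]
        refine Finset.sum_congr rfl fun k _ => ?_
        rw [mul_smul_comm, map_smul, smul_eq_mul, mul_comm]

/-- The coordinates of `b` in its dual basis are the entries of its trace matrix, so the trace
matrices of the two bases are inverse to each other. -/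
theorem Algebra.discr_mul_discr_traceDual [FiniteDimensional K L] [Algebra.IsSeparable K L]
    (b : Basis ι K L) :
    Algebra.discr K b * Algebra.discr K b.traceDual = 1 := by
  rw [Algebra.discr_def, Algebra.discr_def, ← Matrix.det_mul, ← Matrix.det_one (n := ι)]
  congr 1
  ext i j
  simp only [Matrix.mul_apply, Algebra.traceMatrix_apply, Matrix.one_apply]
  calc ∑ k, traceForm K L (b i) (b k) * traceForm K L (b.traceDual k) (b.traceDual j)
      = traceForm K L (∑ k, traceForm K L (b i) (b k) • b.traceDual k) (b.traceDual j) := by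
        rw [map_sum, LinearMap.sum_apply]
        exact Finset.sum_congr rfl fun k _ => by
          rw [map_smul, LinearMap.smul_apply, smul_eq_mul]
    _ = traceForm K L (b i) (b.traceDual j) := by
        congr 2
        conv_rhs => rw [← b.traceDual.sum_repr (b i)]
        exact Finset.sum_congr rfl fun k _ => by rw [Basis.traceDual_repr_apply]
    _ = _ := by rw [traceForm_apply, Basis.trace_mul_traceDual]

end TraceMatrix

section Discriminant

variable (A K L B : Type*) [CommRing A] [IsDedekindDomain A] [Field K] [Algebra A K]
  [IsFractionRing A K] [Field L] [Algebra K L] [FiniteDimensional K L] [Algebra.IsSeparable K L]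
  [Algebra A L] [IsScalarTower A K L] [CommRing B] [IsDedekindDomain B] [Algebra A B]
  [Algebra B L] [IsScalarTower A B L] [IsFractionRing B L] [IsIntegralClosure B A L]
  [Module.Finite A B] [IsTorsionFree A B]

omit [FiniteDimensional K L] [IsTorsionFree A B] in
/-- A basis of `L / K` that generates `B` locally at a maximal ideal `q` of `A`. -/
theorem exists_basis_smul_mem_span (q : Ideal A) [q.IsMaximal] :
    ∃ (b : Basis (Fin (finrank K L)) K L) (b' : Fin (finrank K L) → B) (s : A),
      s ∉ q ∧ (∀ i, b i = algebraMap B L (b' i)) ∧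
        ∀ x : B, s • x ∈ Submodule.span A (Set.range b') := by
  let _ : Field (A ⧸ q) := Ideal.Quotient.field q
  have hrank : finrank (A ⧸ q) (B ⧸ q.map (algebraMap A B)) = finrank K L :=
    Ideal.finrank_quotient_map q K L
  let b₀ := finBasisOfFinrankEq (A ⧸ q) (B ⧸ q.map (algebraMap A B)) hrank
  choose b' hb' using fun i => Ideal.Quotient.mk_surjective (b₀ i)
  let N : Submodule A B := Submodule.span A (Set.range b')
  -- The lifts `b'` generate `B` modulo `q B`; Nakayama's lemma gives `s`, congruent to 1 modulo
  -- `q`, that multiplies `B` into their span.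
  have htop : (⊤ : Submodule A (B ⧸ N)) ≤ q • ⊤ := by
    rintro x -
    obtain ⟨x, rfl⟩ := Submodule.Quotient.mk_surjective N x
    have hx := b₀.sum_repr (Ideal.Quotient.mk _ x)
    choose c hc using fun i => Ideal.Quotient.mk_surjective
      (b₀.repr (Ideal.Quotient.mk (q.map (algebraMap A B)) x) i)
    have hN : ∑ i, c i • b' i ∈ N :=
      sum_mem fun i _ => N.smul_mem _ (Submodule.subset_span ⟨i, rfl⟩)
    have hmem : x - ∑ i, c i • b' i ∈ q.map (algebraMap A B) := by
      rw [← Ideal.Quotient.eq, ← hx, map_sum]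
      refine Finset.sum_congr rfl fun i _ => ?_
      rw [← hc, ← hb', Algebra.smul_def, Algebra.smul_def, map_mul]
      rfl
    have h1 : Submodule.Quotient.mk x =
        (Submodule.Quotient.mk (x - ∑ i, c i • b' i) : B ⧸ N) := by
      rw [Submodule.Quotient.eq, sub_sub_cancel]
      exact hN
    rw [h1]
    have h2 : x - ∑ i, c i • b' i ∈ (q • (⊤ : Submodule A B)) := by
      have := Ideal.smul_top_eq_map (R := A) (S := B) q
      rw [this, Submodule.restrictScalars_mem]
      exact hmem
    have h3 := Submodule.mem_map_of_mem (f := N.mkQ) h2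
    rw [Submodule.map_smul''] at h3
    exact Submodule.smul_mono le_rfl le_top h3
  obtain ⟨s, hs, hs'⟩ := Submodule.exists_sub_one_mem_and_smul_eq_zero_of_fg_of_le_smul q ⊤
    Module.Finite.fg_top htop
  have hsq : s ∉ q := fun h => Ideal.IsMaximal.ne_top ‹_› ((Ideal.eq_top_iff_one q).2 (by
    simpa using sub_mem h hs))
  have hspan (x : B) : s • x ∈ N := by
    have := hs' (Submodule.Quotient.mk x) trivial
    rwa [← Submodule.Quotient.mk_smul, Submodule.Quotient.mk_eq_zero] at this
  have hs0 : algebraMap A K s ≠ 0 := by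
    rw [Ne, FaithfulSMul.algebraMap_eq_zero_iff]
    rintro rfl
    exact hsq (zero_mem q)
  have hsmul (a : A) (y : B) : algebraMap B L (a • y) = algebraMap A K a • algebraMap B L y := by
    simp only [Algebra.smul_def, map_mul, ← IsScalarTower.algebraMap_apply]
  have hB (x : B) : algebraMap B L x ∈
      Submodule.span K (Set.range fun i => algebraMap B L (b' i)) := by
    have h1 : algebraMap B L (s • x) ∈
        Submodule.span K (Set.range fun i => algebraMap B L (b' i)) := by
      have := hspan x
      refine Submodule.span_induction (p := fun y _ => algebraMap B L y ∈
        Submodule.span K (Set.range fun i => algebraMap B L (b' i))) ?_ ?_ ?_ ?_ this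
      · rintro _ ⟨i, rfl⟩
        exact Submodule.subset_span ⟨i, rfl⟩
      · simp
      · intro y z _ _ hy hz
        rw [map_add]
        exact add_mem hy hz
      · intro a y _ hy
        rw [hsmul]
        exact Submodule.smul_mem _ _ hy
    rw [hsmul] at h1
    exact (Submodule.smul_mem_iff _ hs0).1 h1
  have hLspan : ⊤ ≤ Submodule.span K (Set.range fun i => algebraMap B L (b' i)) := by
    rintro x -
    have : IsLocalization (Algebra.algebraMapSubmonoid B (nonZeroDivisors A)) L :=
      IsIntegralClosure.isLocalization A K L B
    obtain ⟨y, z, rfl⟩ := IsLocalization.exists_mk'_eq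
      (Algebra.algebraMapSubmonoid B (nonZeroDivisors A)) x
    obtain ⟨_, a, ha, rfl⟩ := z
    have ha0 : algebraMap A K a ≠ 0 := by
      rw [Ne, FaithfulSMul.algebraMap_eq_zero_iff]
      exact nonZeroDivisors.ne_zero ha
    rw [← Submodule.smul_mem_iff _ ha0, Algebra.smul_def, ← IsScalarTower.algebraMap_apply A K L,
      IsScalarTower.algebraMap_apply A B L, mul_comm]
    have := IsLocalization.mk'_spec L y
      (⟨_, a, ha, rfl⟩ : Algebra.algebraMapSubmonoid B (nonZeroDivisors A))
    rw [this]
    exact hB y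
  refine ⟨basisOfTopLeSpanOfCardEqFinrank _ hLspan (by simp), b', s, hsq, fun i => ?_, hspan⟩
  rw [coe_basisOfTopLeSpanOfCardEqFinrank]

/-- A local generator of the different. -/
theorem exists_local_generator_differentIdeal (q : Ideal A) [q.IsMaximal] (hq : q ≠ ⊥) :
    ∃ (δ : B) (t : A), t ∉ q ∧ δ ∈ differentIdeal A B ∧
      (∀ x ∈ differentIdeal A B, ∃ y, t • x = δ * y) ∧
      (∃ y ∈ FractionalIdeal.dual A K (1 : FractionalIdeal (nonZeroDivisors B) L),
        algebraMap A L t = algebraMap B L δ * y) ∧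
      ∀ y ∈ FractionalIdeal.dual A K (1 : FractionalIdeal (nonZeroDivisors B) L),
        ∃ x, algebraMap B L δ * y = algebraMap B L x := by
  have h10 : (1 : FractionalIdeal (nonZeroDivisors B) L) ≠ 0 := one_ne_zero
  let D := differentIdeal A B
  let M := Algebra.algebraMapSubmonoid B q.primeCompl
  let S := Localization M
  have hM : M ≤ nonZeroDivisors B := by
    refine le_nonZeroDivisors_of_noZeroDivisors ?_
    rintro ⟨x, hx, hx0⟩
    rw [FaithfulSMul.algebraMap_eq_zero_iff] at hx0
    exact hx (hx0 ▸ zero_mem q)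
  have : IsDedekindDomain S := IsLocalization.isDedekindDomain B hM S
  have : IsPrincipalIdealRing S :=
    -- Only the primes above `q` survive in `S`, so the different becomes principal there; `δ` is a
    -- generator with its denominator cleared.
    IsDedekindDomain.isPrincipalIdealRing_localization_over_prime (R := A) B q hq (Sₚ := S)
  have hinj : Function.Injective (algebraMap B S) := IsLocalization.injective S hM
  obtain ⟨z, hz⟩ := (IsPrincipalIdealRing.principal (D.map (algebraMap B S))).principal
  obtain ⟨⟨⟨δ, hδ⟩, m⟩, hm⟩ := (IsLocalization.mem_map_algebraMap_iff M S).1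
    (show z ∈ D.map (algebraMap B S) by rw [hz]; exact Submodule.mem_span_singleton_self z)
  have hspan : Ideal.span {algebraMap B S δ} = D.map (algebraMap B S) := by
    rw [hz, ← hm]
    exact Ideal.span_singleton_mul_right_unit (IsLocalization.map_units S m) z
  have hD0 : D ≠ ⊥ := by
    intro h
    have := coeIdeal_differentIdeal A K L B
    rw [show differentIdeal A B = ⊥ from h] at this
    rw [FractionalIdeal.coeIdeal_bot, eq_comm, inv_eq_zero] at this
    exact FractionalIdeal.dual_ne_zero A K h10 this
  -- The cofactor `J` of the different in `(δ)` is trivial after localization, so it contains some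
  -- `t` outside `q`. As a fractional ideal `J` is `δ` times the dual of `B`, which yields the
  -- remaining claims.
  obtain ⟨J, hJ⟩ := Ideal.dvd_iff_le.2 ((Ideal.span_singleton_le_iff_mem D).2 hδ)
  have hJS : J.map (algebraMap B S) = ⊤ := by
    have h := congrArg (Ideal.map (algebraMap B S)) hJ
    rw [Ideal.map_mul, Ideal.map_span, Set.image_singleton, hspan] at h
    have h0 : D.map (algebraMap B S) ≠ 0 := fun h0 =>
      hD0 ((Ideal.map_eq_bot_iff_of_injective hinj).1 h0)
    exact mul_left_cancel₀ h0 (by rw [← h, Ideal.mul_top])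
  obtain ⟨_, ⟨t, ht, rfl⟩, htJ⟩ := Set.not_disjoint_iff.1 fun h =>
    (IsLocalization.map_algebraMap_ne_top_iff_disjoint M S J).2 h hJS
  have hfrac : (J : FractionalIdeal (nonZeroDivisors B) L) =
      FractionalIdeal.spanSingleton _ (algebraMap B L δ) * FractionalIdeal.dual A K 1 := by
    have h := congrArg (fun I : Ideal B => (I : FractionalIdeal (nonZeroDivisors B) L)) hJ
    simp only [FractionalIdeal.coeIdeal_mul, FractionalIdeal.coeIdeal_span_singleton] at h
    rw [h, show D = differentIdeal A B from rfl, coeIdeal_differentIdeal A K L B, mul_right_comm,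
      inv_mul_cancel₀ (FractionalIdeal.dual_ne_zero A K h10), one_mul]
  refine ⟨δ, t, ht, hδ, fun x hx => ?_, ?_, fun y hy => ?_⟩
  · have : algebraMap A B t * x ∈ Ideal.span {δ} := by
      rw [hJ, mul_comm]
      exact Ideal.mul_mem_mul htJ hx
    obtain ⟨y, hy⟩ := Ideal.mem_span_singleton.1 this
    exact ⟨y, by rw [Algebra.smul_def, hy]⟩
  · have : algebraMap B L (algebraMap A B t) ∈ (J : FractionalIdeal (nonZeroDivisors B) L) :=
      FractionalIdeal.mem_coeIdeal_of_mem _ htJ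
    rw [hfrac, FractionalIdeal.mem_singleton_mul] at this
    rwa [IsScalarTower.algebraMap_apply A B L]
  · have : algebraMap B L δ * y ∈ (J : FractionalIdeal (nonZeroDivisors B) L) := by
      rw [hfrac, FractionalIdeal.mem_singleton_mul]
      exact ⟨y, hy, rfl⟩
    obtain ⟨x, -, hx⟩ := (FractionalIdeal.mem_coeIdeal _).1 this
    exact ⟨x, hx.symm⟩

/-- Locally at `q`, the norm of the different is generated by the discriminant of a local basis. -/
theorem exists_local_discr (q : Ideal A) [q.IsMaximal] (hq : q ≠ ⊥) :
    ∃ (b : Fin (finrank K L) → B) (d : A) (δ : B) (s t a a' : A), s ∉ q ∧ t ∉ q ∧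
      δ ∈ differentIdeal A B ∧
      algebraMap A K d = Algebra.discr K (fun i => algebraMap B L (b i)) ∧
      (∀ x : B, s • x ∈ Submodule.span A (Set.range b)) ∧
      (∀ x ∈ differentIdeal A B, ∃ y, t • x = δ * y) ∧
      s ^ (2 * finrank K L) * Algebra.intNorm A B δ = a * d ∧
      t ^ finrank K L * d = a' * Algebra.intNorm A B δ := by
  classical
  have h10 : (1 : FractionalIdeal (nonZeroDivisors B) L) ≠ 0 := one_ne_zero
  obtain ⟨b, b', s, hs, hb, hspan⟩ := exists_basis_smul_mem_span A K L B q
  obtain ⟨δ, t, ht, hδ, hD, ⟨y, hy, hty⟩, hdual⟩ :=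
    exists_local_generator_differentIdeal A K L B q hq
  have hbfun : (fun i => algebraMap B L (b' i)) = b := funext fun i => (hb i).symm
  have hmemdual (x : L) : x ∈ FractionalIdeal.dual A K (1 : FractionalIdeal (nonZeroDivisors B) L) ↔
      ∀ c : B, Algebra.trace K L (x * algebraMap B L c) ∈ (algebraMap A K).range := by
    rw [FractionalIdeal.mem_dual h10]
    simp [FractionalIdeal.mem_one_iff, -RingHom.mem_range]
  have hinj : Function.Injective (algebraMap A K) := IsFractionRing.injective A K
  have hdet (M : Matrix (Fin (finrank K L)) (Fin (finrank K L)) K)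
      (hM : ∀ i j, M i j ∈ (algebraMap A K).range) : M.det ∈ (algebraMap A K).range := by
    rw [Matrix.det_apply]
    exact sum_mem fun σ _ => zsmul_mem (prod_mem fun i _ => hM _ _) _
  obtain ⟨d, hd⟩ : Algebra.discr K b ∈ (algebraMap A K).range := by
    rw [Algebra.discr_def]
    refine hdet _ fun i j => ?_
    rw [Algebra.traceMatrix_apply, Algebra.traceForm_apply, hb, hb, ← map_mul,
      ← Algebra.algebraMap_intTrace (A := A)]
    exact ⟨_, rfl⟩
  have hNδ : algebraMap A K (Algebra.intNorm A B δ) = Algebra.norm K (algebraMap B L δ) :=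
    Algebra.algebraMap_intNorm δ
  have hNA (x : A) : Algebra.norm K (algebraMap A L x) = algebraMap A K x ^ finrank K L := by
    rw [IsScalarTower.algebraMap_apply A K L, Algebra.norm_algebraMap]
  -- the dual basis, multiplied by `s`, lies in the dual of `B`
  have hsdual (i) : algebraMap A L s * b.traceDual i ∈
      FractionalIdeal.dual A K (1 : FractionalIdeal (nonZeroDivisors B) L) := by
    rw [hmemdual]
    intro c
    have h1 := hspan c
    rw [Submodule.mem_span_range_iff_exists_fun] at h1
    obtain ⟨f, hf⟩ := h1
    refine ⟨f i, ?_⟩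
    have h2 : algebraMap A L s * b.traceDual i * algebraMap B L c =
        ∑ j, algebraMap A K (f j) • (b.traceDual i * b j) := by
      have : algebraMap A L s * algebraMap B L c = algebraMap B L (s • c) := by
        rw [Algebra.smul_def, map_mul, ← IsScalarTower.algebraMap_apply]
      rw [mul_right_comm, this, ← hf, map_sum, Finset.sum_mul]
      refine Finset.sum_congr rfl fun j _ => ?_
      rw [Algebra.smul_def, map_mul, hb j, Algebra.smul_def, ← IsScalarTower.algebraMap_apply,
        ← IsScalarTower.algebraMap_apply]
      ring
    rw [h2, map_sum]
    simp_rw [map_smul, Basis.trace_traceDual_mul]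
    simp
  -- This determinant is `s ^ (2 * n) * N(δ) / d`, where `n = [L : K]`. Its entries lie in `A`
  -- because `s` takes the dual basis into the dual of `B`, and `δ` takes that dual into `B`.
  obtain ⟨a, ha⟩ : (Matrix.of fun i j => Algebra.trace K L
      (algebraMap A L s ^ 2 * algebraMap B L δ * b.traceDual i * b.traceDual j)).det ∈
        (algebraMap A K).range := by
    refine hdet _ fun i j => ?_
    obtain ⟨x, hx⟩ := hdual _ (hsdual i)
    have : algebraMap A L s ^ 2 * algebraMap B L δ * b.traceDual i * b.traceDual j =
        algebraMap A L s * b.traceDual j * algebraMap B L x := by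
      rw [← hx]; ring
    rw [Matrix.of_apply, this]
    exact (hmemdual _).1 (hsdual j) x
  -- Here `y = t / δ` lies in the dual of `B`, and the determinant is `t ^ n * d / N(δ)`.
  obtain ⟨a', ha'⟩ : (Matrix.of fun i j => Algebra.trace K L (y * b i * b j)).det ∈
        (algebraMap A K).range := by
    refine hdet _ fun i j => ?_
    rw [Matrix.of_apply, mul_assoc, hb, hb, ← map_mul]
    exact (hmemdual _).1 hy _
  rw [Algebra.det_trace_mul_mul, map_mul, map_pow, hNA, ← hNδ] at ha
  rw [Algebra.det_trace_mul_mul, ← hd] at ha'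
  refine ⟨b', d, δ, s, t, a, a', hs, ht, hδ, by rw [hbfun, hd], hspan, hD, hinj ?_, hinj ?_⟩
  · have := Algebra.discr_mul_discr_traceDual b
    rw [map_mul, map_mul, ha, map_pow, mul_assoc, hd, mul_comm (Algebra.discr K b.traceDual), this]
    ring
  · rw [map_mul, map_mul, ha', map_pow, ← hNA, hty, map_mul, ← hNδ]
    ring

/-- The ideal generated by the discriminants of bases is the norm of the different. -/
theorem relNorm_differentIdeal_eq_span_discr (hA : ¬ IsField A) :
    Ideal.relNorm A (differentIdeal A B) =
      Ideal.span {d | ∃ b : Fin (finrank K L) → B,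
        algebraMap A K d = Algebra.discr K fun i => algebraMap B L (b i)} := by
  classical
  have hinj : Function.Injective (algebraMap A K) := IsFractionRing.injective A K
  -- Membership is local: otherwise the colon ideal would lie in some maximal ideal `q`.
  have hlocal (I : Ideal A) (x : A) (h : ∀ q : Ideal A, q.IsMaximal → ∃ m ∉ q, m * x ∈ I) :
      x ∈ I := by
    have htop : I.colon {x} = ⊤ := by
      by_contra hne
      obtain ⟨q, hq, hle⟩ := Ideal.exists_le_maximal _ hne
      obtain ⟨m, hm, hmx⟩ := h q hq
      exact hm (hle (Submodule.mem_colon_singleton.2 hmx))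
    have : (1 : A) ∈ I.colon {x} := htop ▸ trivial
    simpa using Submodule.mem_colon_singleton.1 this
  have hpow {q : Ideal A} (hq : q.IsMaximal) {m : A} (hm : m ∉ q) (k : ℕ) : m ^ k ∉ q :=
    fun h => hm (hq.isPrime.mem_of_pow_mem k h)
  refine le_antisymm ?_ (Ideal.span_le.2 ?_)
  · rw [Ideal.relNorm_apply, Ideal.span_le]
    rintro _ ⟨x, hx, rfl⟩
    refine hlocal _ _ fun q hq => ?_
    obtain ⟨b, d, δ, s, t, a, a', hs, ht, hδ, hd, -, hD, h1, h2⟩ := exists_local_discr A K L B q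
      (Ring.ne_bot_of_isMaximal_of_not_isField hq hA)
    refine ⟨s ^ (2 * finrank K L) * t ^ finrank K L,
      fun h => (hq.isPrime.mem_or_mem h).elim (hpow hq hs _) (hpow hq ht _), ?_⟩
    obtain ⟨y, hy⟩ := hD x hx
    have hN : t ^ finrank K L * Algebra.intNorm A B x =
        Algebra.intNorm A B δ * Algebra.intNorm A B y := by
      apply hinj
      have := congrArg (fun z => Algebra.norm K (algebraMap B L z)) hy
      simp only [Algebra.smul_def, map_mul] at this
      rw [map_mul, map_mul, map_pow, Algebra.algebraMap_intNorm (L := L),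
        Algebra.algebraMap_intNorm (L := L), Algebra.algebraMap_intNorm (L := L), ← this,
        ← IsScalarTower.algebraMap_apply, IsScalarTower.algebraMap_apply A K L,
        Algebra.norm_algebraMap]
    have : s ^ (2 * finrank K L) * t ^ finrank K L * Algebra.intNorm A B x =
        a * Algebra.intNorm A B y * d := by
      rw [mul_assoc, hN, ← mul_assoc, h1]; ring
    rw [this]
    exact Ideal.mul_mem_left _ _ (Ideal.subset_span ⟨b, hd⟩)
  · rintro d' ⟨c, hc⟩
    refine hlocal _ _ fun q hq => ?_
    obtain ⟨b, d, δ, s, t, a, a', hs, ht, hδ, hd, hspan, -, h1, h2⟩ :=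
      exists_local_discr A K L B q (Ring.ne_bot_of_isMaximal_of_not_isField hq hA)
    refine ⟨s ^ (2 * finrank K L) * t ^ finrank K L,
      fun h => (hq.isPrime.mem_or_mem h).elim (hpow hq hs _) (hpow hq ht _), ?_⟩
    choose f hf using fun i => (Submodule.mem_span_range_iff_exists_fun A).1 (hspan (c i))
    let C : Matrix (Fin (finrank K L)) (Fin (finrank K L)) A := Matrix.of fun i j => f i j
    -- The family `s • c` is the image of `b` under the integral matrix `C`, which multiplies the
    -- discriminant by `C.det ^ 2`.
    have hC : s ^ (2 * finrank K L) * d' = C.det ^ 2 * d := by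
      apply hinj
      have h3 := Algebra.discr_of_matrix_mulVec (A := K) (fun i => algebraMap B L (b i))
        (C.map (algebraMap A K))
      have h4 : Matrix.mulVec ((C.map (algebraMap A K)).map (algebraMap K L))
          (fun i => algebraMap B L (b i)) =
          Matrix.mulVec ((algebraMap A K s • (1 : Matrix (Fin (finrank K L)) _ K)).map
            (algebraMap K L)) (fun i => algebraMap B L (c i)) := by
        ext i
        have h5 := congrArg (algebraMap B L) (hf i)
        simp only [map_sum, Algebra.smul_def, map_mul, ← IsScalarTower.algebraMap_apply A B L] at h5
        simp only [Matrix.mulVec, dotProduct, Matrix.map_apply, Matrix.smul_apply, Matrix.one_apply,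
          ← IsScalarTower.algebraMap_apply A K L]
        rw [show ∑ j, algebraMap A L (C i j) * algebraMap B L (b j) = _ from h5,
          Finset.sum_eq_single i]
        · simp [← IsScalarTower.algebraMap_apply A K L]
        · intro j _ hj
          simp [hj.symm]
        · simp
      have h6 : (C.map (algebraMap A K)).det = algebraMap A K C.det :=
        (RingHom.map_det (algebraMap A K) C).symm
      rw [h4, Algebra.discr_of_matrix_mulVec, ← hc, ← hd, Matrix.det_smul, Matrix.det_one,
        Fintype.card_fin, mul_one, h6] at h3
      simp only [map_mul, map_pow]
      rw [← h3]
      ring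
    have : s ^ (2 * finrank K L) * t ^ finrank K L * d' =
        C.det ^ 2 * a' * Algebra.intNorm A B δ := by
      rw [mul_right_comm, hC, mul_assoc, mul_comm d, h2]; ring
    rw [this]
    exact Ideal.mul_mem_left _ _ (Ideal.subset_span ⟨δ, hδ, rfl⟩)

end Discriminant

end

section

open Polynomial

namespace WeightedDisc

/-! ### Integers of algebraic extensions of `ℚ_[p]` and the spectral norm -/

section IntegersOfAlgebraicExtension

variable {p : ℕ} [Fact p.Prime] {E : Type*} [Field E] [Algebra ℚ_[p] E] [Algebra ℤ_[p] E]
  [IsScalarTower ℤ_[p] ℚ_[p] E] [Algebra.IsAlgebraic ℚ_[p] E]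

/-- The spectral norm is at most 1 exactly when all coefficients of the minimal polynomial have norm
at most 1. Infinite extensions are allowed, so the criterion covers the algebraic closure. -/
theorem isIntegral_padicInt_iff {x : E} :
    IsIntegral ℤ_[p] x ↔ spectralNorm ℚ_[p] E x ≤ 1 := by
  have hx : IsIntegral ℚ_[p] x := Algebra.IsIntegral.isIntegral x
  rw [spectralNorm, spectralValue_le_one_iff (minpoly.monic hx)]
  constructor
  · intro h n
    rw [minpoly.isIntegrallyClosed_eq_field_fractions' ℚ_[p] h, coeff_map]
    exact PadicInt.norm_le_one _
  · intro h
    have hl : minpoly ℚ_[p] x ∈ Polynomial.lifts (algebraMap ℤ_[p] ℚ_[p]) := by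
      rw [lifts_iff_coeff_lifts]
      exact fun n => ⟨⟨_, h n⟩, rfl⟩
    obtain ⟨q, hq, -, hm⟩ := lifts_and_natDegree_eq_and_monic hl (minpoly.monic hx)
    refine ⟨q, hm, ?_⟩
    rw [← aeval_def, ← aeval_map_algebraMap ℚ_[p] x q, hq, minpoly.aeval]

theorem spectralNorm_coe_le_one (x : integralClosure ℤ_[p] E) :
    spectralNorm ℚ_[p] E (x : E) ≤ 1 :=
  isIntegral_padicInt_iff.1 x.2

theorem isUnit_integralClosure_iff {x : integralClosure ℤ_[p] E} :
    IsUnit x ↔ spectralNorm ℚ_[p] E (x : E) = 1 := by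
  constructor
  · rintro ⟨u, rfl⟩
    have h : spectralNorm ℚ_[p] E (u : E) *
        spectralNorm ℚ_[p] E ((↑u⁻¹ : integralClosure ℤ_[p] E) : E)
        = 1 := by
      have := spectralAlgNorm_mul (K := ℚ_[p]) ((u : integralClosure ℤ_[p] E) : E)
        (↑u⁻¹ : integralClosure ℤ_[p] E)
      simp only [spectralAlgNorm_def] at this
      rw [← this, ← MulMemClass.coe_mul, Units.mul_inv, OneMemClass.coe_one, spectralNorm_one]
    have h1 := spectralNorm_coe_le_one (u : integralClosure ℤ_[p] E)
    have h2 := spectralNorm_coe_le_one (↑u⁻¹ : integralClosure ℤ_[p] E)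
    refine le_antisymm h1 ?_
    rw [← h]
    exact mul_le_of_le_one_right (spectralNorm_nonneg _) h2
  · intro h
    have hx : (x : E) ≠ 0 := by
      intro h0
      rw [h0, spectralNorm_zero] at h
      exact zero_ne_one h
    have hi : spectralNorm ℚ_[p] E (x : E)⁻¹ = 1 := by
      have := spectralAlgNorm_mul (K := ℚ_[p]) (x : E) (x : E)⁻¹
      simp only [spectralAlgNorm_def] at this
      rwa [mul_inv_cancel₀ hx, spectralNorm_one, h, one_mul, eq_comm] at this
    exact IsUnit.of_mul_eq_one ⟨(x : E)⁻¹, isIntegral_padicInt_iff.2 hi.le⟩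
      (Subtype.ext (mul_inv_cancel₀ hx))

theorem mem_nonunits_integralClosure_iff {x : integralClosure ℤ_[p] E} :
    x ∈ nonunits (integralClosure ℤ_[p] E) ↔ spectralNorm ℚ_[p] E (x : E) < 1 := by
  rw [mem_nonunits_iff, isUnit_integralClosure_iff]
  exact (lt_iff_le_and_ne.trans (and_iff_right (spectralNorm_coe_le_one x))).symm

instance isLocalRing_integralClosure : IsLocalRing (integralClosure ℤ_[p] E) :=
  IsLocalRing.of_nonunits_add fun {a b} ha hb => by
    rw [mem_nonunits_integralClosure_iff] at *
    exact (isNonarchimedean_spectralNorm (K := ℚ_[p]) (a : E) b).trans_lt (max_lt ha hb)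

theorem maxIdeal_eq_maximalIdeal :
    maxIdeal p E = IsLocalRing.maximalIdeal (integralClosure ℤ_[p] E) :=
  IsLocalRing.jacobson_eq_maximalIdeal ⊥ bot_ne_top

instance isMaximal_maxIdeal : (maxIdeal p E).IsMaximal := by
  rw [maxIdeal_eq_maximalIdeal]; infer_instance

theorem mem_maxIdeal_iff {x : integralClosure ℤ_[p] E} :
    x ∈ maxIdeal p E ↔ spectralNorm ℚ_[p] E (x : E) < 1 := by
  rw [maxIdeal_eq_maximalIdeal, IsLocalRing.mem_maximalIdeal, mem_nonunits_integralClosure_iff]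

omit [Algebra.IsAlgebraic ℚ_[p] E] in
theorem coe_smul_integralClosure (σ : Gal(E/ℚ_[p])) (x : integralClosure ℤ_[p] E) :
    ((σ • x : integralClosure ℤ_[p] E) : E) = σ (x : E) := rfl

theorem smul_mem_maxIdeal (σ : Gal(E/ℚ_[p])) {x : integralClosure ℤ_[p] E}
    (hx : x ∈ maxIdeal p E) : σ • x ∈ maxIdeal p E := by
  rw [mem_maxIdeal_iff] at *
  rwa [coe_smul_integralClosure, ← spectralNorm_eq_of_equiv]

omit [Algebra.IsAlgebraic ℚ_[p] E] in
theorem mem_galRamificationGroup_iff {i : ℕ} {σ : Gal(E/ℚ_[p])} :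
    σ ∈ galRamificationGroup p E i ↔ ∀ x : integralClosure ℤ_[p] E,
      σ • x - x ∈ maxIdeal p E ^ (i + 1) := Iff.rfl

theorem smul_mem_maxIdeal_pow (n : ℕ) (σ : Gal(E/ℚ_[p])) {x : integralClosure ℤ_[p] E}
    (hx : x ∈ maxIdeal p E ^ n) : σ • x ∈ maxIdeal p E ^ n := by
  have h := Ideal.mem_map_of_mem (MulSemiringAction.toRingHom _ (integralClosure ℤ_[p] E) σ) hx
  rw [Ideal.map_pow] at h
  refine Ideal.pow_right_mono ?_ n h
  exact (Ideal.map_le_iff_le_comap).2 fun x hx => smul_mem_maxIdeal σ hx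

theorem mem_galRamificationGroup_zero_iff {σ : Gal(E/ℚ_[p])} :
    σ ∈ galRamificationGroup p E 0 ↔ ∀ x : integralClosure ℤ_[p] E,
      spectralNorm ℚ_[p] E (σ (x : E) - x) < 1 := by
  simp_rw [mem_galRamificationGroup_iff, zero_add, pow_one, mem_maxIdeal_iff]
  rfl

omit [Algebra.IsAlgebraic ℚ_[p] E] in
theorem galRamificationGroup_antitone : Antitone (galRamificationGroup p E) :=
  fun _ _ h _ hσ x => Ideal.pow_le_pow_right (by omega) (hσ x)

end IntegersOfAlgebraicExtension

/-! ### Absolute inertia and inertia at finite level -/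

section Inertia

variable {p : ℕ} [Fact p.Prime]

/-- Acting trivially on the residue field of the fixed field of `N`, `σ` induces an automorphism
over it of the residue field of the algebraic closure. The profinite group `N` maps onto such
automorphisms, so some element of `N` induces the same one; dividing by it leaves an element of
inertia. -/
theorem exists_mul_mem_absInertia (N : Subgroup (AbsGal ℚ_[p])) [N.Normal]
    (hN : IsClosed (N : Set (AbsGal ℚ_[p]))) {σ : AbsGal ℚ_[p]}
    (hσ : AlgEquiv.restrictNormalHom (IntermediateField.fixedField N) σ ∈
      galRamificationGroup p (IntermediateField.fixedField N) 0) :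
    ∃ τ ∈ N, τ * σ ∈ absInertia p := by
  let B := integralClosure ℤ_[p] (AlgebraicClosure ℚ_[p])
  let Q : Ideal B := maxIdeal p (AlgebraicClosure ℚ_[p])
  let A := FixedPoints.subalgebra ℤ_[p] B N
  let P : Ideal A := Q.under A
  -- Surjectivity for profinite groups needs a continuous action on the discrete ring `B`;
  -- stabilizers are open because the elements are algebraic.
  let _ : TopologicalSpace B := ⊥
  have _ : DiscreteTopology B := ⟨rfl⟩
  have _ : CompactSpace N := isCompact_iff_compactSpace.1 hN.isCompact
  have _ : ContinuousSMul N B := by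
    rw [continuousSMul_iff_stabilizer_isOpen]
    intro x
    have h := stabilizer_isOpen_of_isIntegral (K := ℚ_[p]) (x : AlgebraicClosure ℚ_[p])
    convert h.preimage (continuous_subtype_val (p := fun g => g ∈ N)) using 1
    ext g
    exact Subtype.ext_iff
  have _ : Algebra.IsInvariant A B N := ⟨fun b hb => ⟨⟨b, hb⟩, rfl⟩⟩
  have _ : SMulCommClass N A B := ⟨fun g a b => by
    change g • ((a : B) * b) = (a : B) * g • b
    rw [smul_mul', a.2 g]⟩
  have hmap : Q = Q.map (MulSemiringAction.toRingEquiv _ B σ : B →+* B) := by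
    apply le_antisymm
    · intro x hx
      have := Ideal.mem_map_of_mem (MulSemiringAction.toRingEquiv _ B σ : B →+* B)
        (smul_mem_maxIdeal σ⁻¹ hx)
      convert this using 1
      exact (smul_inv_smul σ x).symm
    · rw [Ideal.map_le_iff_le_comap]
      exact fun x hx => smul_mem_maxIdeal σ hx
  have hfix : ∀ a : A, σ • (a : B) - a ∈ Q := by
    intro a
    have ha : ((a : B) : AlgebraicClosure ℚ_[p]) ∈ IntermediateField.fixedField N :=
      fun g => congrArg Subtype.val (a.2 g)
    have hn : ∀ y : IntermediateField.fixedField N,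
        spectralNorm ℚ_[p] (AlgebraicClosure ℚ_[p]) (y : AlgebraicClosure ℚ_[p]) =
          spectralNorm ℚ_[p] (IntermediateField.fixedField N) y :=
      fun y => (spectralNorm.eq_of_tower (L := AlgebraicClosure ℚ_[p]) y).symm
    have hint : IsIntegral ℤ_[p] (⟨_, ha⟩ : IntermediateField.fixedField N) := by
      rw [isIntegral_padicInt_iff, ← hn]
      exact spectralNorm_coe_le_one (a : B)
    have h := mem_galRamificationGroup_zero_iff.1 hσ ⟨_, hint⟩
    rw [← hn] at h
    rw [mem_maxIdeal_iff]
    convert h using 2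
    exact congrArg (· - _) (AlgEquiv.restrictNormal_commutes σ _
      (⟨_, ha⟩ : IntermediateField.fixedField N)).symm
  let e : (B ⧸ Q) ≃ₐ[A ⧸ P] (B ⧸ Q) :=
    AlgEquiv.ofRingEquiv (f := Ideal.quotientEquiv Q Q (MulSemiringAction.toRingEquiv _ B σ) hmap)
      (Ideal.Quotient.mk_surjective.forall.2 fun a => Ideal.Quotient.eq.2 (hfix a))
  obtain ⟨τ, hτ⟩ := Ideal.Quotient.stabilizerHom_surjective_of_profinite (G := N) P Q e
  refine ⟨(τ : N)⁻¹, (N.inv_mem (τ : N).2), ?_⟩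
  intro x
  rw [zero_add, pow_one]
  have h := DFunLike.congr_fun hτ (Ideal.Quotient.mk Q x)
  have h' : σ • x - ((τ : N) : AbsGal ℚ_[p]) • x ∈ Q := Ideal.Quotient.eq.1 h.symm
  have h2 := smul_mem_maxIdeal (((τ : N) : AbsGal ℚ_[p])⁻¹) h'
  rwa [smul_sub, inv_smul_smul, smul_smul] at h2

/-- Restriction preserves inertia because the spectral norm does not depend on the field.
Conversely, a lift of an inertia element is moved into absolute inertia by an element of the kernel
of `φ`, which does not affect its image. -/
theorem inertiaImage_eq {Γ : Type*} [Group Γ] [TopologicalSpace Γ] [DiscreteTopology Γ]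
    (φ : LocalHom Γ p) : φ.inertiaImage = φ.ramificationGroup 0 := by
  have hcl : IsClosed (φ.toMonoidHom.ker : Set (AbsGal ℚ_[p])) :=
    (isClosed_discrete {(1 : Γ)}).preimage φ.continuous_toFun
  apply le_antisymm
  · rintro _ ⟨σ, hσ, rfl⟩
    refine ⟨σ, ?_, rfl⟩
    rw [Subgroup.coe_comap, Set.mem_preimage, SetLike.mem_coe, mem_galRamificationGroup_zero_iff]
    intro x
    have hn := fun y : φ.field =>
      spectralNorm.eq_of_tower (K := ℚ_[p]) (L := AlgebraicClosure ℚ_[p]) y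
    rw [hn]
    have hx : IsIntegral ℤ_[p] ((x : φ.field) : AlgebraicClosure ℚ_[p]) := by
      rw [isIntegral_padicInt_iff]
      refine (hn _).symm.trans_le (spectralNorm_coe_le_one x)
    have h := mem_galRamificationGroup_zero_iff.1 hσ ⟨_, hx⟩
    convert h using 2
    exact congrArg (· - _) (AlgEquiv.restrictNormal_commutes σ _ (x : φ.field))
  · rintro _ ⟨σ, hσ, rfl⟩
    obtain ⟨τ, hτ, h⟩ := exists_mul_mem_absInertia _ hcl hσ
    refine ⟨τ * σ, h, ?_⟩
    rw [map_mul, (MonoidHom.mem_ker).1 hτ, one_mul]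

end Inertia

end WeightedDisc

end

section

open Polynomial

/-! ### Fixed rings and the ramification formula for a subgroup -/

section FixedPoints

variable (R B G : Type*) [CommRing R] [CommRing B] [IsDomain B] [Algebra R B] [Group G]
  [MulSemiringAction G B] [SMulCommClass G R B]

/-- An integral quotient of fixed elements lies in `B`, and it is fixed because numerator and
denominator are. -/
theorem isIntegrallyClosed_fixedPoints [IsIntegrallyClosed B] :
    IsIntegrallyClosed (FixedPoints.subalgebra R B G) := by
  let A := FixedPoints.subalgebra R B G
  have hinj : Function.Injective (algebraMap A (FractionRing B)) :=
    (IsFractionRing.injective B (FractionRing B)).comp Subtype.val_injective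
  rw [isIntegrallyClosed_iff (FractionRing A)]
  intro x hx
  let f : FractionRing A →ₐ[A] FractionRing B :=
    IsFractionRing.liftAlgHom (g := Algebra.ofId A (FractionRing B)) hinj
  obtain ⟨a, b, hb, rfl⟩ := IsFractionRing.div_surjective A x
  have hb0 : (b : B) ≠ 0 := fun h => nonZeroDivisors.ne_zero hb (Subtype.ext h)
  have h1 : IsIntegral B (f (algebraMap A _ a / algebraMap A _ b)) := (hx.map f).tower_top
  obtain ⟨c, hc⟩ := IsIntegrallyClosed.isIntegral_iff.1 h1
  have hb1 : algebraMap B (FractionRing B) b ≠ 0 := by simpa using hb0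
  have hbc : (b : B) * c = a := by
    apply IsFractionRing.injective B (FractionRing B)
    rw [map_mul, hc, map_div₀, AlgHom.commutes, AlgHom.commutes]
    exact mul_div_cancel₀ _ hb1
  have hcA : ∀ g : G, g • c = c := by
    intro g
    apply mul_left_cancel₀ hb0
    calc (b : B) * g • c = g • ((b : B) * c) := by rw [smul_mul', b.2 g]
      _ = b * c := by rw [hbc, a.2 g]
  refine ⟨⟨c, hcA⟩, ?_⟩
  have hb2 : algebraMap A (FractionRing A) b ≠ 0 := by
    simpa using nonZeroDivisors.ne_zero hb
  rw [eq_div_iff hb2, ← map_mul]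
  congr 1
  exact Subtype.ext ((mul_comm _ _).trans hbc)

theorem isDedekindDomain_fixedPoints [IsDedekindDomain R] [IsDedekindDomain B]
    [Module.Finite R B] : IsDedekindDomain (FixedPoints.subalgebra R B G) := by
  let A := FixedPoints.subalgebra R B G
  have h1 : Module.Finite R A :=
    Module.Finite.of_injective A.val.toLinearMap Subtype.val_injective
  have h2 : IsNoetherianRing A := isNoetherian_of_tower R inferInstance
  have h3 : Ring.DimensionLEOne A := ⟨fun {P} hP0 hP => by
    have : P.comap (algebraMap R A) ≠ ⊥ := by
      obtain ⟨x, hxP, hx0⟩ := P.ne_bot_iff.1 hP0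
      exact Ideal.comap_ne_bot_of_integral_mem hx0 hxP (Algebra.IsIntegral.isIntegral x)
    have h := (hP.comap (algebraMap R A)).isMaximal this
    exact Ideal.isMaximal_of_isIntegral_of_isMaximal_comap P h⟩
  have h4 := isIntegrallyClosed_fixedPoints R B G
  exact { }

end FixedPoints

/-- The case `H = ⊤` of the ramification formula, with `d` the exponent of `p` in the norm of the
different of the ring fixed by `S`. It provides `d` as a function of all subgroups for the
integrality proof. -/
theorem exists_sum_card_inertia_eq {B Γ : Type*} [CommRing B] [Group Γ] [MulSemiringAction Γ B]
    (R : Type*) [CommRing R]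
    [IsDedekindDomain R] [CharZero R] [Algebra R B] [IsDedekindDomain B] [Module.Finite R B]
    [Module.IsTorsionFree R B] [Fintype Γ] [IsGaloisGroup Γ R B] {p : Ideal R} [p.IsMaximal]
    [Finite (R ⧸ p)] (hp : p ≠ ⊥) (P : Ideal B) [P.IsPrime] [P.LiesOver p] (S : Subgroup Γ) :
    ∃ d : ℕ, ∀ᶠ n in Filter.atTop, ∑ γ : Γ, ∑ i ∈ Finset.range n,
        Nat.card ↥(((P ^ (i + 1)).inertia Γ).map (MulAut.conj γ).toMonoidHom ⊓ ⊤) =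
      ∑ γ : Γ, ∑ i ∈ Finset.range n,
        Nat.card ↥(((P ^ (i + 1)).inertia Γ).map (MulAut.conj γ).toMonoidHom ⊓ S) +
      Nat.card (P.inertia Γ) * Nat.card S * d := by
  let A := FixedPoints.subalgebra R B S
  have h0 : IsDedekindDomain A := isDedekindDomain_fixedPoints R B S
  have h1 : Module.Finite R A :=
    Module.Finite.of_injective A.val.toLinearMap Subtype.val_injective
  have h2 : Module.Finite A B := Module.Finite.of_restrictScalars_finite R A B
  have h3 : Module.IsTorsionFree A B := inferInstance
  have h4 : Module.IsTorsionFree R A := by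
    rw [Module.isTorsionFree_iff_algebraMap_injective]
    have : Function.Injective (algebraMap R B) := FaithfulSMul.algebraMap_injective R B
    rw [IsScalarTower.algebraMap_eq R A B, RingHom.coe_comp] at this
    exact Function.Injective.of_comp this
  have h5 : CharZero A := charZero_of_injective_algebraMap (FaithfulSMul.algebraMap_injective R A)
  have h6 : IsGaloisGroup S A B :=
    { faithful := ⟨fun {a b} h => by
        have := (IsGaloisGroup.faithful R : FaithfulSMul Γ B)
        exact Subtype.ext (eq_of_smul_eq_smul (α := B) fun y => h y)⟩
      commutes := ⟨fun g a b => by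
        change g • ((a : B) * b) = (a : B) * g • b
        rw [smul_mul', a.2 g]⟩
      isInvariant := ⟨fun b hb => ⟨⟨b, hb⟩, rfl⟩⟩ }
  exact ⟨_, sum_card_inertia_inf_eq R hp P ⊤ S R A⟩

namespace WeightedDisc

/-! ### Ramification groups of `p`-adic fields: separation and tameness -/

section LocalFields

variable {p : ℕ} [Fact p.Prime] {E : Type*} [Field E] [Algebra ℚ_[p] E] [Algebra ℤ_[p] E]
  [IsScalarTower ℤ_[p] ℚ_[p] E] [FiniteDimensional ℚ_[p] E]

instance isDedekindDomain_integralClosure_padic : IsDedekindDomain (integralClosure ℤ_[p] E) :=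
  integralClosure.isDedekindDomain ℤ_[p] ℚ_[p] E

instance finite_integralClosure_padic : Module.Finite ℤ_[p] (integralClosure ℤ_[p] E) :=
  IsIntegralClosure.finite ℤ_[p] ℚ_[p] E _

instance isFractionRing_integralClosure_padic : IsFractionRing (integralClosure ℤ_[p] E) E :=
  integralClosure.isFractionRing_of_finite_extension ℚ_[p] E

omit [FiniteDimensional ℚ_[p] E] in
theorem algebraMap_padicInt_injective :
    Function.Injective (algebraMap ℤ_[p] (integralClosure ℤ_[p] E)) := by
  have : Function.Injective (algebraMap ℤ_[p] E) := by
    rw [IsScalarTower.algebraMap_eq ℤ_[p] ℚ_[p] E]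
    exact (algebraMap ℚ_[p] E).injective.comp (IsFractionRing.injective ℤ_[p] ℚ_[p])
  rw [IsScalarTower.algebraMap_eq ℤ_[p] (integralClosure ℤ_[p] E) E, RingHom.coe_comp] at this
  exact Function.Injective.of_comp this

instance isTorsionFree_integralClosure_padic :
    Module.IsTorsionFree ℤ_[p] (integralClosure ℤ_[p] E) :=
  (Module.isTorsionFree_iff_algebraMap_injective).2 algebraMap_padicInt_injective

instance charZero_integralClosure_padic : CharZero (integralClosure ℤ_[p] E) :=
  charZero_of_injective_algebraMap (algebraMap_padicInt_injective (p := p))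

theorem natCast_mem_maxIdeal : (p : integralClosure ℤ_[p] E) ∈ maxIdeal p E := by
  rw [mem_maxIdeal_iff]
  have : (((p : integralClosure ℤ_[p] E)) : E) = algebraMap ℚ_[p] E p := by simp
  rw [this, spectralNorm_extends]
  exact Padic.norm_p_lt_one

theorem maxIdeal_ne_bot : maxIdeal p E ≠ ⊥ := fun h => by
  have := natCast_mem_maxIdeal (p := p) (E := E)
  rw [h, Ideal.mem_bot] at this
  exact (Fact.out : p.Prime).ne_zero (by exact_mod_cast this)

instance liesOver_maxIdeal : (maxIdeal p E).LiesOver (IsLocalRing.maximalIdeal ℤ_[p]) :=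
  ⟨(IsLocalRing.eq_maximalIdeal (Ideal.isMaximal_comap_of_isIntegral_of_isMaximal _)).symm⟩

theorem finite_residue_padicInt : Finite (ℤ_[p] ⧸ IsLocalRing.maximalIdeal ℤ_[p]) :=
  Finite.of_equiv _ (PadicInt.residueField (p := p)).symm.toEquiv

theorem iInf_maxIdeal_pow : ⨅ n, maxIdeal p E ^ n = ⊥ :=
  Ideal.iInf_pow_eq_bot_of_isDomain _ (Ideal.IsPrime.ne_top inferInstance)

theorem eq_zero_of_forall_mem_maxIdeal_pow {x : integralClosure ℤ_[p] E}
    (h : ∀ n, x ∈ maxIdeal p E ^ n) : x = 0 := by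
  rw [← Ideal.mem_bot, ← iInf_maxIdeal_pow]
  exact (Ideal.mem_iInf).2 h

instance isGaloisGroup_integralClosure_padic [IsGalois ℚ_[p] E] :
    IsGaloisGroup Gal(E/ℚ_[p]) ℤ_[p] (integralClosure ℤ_[p] E) :=
  IsGaloisGroup.of_isFractionRing _ _ _ ℚ_[p] E

/-- By Krull's intersection theorem such a `σ` is trivial on the ring of integers, hence on its
fraction field. -/
theorem eq_one_of_forall_mem_galRamificationGroup {σ : Gal(E/ℚ_[p])}
    (h : ∀ i, σ ∈ galRamificationGroup p E i) : σ = 1 := by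
  have hO (x : integralClosure ℤ_[p] E) : σ • x = x := by
    apply sub_eq_zero.1
    refine eq_zero_of_forall_mem_maxIdeal_pow fun n => ?_
    exact Ideal.pow_le_pow_right (Nat.le_succ n) (h n x)
  ext x
  obtain ⟨a, b, hb, rfl⟩ := IsFractionRing.div_surjective (integralClosure ℤ_[p] E) x
  rw [map_div₀]
  have h1 := congrArg Subtype.val (hO a)
  have h2 := congrArg Subtype.val (hO b)
  exact congrArg₂ (· / ·) h1 h2

theorem exists_galRamificationGroup_eq_bot :
    ∃ n, ∀ i, n ≤ i → galRamificationGroup p E i = ⊥ := by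
  have h (σ : Gal(E/ℚ_[p])) : ∃ n, σ ∈ galRamificationGroup p E n → σ = 1 := by
    by_contra! hc
    exact (hc 0).2 (eq_one_of_forall_mem_galRamificationGroup fun i => (hc i).1)
  choose n hn using h
  obtain ⟨N, hN⟩ := (Set.finite_range n).bddAbove
  refine ⟨N, fun i hi => (Subgroup.eq_bot_iff_forall _).2 fun σ hσ => hn σ ?_⟩
  exact galRamificationGroup_antitone ((hN ⟨σ, rfl⟩).trans hi) hσ

omit [FiniteDimensional ℚ_[p] E] in
theorem smul_sub_mem_maxIdeal_pow {i : ℕ} {σ : Gal(E/ℚ_[p])}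
    (hσ : σ ∈ galRamificationGroup p E i) (j : ℕ) {x : integralClosure ℤ_[p] E}
    (hx : x ∈ maxIdeal p E ^ j) : σ • x - x ∈ maxIdeal p E ^ (i + j) := by
  induction j generalizing x with
  | zero => exact Ideal.pow_le_pow_right (Nat.le_succ i) (hσ x)
  | succ j ih =>
    rw [pow_succ] at hx
    refine Submodule.mul_induction_on hx (fun a ha b hb => ?_) fun a b ha hb => ?_
    · have hs : σ • (a * b) - a * b = σ • a * (σ • b - b) + (σ • a - a) * b := by
        rw [smul_mul']; ring
      rw [hs]
      refine Ideal.add_mem _ ?_ ?_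
      · have h1 : σ • a ∈ maxIdeal p E ^ j := by
          have := Ideal.add_mem _ (Ideal.pow_le_pow_right (Nat.le_add_left j i) (ih ha)) ha
          rwa [sub_add_cancel] at this
        have := Ideal.mul_mem_mul h1 (hσ b)
        rwa [← pow_add, add_comm j, add_right_comm, add_assoc] at this
      · have := Ideal.mul_mem_mul (ih ha) hb
        rwa [← pow_succ, add_assoc] at this
    · have : σ • (a + b) - (a + b) = (σ • a - a) + (σ • b - b) := by rw [smul_add]; ring
      rw [this]
      exact Ideal.add_mem _ ha hb

/-- Modulo `maxIdeal p E ^ (i + 2)`, `σ ^ k • x - x` is `k` times `σ • x - x`. Taking `k = N` makes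
the left side vanish, and `N` is a unit. -/
theorem mem_galRamificationGroup_succ {i : ℕ} (hi : 1 ≤ i) {σ : Gal(E/ℚ_[p])}
    (hσ : σ ∈ galRamificationGroup p E i) {N : ℕ} (hN : ¬ p ∣ N) (h1 : σ ^ N = 1) :
    σ ∈ galRamificationGroup p E (i + 1) := by
  intro x
  have key (k : ℕ) : σ ^ k • x - x - k * (σ • x - x) ∈ maxIdeal p E ^ (i + 1 + 1) := by
    induction k with
    | zero => simp
    | succ k ih =>
      have hs : σ ^ (k + 1) • x - x - ((k + 1 : ℕ) : integralClosure ℤ_[p] E) * (σ • x - x) =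
          (σ • (σ ^ k • x - x) - (σ ^ k • x - x)) +
            (σ ^ k • x - x - k * (σ • x - x)) := by
        rw [pow_succ', mul_smul, smul_sub]; push_cast; ring
      rw [hs]
      refine Ideal.add_mem _ ?_ ih
      have h := smul_sub_mem_maxIdeal_pow hσ (i + 1)
        (Subgroup.pow_mem _ hσ k x : σ ^ k • x - x ∈ maxIdeal p E ^ (i + 1))
      -- The exponent `i + (i + 1)` reaches `i + 2` because `1 ≤ i`; for inertia itself the argument
      -- fails.
      exact Ideal.pow_le_pow_right (by omega) h
  have h := key N
  rw [h1, one_smul, sub_self, zero_sub, neg_mem_iff] at h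
  have hu : IsUnit (N : integralClosure ℤ_[p] E) := by
    rw [isUnit_integralClosure_iff]
    have : (((N : integralClosure ℤ_[p] E)) : E) = algebraMap ℚ_[p] E N := by simp
    rw [this, spectralNorm_extends, Padic.norm_natCast_eq_one_iff]
    exact ((Fact.out : p.Prime).coprime_iff_not_dvd).2 hN
  exact (Ideal.unit_mul_mem_iff_mem _ hu).1 h

theorem eq_one_of_mem_galRamificationGroup {i : ℕ} (hi : 1 ≤ i) {σ : Gal(E/ℚ_[p])}
    (hσ : σ ∈ galRamificationGroup p E i) {N : ℕ} (hN : ¬ p ∣ N) (h1 : σ ^ N = 1) : σ = 1 := by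
  have h (j : ℕ) : σ ∈ galRamificationGroup p E (i + j) := by
    induction j with
    | zero => exact hσ
    | succ j ih => exact mem_galRamificationGroup_succ (hi.trans (Nat.le_add_right i j)) ih hN h1
  exact eq_one_of_forall_mem_galRamificationGroup fun j =>
    galRamificationGroup_antitone (Nat.le_add_left j i) (h j)

end LocalFields

end WeightedDisc

end

/-! ### Divisibility from orbit counting -/

section GroupActions

/-- By the orbit-stabilizer theorem an orbit on which `c` has the value `c₀` contributes `|M| * c₀`.
-/
theorem MulAction.card_dvd_sum_card_stabilizer_mul {M X : Type*} [Group M] [Finite M] [Fintype X]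
    [MulAction M X] (c : X → ℤ) (hc : ∀ (m : M) x, c (m • x) = c x) :
    (Nat.card M : ℤ) ∣ ∑ x : X, Nat.card (MulAction.stabilizer M x) * c x := by
  classical
  rw [← Finset.sum_fiberwise (s := Finset.univ)
    (g := fun x => (Quotient.mk (MulAction.orbitRel M X) x))]
  refine Finset.dvd_sum fun q _ => ?_
  obtain ⟨x₀, rfl⟩ := Quotient.exists_rep q
  have hmem (x : X) : x ∈ Finset.univ.filter
      (fun x => Quotient.mk (MulAction.orbitRel M X) x = Quotient.mk _ x₀) ↔
      x ∈ MulAction.orbit M x₀ := by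
    rw [Finset.mem_filter_univ, Quotient.eq, MulAction.orbitRel_apply]
  have hconst : ∀ x ∈ Finset.univ.filter
      (fun x => Quotient.mk (MulAction.orbitRel M X) x = Quotient.mk _ x₀),
      (Nat.card (MulAction.stabilizer M x) : ℤ) * c x =
        Nat.card (MulAction.stabilizer M x₀) * c x₀ := by
    intro x hx
    obtain ⟨m, rfl⟩ := (hmem x).1 hx
    rw [hc]
    congr 2
    exact Nat.card_congr (MulAction.stabilizerEquivStabilizerOfOrbitRel
      (MulAction.orbitRel_apply.2 ⟨m, rfl⟩)).toEquiv
  rw [Finset.sum_congr rfl hconst, Finset.sum_const, nsmul_eq_mul, ← mul_assoc, ← Nat.cast_mul]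
  have hcard : (Finset.univ.filter
      (fun x => Quotient.mk (MulAction.orbitRel M X) x = Quotient.mk _ x₀)).card =
      Nat.card (MulAction.orbit M x₀) :=
    (Nat.subtype_card _ hmem).symm
  rw [hcard, ← Nat.card_prod, Nat.card_congr (MulAction.orbitProdStabilizerEquivGroup M x₀)]
  exact Dvd.intro _ rfl

theorem Subgroup.card_map_inf {G Γ : Type*} [Group G] [Group Γ] {f : G →* Γ}
    (hf : Function.Injective f) (I : Subgroup G) (H : Subgroup Γ) :
    Nat.card ↥(I.map f ⊓ H) = Nat.card ↥(I ⊓ H.comap f) := by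
  have : I.map f ⊓ H = (I ⊓ H.comap f).map f := by
    ext x
    constructor
    · rintro ⟨⟨y, hy, rfl⟩, h⟩
      exact ⟨y, ⟨hy, h⟩, rfl⟩
    · rintro ⟨y, ⟨hy, h⟩, rfl⟩
      exact ⟨⟨y, hy, rfl⟩, h⟩
  rw [this]
  exact (Nat.card_congr (Subgroup.equivMapOfInjective _ _ hf).toEquiv).symm

/-- Let `H × G` act on `Γ` by `γ ↦ h γ f(g)⁻¹`. Projection to `G` identifies the stabilizer of `γ`
with the preimage of `γ⁻¹ H γ`; along an orbit this preimage is only conjugated in `G`, so `d` is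
constant there. -/
theorem card_mul_card_dvd_sum_card_comap {G Γ : Type*} [Group G] [Finite G] [Group Γ] [Fintype Γ]
    (f : G →* Γ) (d : Subgroup G → ℤ)
    (hd : ∀ (g : G) (S : Subgroup G), d (S.map (MulAut.conj g).toMonoidHom) = d S)
    (H : Subgroup Γ) :
    (Nat.card H * Nat.card G : ℤ) ∣ ∑ γ : Γ,
      Nat.card (H.comap ((MulAut.conj γ).toMonoidHom.comp f)) *
        d (H.comap ((MulAut.conj γ).toMonoidHom.comp f)) := by
  let _ : MulAction (H × G) Γ :=
    { smul := fun m γ => m.1 * γ * (f m.2)⁻¹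
      one_smul := fun γ => by
        change ((1 : H) : Γ) * γ * (f 1)⁻¹ = γ
        simp
      mul_smul := fun a b γ => by
        change ((a.1 * b.1 : H) : Γ) * γ * (f (a.2 * b.2))⁻¹ =
          a.1 * (b.1 * γ * (f b.2)⁻¹) * (f a.2)⁻¹
        simp [mul_assoc] }
  have hsmul (m : H × G) (γ : Γ) : m • γ = m.1 * γ * (f m.2)⁻¹ := rfl
  have hmem (γ : Γ) (g : G) : g ∈ H.comap ((MulAut.conj γ).toMonoidHom.comp f) ↔
    γ * f g * γ⁻¹ ∈ H := Iff.rfl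
  have h := MulAction.card_dvd_sum_card_stabilizer_mul (M := H × G) (X := Γ)
    (fun γ => d (H.comap ((MulAut.conj γ).toMonoidHom.comp f))) (fun m γ => by
      rw [← hd m.2 (H.comap ((MulAut.conj γ).toMonoidHom.comp f))]
      congr 1
      ext x
      have e : m.1 * γ * (f m.2)⁻¹ * f x * (m.1 * γ * (f m.2)⁻¹)⁻¹ =
          m.1 * (γ * f (m.2⁻¹ * x * m.2) * γ⁻¹) * (m.1 : Γ)⁻¹ := by simp [mul_assoc]
      rw [Subgroup.mem_map_equiv, MulAut.conj_symm_apply, hmem, hmem, hsmul, e,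
        H.mul_mem_cancel_right (H.inv_mem m.1.2), H.mul_mem_cancel_left m.1.2])
  rw [Nat.card_prod, Nat.cast_mul] at h
  convert h using 4 with γ
  refine Nat.card_congr
    { toFun := fun g => ⟨(⟨_, g.2⟩, g.1), ?_⟩
      invFun := fun m => ⟨m.1.2, ?_⟩
      left_inv := fun g => rfl
      right_inv := fun m => ?_ }
  · rw [MulAction.mem_stabilizer_iff, hsmul]
    simp
  · have := MulAction.mem_stabilizer_iff.1 m.2
    rw [hsmul, mul_inv_eq_iff_eq_mul] at this
    rw [hmem, ← this, mul_inv_cancel_right]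
    exact m.1.1.2
  · have := MulAction.mem_stabilizer_iff.1 m.2
    rw [hsmul, mul_inv_eq_iff_eq_mul] at this
    refine Subtype.ext (Prod.ext (Subtype.ext ?_) rfl)
    change γ * f m.1.2 * γ⁻¹ = _
    rw [← this, mul_inv_cancel_right]

end GroupActions

namespace WeightedDisc

/-! ### The Galois group cut out by a homomorphism -/

section GalHom

variable {K Γ : Type*} [Field K] [CharZero K] [Group Γ] [TopologicalSpace Γ] [DiscreteTopology Γ]

theorem ker_restrictNormalHom_fixedField (φ : AbsGal K →ₜ* Γ) :
    (AlgEquiv.restrictNormalHom (K₁ := AlgebraicClosure K)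
      (IntermediateField.fixedField φ.toMonoidHom.ker)).ker = φ.toMonoidHom.ker := by
  have hcl : IsClosed (φ.toMonoidHom.ker : Set (AbsGal K)) :=
    (isClosed_discrete {(1 : Γ)}).preimage φ.continuous_toFun
  rw [IntermediateField.restrictNormalHom_ker]
  exact InfiniteGalois.fixingSubgroup_fixedField ⟨φ.toMonoidHom.ker, hcl⟩

/-- The injection of the Galois group of the extension cut out by `φ` into `Γ`. -/
noncomputable def galHom (φ : AbsGal K →ₜ* Γ) :
    Gal(IntermediateField.fixedField φ.toMonoidHom.ker/K) →* Γ :=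
  (AlgEquiv.restrictNormalHom _).liftOfSurjective (AlgEquiv.restrictNormalHom_surjective _)
    ⟨φ.toMonoidHom, (ker_restrictNormalHom_fixedField φ).le⟩

theorem galHom_restrictNormalHom (φ : AbsGal K →ₜ* Γ) (σ : AbsGal K) :
    galHom φ (AlgEquiv.restrictNormalHom _ σ) = φ σ :=
  MonoidHom.liftOfRightInverse_comp_apply _ _ _ _ _

theorem galHom_injective (φ : AbsGal K →ₜ* Γ) : Function.Injective (galHom φ) := by
  rw [injective_iff_map_eq_one]
  intro g hg
  obtain ⟨σ, rfl⟩ := AlgEquiv.restrictNormalHom_surjective (AlgebraicClosure K) g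
  rw [galHom_restrictNormalHom] at hg
  have : σ ∈ φ.toMonoidHom.ker := hg
  rwa [← ker_restrictNormalHom_fixedField] at this

end GalHom

/-! ### Local counts: invariance, vanishing and integrality -/

section LocalHoms

variable {Γ : Type*} [Group Γ] [TopologicalSpace Γ] [DiscreteTopology Γ]
  {p : ℕ} [Fact p.Prime]

instance finiteDimensional_field (φ : LocalHom Γ p) : FiniteDimensional ℚ_[p] φ.field :=
  finiteDimensional_fixedField φ ⊥

theorem ramificationGroup_eq_map_galHom (φ : LocalHom Γ p) (i : ℕ) :
    φ.ramificationGroup i = (galRamificationGroup p φ.field i).map (galHom φ) := by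
  ext x
  constructor
  · rintro ⟨σ, hσ, rfl⟩
    exact ⟨_, hσ, galHom_restrictNormalHom φ σ⟩
  · rintro ⟨g, hg, rfl⟩
    obtain ⟨σ, rfl⟩ := AlgEquiv.restrictNormalHom_surjective (AlgebraicClosure ℚ_[p]) g
    exact ⟨σ, hg, (galHom_restrictNormalHom φ σ).symm⟩

theorem ramificationGroup_antitone (φ : LocalHom Γ p) : Antitone φ.ramificationGroup :=
  fun i j h => by
    rw [ramificationGroup_eq_map_galHom, ramificationGroup_eq_map_galHom]
    exact Subgroup.map_mono (galRamificationGroup_antitone h)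

theorem exists_ramificationGroup_eq_bot (φ : LocalHom Γ p) :
    ∃ n, ∀ i, n ≤ i → φ.ramificationGroup i = ⊥ := by
  obtain ⟨n, hn⟩ := exists_galRamificationGroup_eq_bot (p := p) (E := φ.field)
  refine ⟨n, fun i hi => ?_⟩
  rw [ramificationGroup_eq_map_galHom, hn i hi, Subgroup.map_bot]

/-- Elements have order dividing `|Γ|`, hence prime to `p`, and the groups of index at least 1
contain no such element except 1. -/
theorem ramificationGroup_eq_bot_of_not_dvd (φ : LocalHom Γ p) (hp : ¬ p ∣ Nat.card Γ) {i : ℕ}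
    (hi : 1 ≤ i) : φ.ramificationGroup i = ⊥ := by
  rw [ramificationGroup_eq_map_galHom, Subgroup.map_eq_bot_iff_of_injective _ (galHom_injective φ),
    Subgroup.eq_bot_iff_forall]
  intro σ hσ
  refine eq_one_of_mem_galRamificationGroup hi hσ hp (galHom_injective φ ?_)
  rw [map_pow, map_one, pow_card_eq_one']

theorem ramificationGroup_conj (φ : LocalHom Γ p) (γ : Γ) (i : ℕ) :
    (φ.conj γ).ramificationGroup i =
      (φ.ramificationGroup i).map (MulAut.conj γ).toMonoidHom := by
  -- The two kernels are equal only propositionally while the fields depend on them, so the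
  -- comparison is made for variable subgroups.
  have key (N N' : Subgroup (AbsGal ℚ_[p])) [N.Normal] [N'.Normal] (h : N = N') :
      (galRamificationGroup p (IntermediateField.fixedField N) i).comap
        (AlgEquiv.restrictNormalHom (IntermediateField.fixedField N)) =
      (galRamificationGroup p (IntermediateField.fixedField N') i).comap
        (AlgEquiv.restrictNormalHom (K₁ := AlgebraicClosure ℚ_[p])
          (IntermediateField.fixedField N')) := by
    subst h; rfl
  have hk : (φ.conj γ).toMonoidHom.ker = φ.toMonoidHom.ker := by
    ext σ
    exact MulEquiv.map_eq_one_iff (MulAut.conj γ)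
  rw [LocalHom.ramificationGroup, LocalHom.ramificationGroup, key _ _ hk, Subgroup.map_map]
  rfl

variable [Fintype Γ]

omit [DiscreteTopology Γ] in
theorem pairCount_eq_sum (H H' : Subgroup Γ) (φ : LocalHom Γ p) {n : ℕ}
    (hn : ∀ i, n ≤ i → φ.ramificationGroup i = ⊥) :
    pairCount H H' φ = 1 / (Nat.card (φ.ramificationGroup 0) * Nat.card H') *
      (∑ γ : Γ, ∑ i ∈ Finset.range n,
        (Nat.card ↥((φ.ramificationGroup i).map (MulAut.conj γ).toMonoidHom ⊓ H) : ℚ) -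
       ∑ γ : Γ, ∑ i ∈ Finset.range n,
        (Nat.card ↥((φ.ramificationGroup i).map (MulAut.conj γ).toMonoidHom ⊓ H') : ℚ)) := by
  rw [pairCount, finsum_eq_sum_of_fintype, ← Finset.sum_sub_distrib]
  congr 1
  refine Finset.sum_congr rfl fun γ _ => ?_
  rw [← Finset.sum_sub_distrib]
  refine finsum_eq_sum_of_support_subset _ fun i hi => ?_
  by_contra hc
  apply hi
  have : n ≤ i := by simpa using hc
  simp [hn i this]

omit [Fintype Γ] in
theorem pairCount_conj (H H' : Subgroup Γ) (φ : LocalHom Γ p) (γ : Γ) :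
    pairCount H H' (φ.conj γ) = pairCount H H' φ := by
  have h1 (γ' : Γ) (i : ℕ) : ((φ.conj γ).ramificationGroup i).map (MulAut.conj γ').toMonoidHom =
      (φ.ramificationGroup i).map (MulAut.conj (γ' * γ)).toMonoidHom := by
    rw [ramificationGroup_conj, Subgroup.map_map]
    congr 1
    ext x
    simp [mul_assoc]
  have h2 : Nat.card ((φ.conj γ).ramificationGroup 0) = Nat.card (φ.ramificationGroup 0) := by
    rw [ramificationGroup_conj]
    exact Nat.card_congr (Subgroup.equivMapOfInjective _ _
      (MulAut.conj γ).injective).symm.toEquiv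
  rw [pairCount, pairCount, h2]
  simp_rw [h1]
  congr 1
  exact finsum_comp_equiv (Equiv.mulRight γ) (f := fun γ' => ∑ᶠ i : ℕ,
      ((Nat.card ↥((φ.ramificationGroup i).map (MulAut.conj γ').toMonoidHom ⊓ H) : ℚ) -
        Nat.card ↥((φ.ramificationGroup i).map (MulAut.conj γ').toMonoidHom ⊓ H')))

theorem pairCount_eq_zero (H H' : Subgroup Γ) (φ : LocalHom Γ p)
    (h : φ.ramificationGroup 0 = ⊥) : pairCount H H' φ = 0 := by
  rw [pairCount_eq_sum H H' φ (n := 0)]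
  · simp
  · exact fun i _ => le_bot_iff.1 ((ramificationGroup_antitone φ (Nat.zero_le i)).trans h.le)

omit [DiscreteTopology Γ] [Fintype Γ] in
theorem pairCount_congr {p' : ℕ} [Fact p'.Prime] (H H' : Subgroup Γ) (φ : LocalHom Γ p)
    (φ' : LocalHom Γ p') (h : ∀ i, φ.ramificationGroup i = φ'.ramificationGroup i) :
    pairCount H H' φ = pairCount H H' φ' := by
  simp only [pairCount, h]

theorem galRamificationGroup_map_conj {E : Type*} [Field E] [Algebra ℚ_[p] E] [Algebra ℤ_[p] E]
    [IsScalarTower ℤ_[p] ℚ_[p] E] [Algebra.IsAlgebraic ℚ_[p] E] (i : ℕ) (g : Gal(E/ℚ_[p])) :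
    (galRamificationGroup p E i).map (MulAut.conj g).toMonoidHom = galRamificationGroup p E i := by
  have hle (g : Gal(E/ℚ_[p])) : (galRamificationGroup p E i).map (MulAut.conj g).toMonoidHom ≤
      galRamificationGroup p E i := by
    rintro _ ⟨σ, hσ, rfl⟩ x
    have := smul_mem_maxIdeal_pow _ g (hσ (g⁻¹ • x))
    rw [smul_sub, smul_inv_smul, smul_smul, smul_smul] at this
    exact this
  refine le_antisymm (hle g) ?_
  have := Subgroup.map_mono (f := (MulAut.conj g).toMonoidHom) (hle g⁻¹)
  rw [Subgroup.map_map] at this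
  convert this
  convert (Subgroup.map_id _).symm
  ext x
  simp [mul_assoc]

/-- Orbit counting yields integers `a` for `H` and `b` for `H'`, the discriminant exponents of the
étale algebras attached to `Γ / H` and `Γ / H'`. The count is `b - [H : H'] * a`, as in a tower of
fields. -/
theorem exists_int_eq_pairCount {H H' : Subgroup Γ} (h : H' ≤ H) (φ : LocalHom Γ p) :
    ∃ z : ℤ, pairCount H H' φ = z := by
  classical
  let G := Gal(φ.field/ℚ_[p])
  let I : ℕ → Subgroup G := galRamificationGroup p φ.field
  have _ : Fintype G := Fintype.ofFinite G
  have _ : Finite (ℤ_[p] ⧸ IsLocalRing.maximalIdeal ℤ_[p]) := finite_residue_padicInt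
  have hI (i : ℕ) (g : G) : (I i).map (MulAut.conj g).toMonoidHom = I i :=
    galRamificationGroup_map_conj i g
  choose d hd using exists_sum_card_inertia_eq (Γ := G) ℤ_[p]
    (IsDiscreteValuationRing.not_a_field ℤ_[p]) (maxIdeal p φ.field)
  obtain ⟨n₀, hn₀⟩ := exists_ramificationGroup_eq_bot φ
  obtain ⟨n, hn, hdn⟩ := ((Filter.eventually_ge_atTop n₀).and (Filter.eventually_all.2 hd)).exists
  let t (S : Subgroup G) : ℕ := ∑ i ∈ Finset.range n, Nat.card ↥(I i ⊓ S)
  -- Ramification groups are normal in `G`, so averaging over `G` only produces the factor `|G|`.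
  have ht (S : Subgroup G) : Nat.card G * t ⊤ = Nat.card G * t S +
      Nat.card (I 0) * Nat.card S * d S := by
    have h1 (T : Subgroup G) : ∑ γ : G, ∑ i ∈ Finset.range n,
        Nat.card ↥(((maxIdeal p φ.field ^ (i + 1)).inertia G).map
          (MulAut.conj γ).toMonoidHom ⊓ T) = Nat.card G * t T := by
      have h2 (γ : G) (i : ℕ) : ((maxIdeal p φ.field ^ (i + 1)).inertia G).map
          (MulAut.conj γ).toMonoidHom = I i := hI i γ
      simp_rw [h2]
      rw [Finset.sum_const, Finset.card_univ, smul_eq_mul, Nat.card_eq_fintype_card]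
    have h0 : (maxIdeal p φ.field).inertia G = I 0 := by
      change _ = (maxIdeal p φ.field ^ (0 + 1)).inertia G
      rw [zero_add, pow_one]
    have := hdn S
    rwa [h1, h1, h0] at this
  have hconj (g : G) (S : Subgroup G) : Nat.card ↥(S.map (MulAut.conj g).toMonoidHom) =
      Nat.card S :=
    (Nat.card_congr (Subgroup.equivMapOfInjective _ _ (MulAut.conj g).injective).toEquiv).symm
  -- The relation `ht` determines `d`, and its other terms are invariant under conjugation.
  have hdconj (g : G) (S : Subgroup G) :
      (d (S.map (MulAut.conj g).toMonoidHom) : ℤ) = d S := by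
    have h1 := ht S
    have h2 := ht (S.map (MulAut.conj g).toMonoidHom)
    have h3 : t (S.map (MulAut.conj g).toMonoidHom) = t S := by
      refine Finset.sum_congr rfl fun i _ => ?_
      rw [← hI i g, ← Subgroup.map_inf _ _ _ (MulAut.conj g).injective, hconj, hI i g]
    rw [h3, hconj, h1, Nat.add_left_cancel_iff] at h2
    have h4 : 0 < Nat.card (I 0) * Nat.card S := Nat.mul_pos Nat.card_pos Nat.card_pos
    exact_mod_cast (Nat.eq_of_mul_eq_mul_left h4 h2).symm
  let F (γ : Γ) : G →* Γ := (MulAut.conj γ).toMonoidHom.comp (galHom φ)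
  have hF (γ : Γ) : Function.Injective (F γ) := (MulAut.conj γ).injective.comp (galHom_injective φ)
  have hsum (T : Subgroup Γ) : ∑ γ : Γ, ∑ i ∈ Finset.range n,
      (Nat.card ↥((φ.ramificationGroup i).map (MulAut.conj γ).toMonoidHom ⊓ T) : ℚ) =
      ∑ γ : Γ, (t (T.comap (F γ)) : ℚ) := by
    refine Finset.sum_congr rfl fun γ _ => ?_
    rw [← Nat.cast_sum]
    congr 1
    refine Finset.sum_congr rfl fun i _ => ?_
    rw [ramificationGroup_eq_map_galHom, Subgroup.map_map]
    exact Subgroup.card_map_inf (hF γ) _ _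
  obtain ⟨a, ha⟩ := card_mul_card_dvd_sum_card_comap (galHom φ) (fun S => (d S : ℤ)) hdconj H
  obtain ⟨b, hb⟩ := card_mul_card_dvd_sum_card_comap (galHom φ) (fun S => (d S : ℤ)) hdconj H'
  have hG0 : (Nat.card G : ℚ) ≠ 0 := Nat.cast_ne_zero.2 Nat.card_pos.ne'
  have key (T : Subgroup Γ) (c : ℤ) (hc : ∑ γ : Γ, (Nat.card (T.comap (F γ)) : ℤ) *
      (d (T.comap (F γ)) : ℤ) = (Nat.card T * Nat.card G : ℤ) * c) :
      ∑ γ : Γ, (t (T.comap (F γ)) : ℚ) =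
        Nat.card Γ * t ⊤ - Nat.card (I 0) * Nat.card T * c := by
    apply mul_left_cancel₀ hG0
    have h1 : ∑ γ : Γ, (Nat.card G * t ⊤ : ℚ) = ∑ γ : Γ, (Nat.card G * (t (T.comap (F γ)) : ℚ) +
        Nat.card (I 0) * (Nat.card (T.comap (F γ)) * d (T.comap (F γ)))) := by
      refine Finset.sum_congr rfl fun γ _ => ?_
      have := ht (T.comap (F γ))
      rw [mul_assoc (Nat.card (I 0))] at this
      exact_mod_cast this
    have h2 : ∑ γ : Γ, (Nat.card (T.comap (F γ)) : ℚ) * (d (T.comap (F γ)) : ℚ) =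
      (Nat.card T * Nat.card G : ℚ) * c := by exact_mod_cast hc
    rw [Finset.sum_add_distrib, ← Finset.mul_sum, ← Finset.mul_sum, ← Finset.mul_sum,
      h2, Finset.sum_const, Finset.card_univ, nsmul_eq_mul, ← Nat.card_eq_fintype_card] at h1
    linear_combination -h1
  obtain ⟨m, hm⟩ := Subgroup.card_dvd_of_le h
  have hI0 : Nat.card (φ.ramificationGroup 0) = Nat.card (I 0) := by
    rw [ramificationGroup_eq_map_galHom]
    exact (Nat.card_congr (Subgroup.equivMapOfInjective _ _ (galHom_injective φ)).toEquiv).symm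
  refine ⟨b - m * a, ?_⟩
  rw [pairCount_eq_sum H H' φ fun i hi => hn₀ i (hn.trans hi), hsum, hsum, key H a ha, key H' b hb,
    hI0, hm]
  have h1 : (Nat.card (I 0) : ℚ) ≠ 0 := Nat.cast_ne_zero.2 Nat.card_pos.ne'
  have h2 : (Nat.card H' : ℚ) ≠ 0 := Nat.cast_ne_zero.2 Nat.card_pos.ne'
  push_cast
  field_simp
  ring

end LocalHoms

end WeightedDisc

section

/-! ### Density of a number field in its completion -/

open scoped Pointwise NumberField

/-- Divisibility is total in the localization at `P`. The alternatives are `v(b) ≤ v(a)` and `v(a) <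
v(b)`, whence `c ∈ P` in the second. -/
theorem Ideal.exists_mul_eq_mul_of_isPrime {R : Type*} [CommRing R] [IsDedekindDomain R]
    {P : Ideal R} [P.IsPrime] (hP : P ≠ ⊥) (a b : R) :
    (∃ s ∉ P, ∃ c, s * a = c * b) ∨ ∃ s ∉ P, ∃ c ∈ P, s * b = c * a := by
  let A := Localization.AtPrime P
  have : IsDiscreteValuationRing A :=
    IsLocalization.AtPrime.isDiscreteValuationRing_of_dedekind_domain R hP A
  have key (a b : R) (h : algebraMap R A b ∣ algebraMap R A a) : ∃ s ∉ P, ∃ c, s * a = c * b := by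
    obtain ⟨z, hz⟩ := h
    obtain ⟨c, s, rfl⟩ := IsLocalization.exists_mk'_eq P.primeCompl z
    refine ⟨s, s.2, c, ?_⟩
    apply IsLocalization.injective A P.primeCompl_le_nonZeroDivisors
    rw [map_mul, map_mul, hz, mul_left_comm, IsLocalization.mk'_spec', mul_comm]
  rcases ValuationRing.dvd_total (algebraMap R A b) (algebraMap R A a) with h | h
  · exact Or.inl (key a b h)
  · obtain ⟨s, hs, c, hc⟩ := key b a h
    by_cases hcP : c ∈ P
    · exact Or.inr ⟨s, hs, c, hcP, hc⟩
    · exact Or.inl ⟨c, hcP, s, hc.symm⟩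

/-- The order `e f` of the decomposition group, with `e` and `f` expressed by a multiplicity and by
residue cardinalities so that they can be compared between a number field and its completion. -/
theorem Ideal.exists_card_stabilizer_eq_mul {R B G : Type*} [CommRing R] [IsDedekindDomain R]
    [CommRing B] [IsDedekindDomain B] [Algebra R B] [Module.Finite R B] [Module.IsTorsionFree R B]
    [Group G] [Finite G] [MulSemiringAction G B] [IsGaloisGroup G R B] {p : Ideal R} [p.IsMaximal]
    [Finite (R ⧸ p)] (hp : p ≠ ⊥) (P : Ideal B) [P.IsMaximal] [P.LiesOver p] :
    ∃ f, Nat.card (MulAction.stabilizer G P) = multiplicity P (p.map (algebraMap R B)) * f ∧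
      Nat.card (B ⧸ P) = Nat.card (R ⧸ p) ^ f := by
  have : Finite p.ResidueField := by
    have := IsFractionRing.surjective_iff_isField (R := R ⧸ p) (K := p.ResidueField) |>.2
      (Ideal.Quotient.maximal_ideal_iff_isField_quotient p |>.1 inferInstance)
    exact Finite.of_surjective _ this
  have hpB : p.map (algebraMap R B) ≠ ⊥ := Ideal.map_ne_bot_of_ne_bot hp
  refine ⟨Module.finrank (R ⧸ p) (B ⧸ P), ?_, ?_⟩
  · rw [Ideal.card_stabilizer_eq p, Ideal.ramificationIdxIn_eq_ramificationIdx p P G,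
      Ideal.inertiaDegIn_eq_inertiaDeg p P G,
      Ideal.IsDedekindDomain.ramificationIdx_eq_multiplicity p P hpB,
      Ideal.inertiaDeg_eq_of_isMaximal p P]
  · let := Ideal.Quotient.field p
    exact Module.natCard_eq_pow_finrank

namespace WeightedDisc

section LocalNorm

variable {p : ℕ} [Fact p.Prime] {L : Type*} [Field L] [Algebra ℚ_[p] L] [Algebra ℤ_[p] L]
  [IsScalarTower ℤ_[p] ℚ_[p] L] [FiniteDimensional ℚ_[p] L]

omit [Algebra ℤ_[p] L] [IsScalarTower ℤ_[p] ℚ_[p] L] in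
theorem spectralNorm_mul_padic (x y : L) : spectralNorm ℚ_[p] L (x * y) =
    spectralNorm ℚ_[p] L x * spectralNorm ℚ_[p] L y :=
  spectralAlgNorm_mul x y

variable (p L) in
theorem exists_maxIdeal_eq_span :
    ∃ π : integralClosure ℤ_[p] L, maxIdeal p L = Ideal.span {π} := by
  have : IsPrincipalIdealRing (integralClosure ℤ_[p] L) := by
    apply IsPrincipalIdealRing.of_finite_maximals
    refine (Set.finite_singleton (IsLocalRing.maximalIdeal _)).subset fun I hI => ?_
    exact IsLocalRing.eq_maximalIdeal hI
  exact (IsPrincipalIdealRing.principal (maxIdeal p L)).principal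

theorem mem_maxIdeal_pow_iff {π : integralClosure ℤ_[p] L} (hπ : maxIdeal p L = Ideal.span {π})
    {n : ℕ} {x : integralClosure ℤ_[p] L} :
    x ∈ maxIdeal p L ^ n ↔ spectralNorm ℚ_[p] L (x : L) ≤ spectralNorm ℚ_[p] L (π : L) ^ n := by
  have hpow : spectralNorm ℚ_[p] L (π : L) ^ n = spectralNorm ℚ_[p] L ((π : L) ^ n) :=
    (map_pow (spectralMulAlgNorm ℚ_[p] L) (π : L) n).symm
  have hπ0 : (π : L) ^ n ≠ 0 := by
    apply pow_ne_zero
    intro h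
    apply maxIdeal_ne_bot (p := p) (E := L)
    rw [hπ, Ideal.span_singleton_eq_bot]
    exact Subtype.ext h
  rw [hπ, Ideal.span_singleton_pow, Ideal.mem_span_singleton, hpow]
  constructor
  · rintro ⟨y, rfl⟩
    rw [MulMemClass.coe_mul, SubmonoidClass.coe_pow, spectralNorm_mul_padic]
    exact mul_le_of_le_one_right (spectralNorm_nonneg _) (spectralNorm_coe_le_one y)
  · intro h
    have hpos := spectralNorm_zero_lt hπ0 (Algebra.IsAlgebraic.isAlgebraic (R := ℚ_[p]) _)
    have hx : (x : L) = (π : L) ^ n * (x / (π : L) ^ n) := (mul_div_cancel₀ _ hπ0).symm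
    have hi : IsIntegral ℤ_[p] ((x : L) / (π : L) ^ n) := by
      rw [isIntegral_padicInt_iff]
      rw [hx, spectralNorm_mul_padic] at h
      exact le_of_mul_le_mul_left (by simpa using h) hpos
    exact ⟨⟨_, hi⟩, Subtype.ext hx⟩

variable (p L) in
theorem exists_pos_forall_mem_maxIdeal_pow (n : ℕ) : ∃ ε > 0, ∀ x : integralClosure ℤ_[p] L,
    spectralNorm ℚ_[p] L (x : L) < ε → x ∈ maxIdeal p L ^ n := by
  obtain ⟨π, hπ⟩ := exists_maxIdeal_eq_span p L
  refine ⟨spectralNorm ℚ_[p] L (π : L) ^ n, pow_pos (spectralNorm_zero_lt (fun h => ?_)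
    (Algebra.IsAlgebraic.isAlgebraic (R := ℚ_[p]) _)) n,
    fun x hx => (mem_maxIdeal_pow_iff hπ).2 hx.le⟩
  apply maxIdeal_ne_bot (p := p) (E := L)
  rw [hπ, Ideal.span_singleton_eq_bot]
  exact Subtype.ext h

end LocalNorm

section Dense

variable {p : ℕ} [Fact p.Prime] {L : Type*} [Field L] [Algebra ℚ_[p] L]
  [FiniteDimensional ℚ_[p] L]

theorem spectralNorm_add_lt {x y : L} {ε : ℝ} (hx : spectralNorm ℚ_[p] L x < ε)
    (hy : spectralNorm ℚ_[p] L y < ε) : spectralNorm ℚ_[p] L (x + y) < ε :=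
  (isNonarchimedean_spectralNorm (K := ℚ_[p]) x y).trans_lt (max_lt hx hy)

/-- A number field generating `L` over `ℚ_p` is dense in `L`. -/
theorem exists_spectralNorm_sub_lt {K : Type*} [Field K] (j : K →+* L)
    (hj : IntermediateField.adjoin ℚ_[p] (Set.range j) = ⊤) (y : L) {ε : ℝ} (hε : 0 < ε) :
    ∃ x, spectralNorm ℚ_[p] L (y - j x) < ε := by
  have hy : y ∈ Algebra.adjoin ℚ_[p] (Set.range j) := by
    rw [← IntermediateField.adjoin_toSubalgebra_of_isAlgebraic
      fun x _ => Algebra.IsAlgebraic.isAlgebraic x, hj]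
    exact Algebra.mem_top
  have hmulpos (x : L) : 0 < spectralNorm ℚ_[p] L x + 1 :=
    add_pos_of_nonneg_of_pos (spectralNorm_nonneg _) one_pos
  have hmul (x z : L) (δ : ℝ) (h : spectralNorm ℚ_[p] L z < δ / (spectralNorm ℚ_[p] L x + 1)) :
      spectralNorm ℚ_[p] L (x * z) < δ := by
    rw [lt_div_iff₀ (hmulpos x)] at h
    rw [show spectralNorm ℚ_[p] L (x * z) = _ from spectralAlgNorm_mul x z]
    change spectralNorm ℚ_[p] L x * spectralNorm ℚ_[p] L z < δ
    nlinarith [spectralNorm_nonneg (K := ℚ_[p]) z]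
  induction hy using Algebra.adjoin_induction generalizing ε with
  | mem x hx =>
    obtain ⟨x, rfl⟩ := hx
    exact ⟨x, by rwa [sub_self, spectralNorm_zero]⟩
  | algebraMap r =>
    obtain ⟨q, hq⟩ := Padic.rat_dense p r hε
    have hcast : CharZero L := charZero_of_injective_algebraMap (algebraMap ℚ_[p] L).injective
    have hcast : CharZero K := (RingHom.charZero_iff j.injective).2 hcast
    refine ⟨q, ?_⟩
    rwa [map_ratCast, ← map_ratCast (algebraMap ℚ_[p] L), ← map_sub, spectralNorm_extends]
  | add x y _ _ hx hy =>
    obtain ⟨a, ha⟩ := hx hε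
    obtain ⟨b, hb⟩ := hy hε
    refine ⟨a + b, ?_⟩
    rw [map_add, add_sub_add_comm]
    exact spectralNorm_add_lt ha hb
  | mul x y _ _ hx hy =>
    obtain ⟨a, ha⟩ := hx (div_pos hε (hmulpos y))
    obtain ⟨b, hb⟩ := hy (div_pos hε (hmulpos (j a)))
    refine ⟨a * b, ?_⟩
    have : x * y - j (a * b) = y * (x - j a) + j a * (y - j b) := by rw [map_mul]; ring
    rw [this]
    exact spectralNorm_add_lt (hmul _ _ _ ha) (hmul _ _ _ hb)

end Dense

section Comparison

variable {p : ℕ} [Fact p.Prime] {L : Type*} [Field L] [Algebra ℚ_[p] L] [Algebra ℤ_[p] L]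
  [IsScalarTower ℤ_[p] ℚ_[p] L] [FiniteDimensional ℚ_[p] L] {K : Type*} [Field K] [NumberField K]

variable (p) in
/-- The map between rings of integers induced by an embedding of a number field into an
extension of `ℚ_p`. -/
noncomputable def integersMap (j : K →+* L) : 𝓞 K →+* integralClosure ℤ_[p] L :=
  (j.comp (algebraMap (𝓞 K) K)).codRestrict (integralClosure ℤ_[p] L) fun x =>
    ((NumberField.RingOfIntegers.isIntegral_coe x).map j.toIntAlgHom).tower_top

omit [Algebra ℚ_[p] L] [IsScalarTower ℤ_[p] ℚ_[p] L] [FiniteDimensional ℚ_[p] L] [NumberField K] in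
theorem coe_integersMap (j : K →+* L) (x : 𝓞 K) : (integersMap p j x : L) = j x := rfl

omit [Algebra ℚ_[p] L] [IsScalarTower ℤ_[p] ℚ_[p] L] [FiniteDimensional ℚ_[p] L] [NumberField K] in
theorem integersMap_injective (j : K →+* L) : Function.Injective (integersMap p j) := by
  intro x y h
  exact NumberField.RingOfIntegers.ext (j.injective (congrArg Subtype.val h))

/-- The prime of a number field induced by an embedding into an extension of `ℚ_p`. -/
noncomputable abbrev primeOfEmbedding (p : ℕ) [Fact p.Prime] {L : Type*} [Field L] [Algebra ℚ_[p] L]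
    [Algebra ℤ_[p] L] [IsScalarTower ℤ_[p] ℚ_[p] L] {K : Type*} [Field K] [NumberField K]
    (j : K →+* L) : Ideal (𝓞 K) :=
  (maxIdeal p L).comap (integersMap p j)

theorem mem_primeOfEmbedding_iff {j : K →+* L} {x : 𝓞 K} :
    x ∈ primeOfEmbedding p j ↔ spectralNorm ℚ_[p] L (j x) < 1 := by
  rw [Ideal.mem_comap, mem_maxIdeal_iff, coe_integersMap]

theorem spectralNorm_eq_one_of_notMem {j : K →+* L} {x : 𝓞 K} (hx : x ∉ primeOfEmbedding p j) :
    spectralNorm ℚ_[p] L (j x) = 1 := by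
  rw [mem_primeOfEmbedding_iff, not_lt] at hx
  exact le_antisymm (spectralNorm_coe_le_one (integersMap p j x)) hx

theorem natCast_mem_primeOfEmbedding (j : K →+* L) : (p : 𝓞 K) ∈ primeOfEmbedding p j := by
  rw [Ideal.mem_comap, map_natCast]
  exact natCast_mem_maxIdeal

theorem primeOfEmbedding_ne_bot (j : K →+* L) : primeOfEmbedding p j ≠ ⊥ := fun h => by
  have := natCast_mem_primeOfEmbedding (p := p) j
  rw [h, Ideal.mem_bot] at this
  exact (Fact.out : p.Prime).ne_zero (by exact_mod_cast this)

instance isMaximal_primeOfEmbedding (j : K →+* L) : (primeOfEmbedding p j).IsMaximal :=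
  (Ideal.IsPrime.isMaximal inferInstance (primeOfEmbedding_ne_bot j))

theorem isMaximal_span_int (p : ℕ) [Fact p.Prime] : (Ideal.span {(p : ℤ)}).IsMaximal :=
  PrincipalIdealRing.isMaximal_of_irreducible
    (Nat.prime_iff_prime_int.1 (Fact.out : p.Prime)).irreducible

instance liesOver_primeOfEmbedding (j : K →+* L) :
    (primeOfEmbedding p j).LiesOver (Ideal.span {(p : ℤ)}) := by
  refine ⟨(isMaximal_span_int p).eq_of_le (Ideal.IsPrime.ne_top inferInstance) ?_⟩
  rw [Ideal.span_singleton_le_iff_mem, Ideal.mem_comap, map_natCast]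
  exact natCast_mem_primeOfEmbedding j

/-- Approximate `y` by some `a / b` in the number field. It has norm at most 1, so it equals `c / s`
with `s` outside the prime; an inverse `t` of `s` modulo the `n`-th power gives the integer `c * t`.
-/
theorem exists_sub_integersMap_mem {j : K →+* L}
    (hj : IntermediateField.adjoin ℚ_[p] (Set.range j) = ⊤) (n : ℕ)
    (y : integralClosure ℤ_[p] L) : ∃ a, y - integersMap p j a ∈ maxIdeal p L ^ n := by
  obtain ⟨ε, hε, hn⟩ := exists_pos_forall_mem_maxIdeal_pow p L n
  obtain ⟨x, hx⟩ := exists_spectralNorm_sub_lt j hj y (lt_min hε one_pos)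
  have hx1 : spectralNorm ℚ_[p] L (j x) ≤ 1 := by
    have : j x = (y : L) + -(y - j x) := by ring
    rw [this]
    refine (isNonarchimedean_spectralNorm (K := ℚ_[p]) _ _).trans (max_le
      (spectralNorm_coe_le_one y) ?_)
    rw [spectralNorm_neg (Algebra.IsAlgebraic.isAlgebraic _)]
    exact (hx.trans_le (min_le_right _ _)).le
  obtain ⟨a, b, hb, rfl⟩ := IsFractionRing.div_surjective (𝓞 K) x
  have hb0 : j (algebraMap _ K b) ≠ 0 := by
    rw [map_ne_zero]
    simpa using nonZeroDivisors.ne_zero hb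
  have hbpos := spectralNorm_zero_lt hb0 (Algebra.IsAlgebraic.isAlgebraic (R := ℚ_[p]) _)
  have hab : spectralNorm ℚ_[p] L (j (algebraMap _ K a)) ≤
      spectralNorm ℚ_[p] L (j (algebraMap _ K b)) := by
    have : j (algebraMap _ K a) = j (algebraMap _ K a / algebraMap _ K b) *
        j (algebraMap _ K b) := by rw [map_div₀, div_mul_cancel₀ _ hb0]
    rw [this, spectralNorm_mul_padic]
    exact mul_le_of_le_one_left hbpos.le hx1
  obtain ⟨s, hs, c, hc⟩ | ⟨s, hs, c, hcP, hc⟩ :=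
    Ideal.exists_mul_eq_mul_of_isPrime (primeOfEmbedding_ne_bot (p := p) j) a b
  · have hcop : IsCoprime (Ideal.span {s}) (primeOfEmbedding p j ^ n) := by
      apply IsCoprime.pow_right
      rw [Ideal.isCoprime_iff_sup_eq, sup_comm]
      exact (isMaximal_primeOfEmbedding j).1.2 _ (by
        rw [left_lt_sup, Ideal.span_singleton_le_iff_mem]
        exact hs)
    obtain ⟨u, hu, v, hv, huv⟩ := Ideal.isCoprime_iff_exists.1 hcop
    obtain ⟨t, rfl⟩ := Ideal.mem_span_singleton'.1 hu
    refine ⟨c * t, ?_⟩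
    have hs1 := spectralNorm_eq_one_of_notMem hs
    have hs0 : j (algebraMap _ K s) ≠ 0 := fun h => by
      rw [h, spectralNorm_zero] at hs1
      exact zero_ne_one hs1
    have hxc : j (algebraMap _ K a / algebraMap _ K b) * j (algebraMap _ K s) =
        j (algebraMap _ K c) := by
      have := congrArg (fun z => j (algebraMap _ K z)) hc
      simp only [map_mul] at this
      rw [map_div₀]
      field_simp
      linear_combination this
    have hxc1 : IsIntegral ℤ_[p] (j (algebraMap _ K a / algebraMap _ K b)) :=
      isIntegral_padicInt_iff.2 hx1
    have h1 : y - ⟨_, hxc1⟩ ∈ maxIdeal p L ^ n := hn _ (hx.trans_le (min_le_left _ _))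
    have hvn : integersMap p j v ∈ maxIdeal p L ^ n := by
      have := Ideal.mem_map_of_mem (integersMap p j) hv
      rw [Ideal.map_pow] at this
      exact Ideal.pow_right_mono Ideal.map_comap_le n this
    have h2 : (⟨_, hxc1⟩ : integralClosure ℤ_[p] L) - integersMap p j (c * t) =
        ⟨_, hxc1⟩ * integersMap p j v := by
      have hcs : integersMap p j c = ⟨_, hxc1⟩ * integersMap p j s := Subtype.ext hxc.symm
      have hv1 : integersMap p j v = 1 - integersMap p j t * integersMap p j s := by
        rw [← map_mul, ← map_one (integersMap p j), ← map_sub]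
        congr 1
        linear_combination huv
      rw [map_mul, hcs, hv1]
      ring
    have := Ideal.add_mem _ h1 (h2 ▸ Ideal.mul_mem_left _ _ hvn)
    rwa [sub_add_sub_cancel] at this
  · exfalso
    have h1 := spectralNorm_eq_one_of_notMem hs
    have h2 := mem_primeOfEmbedding_iff.1 hcP
    have h3 := congrArg (fun z => spectralNorm ℚ_[p] L (j (algebraMap _ K z))) hc
    simp only [map_mul, spectralNorm_mul_padic] at h3
    rw [h1, one_mul] at h3
    have h4 : spectralNorm ℚ_[p] L (j (algebraMap _ K c)) *
        spectralNorm ℚ_[p] L (j (algebraMap _ K a)) ≤ spectralNorm ℚ_[p] L (j (algebraMap _ K c)) *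
        spectralNorm ℚ_[p] L (j (algebraMap _ K b)) :=
      mul_le_mul_of_nonneg_left hab (spectralNorm_nonneg _)
    nlinarith

/-- For the inclusion `≤`, choose `ϖ` in `𝓞 K` close to the uniformizer `π` and compare `a` with `ϖ
^ n`: either `ϖ ^ n` divides `a` locally, or `a` has larger norm than `ϖ ^ n`, hence than `π ^ n`,
which is excluded. -/
theorem comap_maxIdeal_pow {j : K →+* L}
    (hj : IntermediateField.adjoin ℚ_[p] (Set.range j) = ⊤) (n : ℕ) :
    (maxIdeal p L ^ n).comap (integersMap p j) = primeOfEmbedding p j ^ n := by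
  apply le_antisymm
  · obtain ⟨π, hπ⟩ := exists_maxIdeal_eq_span p L
    obtain ⟨ϖ, hϖ⟩ := exists_sub_integersMap_mem hj 2 π
    have hπ1 : spectralNorm ℚ_[p] L (π : L) < 1 :=
      mem_maxIdeal_iff.1 (hπ ▸ Ideal.mem_span_singleton_self π)
    have hπ0 : (π : L) ≠ 0 := fun h => by
      apply maxIdeal_ne_bot (p := p) (E := L)
      rw [hπ, Ideal.span_singleton_eq_bot]
      exact Subtype.ext h
    have hπpos := spectralNorm_zero_lt hπ0 (Algebra.IsAlgebraic.isAlgebraic (R := ℚ_[p]) _)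
    have hle : spectralNorm ℚ_[p] L (π : L) ≤ spectralNorm ℚ_[p] L (j ϖ) := by
      by_contra! hlt
      have h1 : spectralNorm ℚ_[p] L ((π : L) - j ϖ) < spectralNorm ℚ_[p] L (π : L) :=
        ((mem_maxIdeal_pow_iff hπ).1 hϖ).trans_lt (by rw [pow_two]; nlinarith)
      have h2 := spectralNorm_add_lt h1 hlt
      rw [sub_add_cancel] at h2
      exact lt_irrefl _ h2
    have hϖP : ϖ ∈ primeOfEmbedding p j := by
      have h1 : π - integersMap p j ϖ ∈ maxIdeal p L :=
        Ideal.pow_le_self two_ne_zero hϖ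
      have h2 : π ∈ maxIdeal p L := hπ ▸ Ideal.mem_span_singleton_self π
      exact Ideal.mem_comap.2 (by simpa using Ideal.sub_mem _ h2 h1)
    intro a ha
    rw [Ideal.mem_comap, mem_maxIdeal_pow_iff hπ, coe_integersMap] at ha
    obtain ⟨s, hs, c, hc⟩ | ⟨s, hs, c, hcP, hc⟩ :=
      Ideal.exists_mul_eq_mul_of_isPrime (primeOfEmbedding_ne_bot (p := p) j) a (ϖ ^ n)
    · have : s * a ∈ primeOfEmbedding p j ^ n := by
        rw [hc]
        exact Ideal.mul_mem_left _ _ (Ideal.pow_mem_pow hϖP n)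
      exact (Ideal.IsPrime.mul_mem_pow _ this).resolve_left hs
    · exfalso
      have h1 := spectralNorm_eq_one_of_notMem hs
      have h2 := mem_primeOfEmbedding_iff.1 hcP
      have h3 := congrArg (fun z => spectralNorm ℚ_[p] L (j (algebraMap _ K z))) hc
      simp only [map_mul, spectralNorm_mul_padic] at h3
      rw [h1, one_mul, map_pow, map_pow, show spectralNorm ℚ_[p] L (j ϖ ^ n) =
        spectralNorm ℚ_[p] L (j ϖ) ^ n from map_pow (spectralMulAlgNorm ℚ_[p] L) (j ϖ) n] at h3
      have h4 := pow_le_pow_left₀ hπpos.le hle n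
      have h5 : 0 < spectralNorm ℚ_[p] L (π : L) ^ n := pow_pos hπpos n
      have h6 := spectralNorm_nonneg (K := ℚ_[p]) (j (algebraMap _ K c))
      nlinarith
  · rw [← Ideal.map_le_iff_le_comap, Ideal.map_pow]
    exact Ideal.pow_right_mono Ideal.map_comap_le n

end Comparison

end WeightedDisc

end

section

open scoped Pointwise NumberField

namespace WeightedDisc

/-! ### Decomposition and ramification groups under completion -/

section Comparison

variable {p : ℕ} [Fact p.Prime] {L : Type*} [Field L] [Algebra ℚ_[p] L] [Algebra ℤ_[p] L]
  [IsScalarTower ℤ_[p] ℚ_[p] L] [FiniteDimensional ℚ_[p] L] {K : Type*} [Field K] [NumberField K]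
  {G : Type*} [Group G] [MulSemiringAction G K] {j : K →+* L} {r : Gal(L/ℚ_[p]) →* G}

omit [FiniteDimensional ℚ_[p] L] [NumberField K] in
theorem integersMap_smul (hj : ∀ g x, j (r g • x) = g (j x)) (g : Gal(L/ℚ_[p])) (x : 𝓞 K) :
    integersMap p j (r g • x) = g • integersMap p j x :=
  Subtype.ext (hj g x)

theorem finite_quotient_span_int (p : ℕ) [Fact p.Prime] :
    Finite (ℤ ⧸ Ideal.span {(p : ℤ)}) :=
  Finite.of_equiv _ (Int.quotientSpanNatEquivZMod p).symm.toEquiv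

variable [Finite G] [IsGaloisGroup G ℤ (𝓞 K)] [IsGalois ℚ_[p] L]

-- By injectivity of `r`, an automorphism fixing the image of `j` is trivial; the Galois
-- correspondence does the rest.
omit [Finite G] in
omit [Finite G] in
theorem adjoin_range_eq_top (hj : ∀ g x, j (r g • x) = g (j x)) (hr : Function.Injective r) :
    IntermediateField.adjoin ℚ_[p] (Set.range j) = ⊤ := by
  have hbot : (IntermediateField.adjoin ℚ_[p] (Set.range j)).fixingSubgroup = ⊥ := by
    refine (Subgroup.eq_bot_iff_forall _).2 fun g hg => hr ?_
    rw [map_one]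
    have := IsGaloisGroup.faithful ℤ (G := G) (B := 𝓞 K)
    refine eq_of_smul_eq_smul (α := 𝓞 K) fun x => ?_
    apply integersMap_injective (p := p) j
    rw [integersMap_smul hj, one_smul]
    exact Subtype.ext (hg ⟨j x, IntermediateField.subset_adjoin _ _ ⟨x, rfl⟩⟩)
  rw [← IsGalois.fixedField_fixingSubgroup (IntermediateField.adjoin ℚ_[p] (Set.range j)), hbot,
    IntermediateField.fixedField_bot]

theorem multiplicity_primeOfEmbedding (hj : IntermediateField.adjoin ℚ_[p] (Set.range j) = ⊤) :
    multiplicity (primeOfEmbedding p j) ((Ideal.span {(p : ℤ)}).map (algebraMap ℤ (𝓞 K))) =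
      multiplicity (maxIdeal p L)
        ((IsLocalRing.maximalIdeal ℤ_[p]).map (algebraMap ℤ_[p] (integralClosure ℤ_[p] L))) := by
  rw [PadicInt.maximalIdeal_eq_span_p, Ideal.map_span, Ideal.map_span, Set.image_singleton,
    Set.image_singleton, map_natCast, map_natCast]
  have hp0 : p ≠ 0 := (Fact.out : p.Prime).ne_zero
  refine eq_of_forall_le_iff fun n => ?_
  rw [← Ideal.mem_pow_iff_le_multiplicity (primeOfEmbedding_ne_bot j) (Nat.cast_ne_zero.2 hp0),
    ← Ideal.mem_pow_iff_le_multiplicity maxIdeal_ne_bot (Nat.cast_ne_zero.2 hp0),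
    ← comap_maxIdeal_pow hj, Ideal.mem_comap, map_natCast]

omit [IsGalois ℚ_[p] L] in
theorem card_quotient_primeOfEmbedding
    (hj : IntermediateField.adjoin ℚ_[p] (Set.range j) = ⊤) :
    Nat.card (𝓞 K ⧸ primeOfEmbedding p j) = Nat.card (integralClosure ℤ_[p] L ⧸ maxIdeal p L) := by
  refine Nat.card_congr (Equiv.ofBijective
    (Ideal.quotientMap (maxIdeal p L) (integersMap p j) le_rfl)
    ⟨Ideal.quotientMap_injective, ?_⟩)
  refine Ideal.Quotient.mk_surjective.forall.2 fun y => ?_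
  obtain ⟨a, ha⟩ := exists_sub_integersMap_mem hj 1 y
  rw [pow_one] at ha
  exact ⟨Ideal.Quotient.mk _ a, (Ideal.Quotient.eq.2 ha).symm⟩

/-- Both decomposition groups have order `e f` with the same `e` and `f`, and the local one is the
whole Galois group. -/
theorem card_stabilizer_primeOfEmbedding
    (hj : IntermediateField.adjoin ℚ_[p] (Set.range j) = ⊤) :
    Nat.card (MulAction.stabilizer G (primeOfEmbedding p j)) = Nat.card Gal(L/ℚ_[p]) := by
  have _ := isMaximal_span_int p
  have _ := finite_quotient_span_int p
  have _ := finite_residue_padicInt (p := p)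
  have hp0 : (p : ℤ) ≠ 0 := Nat.cast_ne_zero.2 (Fact.out : p.Prime).ne_zero
  obtain ⟨f, hf, hcf⟩ := Ideal.exists_card_stabilizer_eq_mul (G := G)
    (p := Ideal.span {(p : ℤ)}) (by simpa using hp0) (primeOfEmbedding p j)
  obtain ⟨f', hf', hcf'⟩ := Ideal.exists_card_stabilizer_eq_mul (G := Gal(L/ℚ_[p]))
    (IsDiscreteValuationRing.not_a_field ℤ_[p]) (maxIdeal p L)
  have hstab : MulAction.stabilizer Gal(L/ℚ_[p]) (maxIdeal p L) = ⊤ := by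
    refine (Subgroup.eq_top_iff' _).2 fun g => ?_
    rw [MulAction.mem_stabilizer_iff]
    ext x
    rw [Ideal.mem_pointwise_smul_iff_inv_smul_mem]
    exact ⟨fun h => by simpa using smul_mem_maxIdeal g h, smul_mem_maxIdeal g⁻¹⟩
  rw [hstab, Subgroup.card_top] at hf'
  have h1 : Nat.card (ℤ ⧸ Ideal.span {(p : ℤ)}) = p := by
    rw [Nat.card_congr (Int.quotientSpanNatEquivZMod p).toEquiv, Nat.card_zmod]
  have h2 : Nat.card (ℤ_[p] ⧸ IsLocalRing.maximalIdeal ℤ_[p]) = p :=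
    (Nat.card_congr (PadicInt.residueField (p := p)).toEquiv).trans (Nat.card_zmod p)
  rw [h1, card_quotient_primeOfEmbedding hj, hcf', h2] at hcf
  rw [hf, hf', multiplicity_primeOfEmbedding hj,
    Nat.pow_right_injective (Fact.out : p.Prime).two_le hcf]

theorem range_eq_stabilizer (hj : ∀ g x, j (r g • x) = g (j x)) (hr : Function.Injective r) :
    r.range = MulAction.stabilizer G (primeOfEmbedding p j) := by
  have hle : r.range ≤ MulAction.stabilizer G (primeOfEmbedding p j) := by
    rintro _ ⟨g, rfl⟩
    rw [MulAction.mem_stabilizer_iff]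
    ext x
    rw [Ideal.mem_pointwise_smul_iff_inv_smul_mem, ← map_inv, Ideal.mem_comap, Ideal.mem_comap,
      integersMap_smul hj]
    exact ⟨fun h => by simpa using smul_mem_maxIdeal g h, smul_mem_maxIdeal g⁻¹⟩
  refine Subgroup.eq_of_le_of_card_ge hle ?_
  rw [card_stabilizer_primeOfEmbedding (adjoin_range_eq_top hj hr)]
  exact (Nat.card_congr (MonoidHom.ofInjective hr).toEquiv).le

/-- The ramification groups of a decomposition group agree with those of the completion. -/
theorem map_galRamificationGroup (hj : ∀ g x, j (r g • x) = g (j x))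
    (hr : Function.Injective r) (i : ℕ) :
    (galRamificationGroup p L i).map r = (primeOfEmbedding p j ^ (i + 1)).inertia G := by
  have htop := adjoin_range_eq_top hj hr
  have hmem (g : Gal(L/ℚ_[p])) : g ∈ galRamificationGroup p L i ↔
      r g ∈ (primeOfEmbedding p j ^ (i + 1)).inertia G := by
    rw [← comap_maxIdeal_pow htop]
    have h1 (x : 𝓞 K) : integersMap p j (r g • x - x) =
        g • integersMap p j x - integersMap p j x := by rw [map_sub, integersMap_smul hj]
    constructor
    · intro h x
      change integersMap p j (r g • x - x) ∈ maxIdeal p L ^ (i + 1)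
      rw [h1]
      exact h _
    · intro h y
      obtain ⟨a, ha⟩ := exists_sub_integersMap_mem htop (i + 1) y
      have h2 : g • integersMap p j a - integersMap p j a ∈ maxIdeal p L ^ (i + 1) := by
        rw [← h1]
        exact h a
      have h3 := smul_mem_maxIdeal_pow _ g ha
      have h4 : g • y - y = g • (y - integersMap p j a) +
          (g • integersMap p j a - integersMap p j a) - (y - integersMap p j a) := by
        rw [smul_sub]; ring
      change g • y - y ∈ maxIdeal p L ^ (i + 1)
      rw [h4]
      exact Ideal.sub_mem _ (Ideal.add_mem _ h3 h2) ha
  ext γ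
  constructor
  · rintro ⟨g, hg, rfl⟩
    exact (hmem g).1 hg
  · intro hγ
    -- Elements of a ramification group stabilize the prime, so they come from the local Galois
    -- group.
    have hstab : γ ∈ MulAction.stabilizer G (primeOfEmbedding p j) := by
      have h (x : 𝓞 K) : γ • x - x ∈ primeOfEmbedding p j :=
        Ideal.pow_le_self (Nat.succ_ne_zero i) (hγ x)
      rw [MulAction.mem_stabilizer_iff]
      ext x
      rw [Ideal.mem_pointwise_smul_iff_inv_smul_mem]
      have := h (γ⁻¹ • x)
      rw [smul_inv_smul] at this
      exact ⟨fun hx => by simpa using Ideal.add_mem _ this hx,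
        fun hx => by simpa using Ideal.sub_mem _ hx this⟩
    rw [← range_eq_stabilizer hj hr] at hstab
    obtain ⟨g, rfl⟩ := hstab
    exact ⟨g, (hmem g).2 hγ, rfl⟩

end Comparison

end WeightedDisc

end

section

open scoped Pointwise NumberField

namespace WeightedDisc

/-! ### Rings of integers and relative discriminants -/

section RingsOfIntegers

variable {K Γ : Type*} [Field K] [NumberField K] [Group Γ] [MulSemiringAction Γ K]

theorem faithfulSMul_ringOfIntegers [FaithfulSMul Γ K] : FaithfulSMul Γ (𝓞 K) where
  eq_of_smul_eq_smul {g h} hgh := by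
    refine eq_of_smul_eq_smul fun x : K => ?_
    obtain ⟨a, b, hb, rfl⟩ := IsFractionRing.div_surjective (𝓞 K) x
    have (c : 𝓞 K) : g • algebraMap (𝓞 K) K c = h • algebraMap (𝓞 K) K c :=
      congrArg (algebraMap (𝓞 K) K) (hgh c)
    rw [smul_div₀', smul_div₀', this, this]

theorem isGaloisGroup_ringOfIntegers [FaithfulSMul Γ K] {F : Type*} [Field F] [NumberField F]
    [Algebra F K] (H : Subgroup Γ)
    (h : ∀ y : K, (∀ g ∈ H, g • y = y) ↔ ∃ x : F, algebraMap F K x = y) :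
    IsGaloisGroup H (𝓞 F) (𝓞 K) where
  faithful := ⟨fun {a b} hab => by
    have := faithfulSMul_ringOfIntegers (K := K) (Γ := Γ)
    exact Subtype.ext (eq_of_smul_eq_smul (α := 𝓞 K) fun y => hab y)⟩
  commutes := ⟨fun g a b => by
    refine NumberField.RingOfIntegers.ext ?_
    have h1 : (g : Γ) • algebraMap F K a = algebraMap F K a := (h _).2 ⟨a, rfl⟩ g g.2
    rw [Algebra.smul_def, Algebra.smul_def, smul_mul']
    change (g : Γ) • algebraMap F K a * _ = algebraMap F K a * _
    rw [h1]⟩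
  isInvariant := ⟨fun b hb => by
    obtain ⟨x, hx⟩ := (h b).1 fun g hg => congrArg (algebraMap (𝓞 K) K) (hb ⟨g, hg⟩)
    have hint : IsIntegral ℤ x := by
      rw [← isIntegral_algebraMap_iff (algebraMap F K).injective, hx]
      exact NumberField.RingOfIntegers.isIntegral_coe b
    exact ⟨⟨x, hint⟩, NumberField.RingOfIntegers.ext hx⟩⟩

theorem isGaloisGroup_int_ringOfIntegers [FaithfulSMul Γ K]
    (h : ∀ y : K, (∀ g : Γ, g • y = y) → ∃ x : ℚ, (x : K) = y) :
    IsGaloisGroup Γ ℤ (𝓞 K) where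
  faithful := faithfulSMul_ringOfIntegers
  commutes := ⟨fun g a b => map_zsmul (DistribSMul.toAddMonoidHom (𝓞 K) g) a b⟩
  isInvariant := ⟨fun b hb => by
    obtain ⟨x, hx⟩ := h b fun g => congrArg (algebraMap (𝓞 K) K) (hb g)
    have hint : IsIntegral ℤ x := by
      rw [← isIntegral_algebraMap_iff (algebraMap ℚ K).injective, eq_ratCast, hx]
      exact NumberField.RingOfIntegers.isIntegral_coe b
    obtain ⟨n, rfl⟩ := IsIntegrallyClosed.isIntegral_iff.1 hint
    refine ⟨n, NumberField.RingOfIntegers.ext ?_⟩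
    rw [← hx]
    simp⟩

theorem multiplicity_relNorm_int {B : Type*} [CommRing B] [IsDedekindDomain B] [CharZero B]
    [Module.Finite ℤ B] {I : Ideal B} (hI : I ≠ ⊥) (p : ℕ) [Fact p.Prime] :
    multiplicity (Ideal.span {(p : ℤ)}) (Ideal.relNorm ℤ I) =
      (Ideal.absNorm I).factorization p := by
  have := isMaximal_span_int p
  have hp0 : Ideal.span {(p : ℤ)} ≠ ⊥ := by
    simpa using (Fact.out : p.Prime).ne_zero
  have hI0 : Ideal.absNorm I ≠ 0 := by rwa [Ne, Ideal.absNorm_eq_zero_iff]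
  rw [Ideal.relNorm_int]
  refine eq_of_forall_le_iff fun n => ?_
  rw [← Ideal.mem_pow_iff_le_multiplicity hp0 (Nat.cast_ne_zero.2 hI0), Ideal.span_singleton_pow,
    Ideal.mem_span_singleton, ← (Fact.out : p.Prime).pow_dvd_iff_le_factorization hI0]
  exact_mod_cast Iff.rfl

theorem relDiscr_eq_relNorm (F F' : Type*) [Field F] [NumberField F] [Field F'] [NumberField F']
    [Algebra F F'] : relDiscr F F' = Ideal.relNorm (𝓞 F) (differentIdeal (𝓞 F) (𝓞 F')) :=
  (relNorm_differentIdeal_eq_span_discr (𝓞 F) F F' (𝓞 F')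
    (NumberField.RingOfIntegers.not_isField F)).symm

theorem relDiscr_ne_bot (F F' : Type*) [Field F] [NumberField F] [Field F'] [NumberField F']
    [Algebra F F'] : relDiscr F F' ≠ ⊥ := by
  rw [relDiscr_eq_relNorm, Ne, Ideal.relNorm_eq_bot_iff]
  exact differentIdeal_ne_bot_of_charZero (𝓞 F)

theorem sum_card_inertia_inf_eq_factorization [Fintype Γ] [IsGaloisGroup Γ ℤ (𝓞 K)]
    (F F' : Type*) [Field F]
    [NumberField F] [Field F'] [NumberField F'] [Algebra F F'] [Algebra F K] [Algebra F' K]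
    [IsScalarTower F F' K] (H H' : Subgroup Γ) [IsGaloisGroup H (𝓞 F) (𝓞 K)]
    [IsGaloisGroup H' (𝓞 F') (𝓞 K)] (p : ℕ) [Fact p.Prime] (P : Ideal (𝓞 K)) [P.IsPrime]
    [P.LiesOver (Ideal.span {(p : ℤ)})] :
    ∀ᶠ n in Filter.atTop, ∑ γ : Γ, ∑ i ∈ Finset.range n,
        Nat.card ↥(((P ^ (i + 1)).inertia Γ).map (MulAut.conj γ).toMonoidHom ⊓ H) =
      ∑ γ : Γ, ∑ i ∈ Finset.range n,
        Nat.card ↥(((P ^ (i + 1)).inertia Γ).map (MulAut.conj γ).toMonoidHom ⊓ H') +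
      Nat.card (P.inertia Γ) * Nat.card H' *
        (Ideal.absNorm (relDiscr F F')).factorization p := by
  have _ := isMaximal_span_int p
  have _ := finite_quotient_span_int p
  have hp0 : Ideal.span {(p : ℤ)} ≠ ⊥ := by
    simpa using (Fact.out : p.Prime).ne_zero
  have _ : IsScalarTower (𝓞 F) (𝓞 F') (𝓞 K) := inferInstance
  have h := sum_card_inertia_inf_eq ℤ hp0 P H H' (𝓞 F) (𝓞 F')
  have h1 := multiplicity_relNorm_int (relDiscr_ne_bot F F') p
  -- Transitivity of norms: the norm to `ℤ` of the different is that of the discriminant.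
  rw [relDiscr_eq_relNorm, Ideal.relNorm_relNorm, ← relDiscr_eq_relNorm] at h1
  rwa [h1] at h

end RingsOfIntegers

end WeightedDisc

end

section

open scoped Pointwise NumberField

namespace WeightedDisc

/-! ### The global extension cut out by a surjection -/

section GalAction

variable {k Γ : Type*} [Field k] [CharZero k] [Group Γ] [TopologicalSpace Γ] [DiscreteTopology Γ]
  (φ : AbsGal k →ₜ* Γ) (hφ : Function.Surjective φ)

/-- The Galois group of the extension of `k` cut out by a surjection to `Γ` is `Γ`. -/
noncomputable def galEquiv : Gal(IntermediateField.fixedField φ.toMonoidHom.ker/k) ≃* Γ :=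
  MulEquiv.ofBijective (galHom φ) ⟨galHom_injective φ, by
    intro γ
    obtain ⟨σ, rfl⟩ := hφ γ
    exact ⟨_, galHom_restrictNormalHom φ σ⟩⟩

/-- The action of `Γ` on the extension of `k` cut out by a surjection to `Γ`. -/
noncomputable abbrev galAction :
    MulSemiringAction Γ (IntermediateField.fixedField φ.toMonoidHom.ker) :=
  MulSemiringAction.compHom _ (galEquiv φ hφ).symm.toMonoidHom

theorem coe_galAction_smul (σ : AbsGal k) (x : IntermediateField.fixedField φ.toMonoidHom.ker) :
    letI := galAction φ hφ
    ((φ σ • x : IntermediateField.fixedField φ.toMonoidHom.ker) : AlgebraicClosure k) = σ x := by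
  have h : (galEquiv φ hφ).symm (φ σ) = AlgEquiv.restrictNormalHom _ σ := by
    rw [MulEquiv.symm_apply_eq]
    exact (galHom_restrictNormalHom φ σ).symm
  change (((galEquiv φ hφ).symm (φ σ) x : IntermediateField.fixedField φ.toMonoidHom.ker) :
    AlgebraicClosure k) = σ x
  rw [h]
  exact AlgEquiv.restrictNormal_commutes σ (IntermediateField.fixedField φ.toMonoidHom.ker) x

theorem faithfulSMul_galAction :
    letI := galAction φ hφ
    FaithfulSMul Γ (IntermediateField.fixedField φ.toMonoidHom.ker) := by
  let _ := galAction φ hφ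
  exact ⟨fun {a b} h => (galEquiv φ hφ).symm.injective (AlgEquiv.ext h)⟩

theorem forall_galAction_smul_eq_iff (H : Subgroup Γ)
    (y : IntermediateField.fixedField φ.toMonoidHom.ker) :
    letI := galAction φ hφ
    (∀ g ∈ H, g • y = y) ↔
      (y : AlgebraicClosure k) ∈ IntermediateField.fixedField (H.comap φ.toMonoidHom) := by
  let _ := galAction φ hφ
  constructor
  · intro h σ
    exact (coe_galAction_smul φ hφ σ.1 y).symm.trans (congrArg Subtype.val (h _ σ.2))
  · intro h g hg
    obtain ⟨σ, rfl⟩ := hφ g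
    exact Subtype.ext ((coe_galAction_smul φ hφ σ y).trans (h ⟨σ, hg⟩))

theorem exists_algebraMap_eq_of_galAction (y : IntermediateField.fixedField φ.toMonoidHom.ker)
    (hy : letI := galAction φ hφ; ∀ g : Γ, g • y = y) :
    ∃ x : k, algebraMap k (AlgebraicClosure k) x = y := by
  have h := (forall_galAction_smul_eq_iff φ hφ ⊤ y).1 fun g _ => hy g
  rwa [Subgroup.comap_top, InfiniteGalois.fixedField_bot, IntermediateField.mem_bot] at h

end GalAction

section Global

variable {Γ : Type*} [Group Γ] [TopologicalSpace Γ] [DiscreteTopology Γ]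
  (φ : GlobalHom Γ) (hφ : Function.Surjective φ)

theorem isGaloisGroup_galAction_int :
    letI : MulSemiringAction Γ (φ.fixedField ⊥) := galAction φ hφ
    IsGaloisGroup Γ ℤ (𝓞 (φ.fixedField ⊥)) := by
  let _ : MulSemiringAction Γ (φ.fixedField ⊥) := galAction φ hφ
  have : FaithfulSMul Γ (φ.fixedField ⊥) := faithfulSMul_galAction φ hφ
  refine isGaloisGroup_int_ringOfIntegers fun y hy => ?_
  obtain ⟨q, hq⟩ := exists_algebraMap_eq_of_galAction φ hφ y hy
  refine ⟨q, Subtype.ext ?_⟩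
  rw [← hq]
  simp

theorem numberField_extendScalars {H H' : Subgroup Γ} (h : H' ≤ H) :
    NumberField (IntermediateField.extendScalars (φ.fixedField_le h)) :=
  let e : φ.fixedField H' ≃+* IntermediateField.extendScalars (φ.fixedField_le h) :=
    { toFun := fun x => ⟨x, x.2⟩
      invFun := fun x => ⟨x, x.2⟩
      left_inv := fun _ => rfl
      right_inv := fun _ => rfl
      map_mul' := fun _ _ => rfl
      map_add' := fun _ _ => rfl }
  NumberField.of_ringEquiv _ _ e

variable {p : ℕ} [Fact p.Prime] (ι : ClosureEmbedding ℚ ℚ_[p])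

/-- The embedding, induced by `ι`, of the global extension cut out by `φ` into the local one. -/
noncomputable def localEmbedding : φ.fixedField ⊥ →+* (φ.restrict ι).field :=
  ((ι : AlgebraicClosure ℚ →+* AlgebraicClosure ℚ_[p]).comp
    (algebraMap (φ.fixedField ⊥) (AlgebraicClosure ℚ))).codRestrict (φ.restrict ι).field
    fun x σ => (restrictGal_commutes ι σ x).symm.trans
      (congrArg ι (x.2 ⟨restrictGal ι σ, σ.2⟩))

/-- The equivariance that identifies the local Galois group with a decomposition group in `Γ`. -/
theorem localEmbedding_smul (g : Gal((φ.restrict ι).field/ℚ_[p])) (x : φ.fixedField ⊥) :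
    letI : MulSemiringAction Γ (φ.fixedField ⊥) := galAction φ hφ
    localEmbedding φ ι (galHom (φ.restrict ι) g • x) = g (localEmbedding φ ι x) := by
  let _ : MulSemiringAction Γ (φ.fixedField ⊥) := galAction φ hφ
  obtain ⟨σ, rfl⟩ := AlgEquiv.restrictNormalHom_surjective (AlgebraicClosure ℚ_[p]) g
  apply Subtype.ext
  rw [galHom_restrictNormalHom]
  refine Eq.trans ?_ (AlgEquiv.restrictNormal_commutes σ (φ.restrict ι).field
    (localEmbedding φ ι x)).symm
  refine Eq.trans ?_ (restrictGal_commutes ι σ x)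
  exact congrArg ι (coe_galAction_smul φ hφ (restrictGal ι σ) x)

/-- The local counts are the exponents in the norm of the discriminant. -/
theorem pairCount_restrict [Fintype Γ] (hφ : Function.Surjective φ) {H H' : Subgroup Γ}
    (h : H' ≤ H) :
    pairCount H H' (φ.restrict ι) = (Ideal.absNorm (relDiscr (φ.fixedField H)
      (IntermediateField.extendScalars (φ.fixedField_le h)))).factorization p := by
  let F := φ.fixedField H
  let F' := IntermediateField.extendScalars (φ.fixedField_le h)
  let K := φ.fixedField ⊥
  let _ : MulSemiringAction Γ K := galAction φ hφ
  have _ : FaithfulSMul Γ K := faithfulSMul_galAction φ hφ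
  have _ : IsGaloisGroup Γ ℤ (𝓞 K) := isGaloisGroup_galAction_int φ hφ
  have _ : NumberField F' := numberField_extendScalars φ h
  let _ : Algebra F K := (IntermediateField.inclusion
    (φ.fixedField_le (bot_le : ⊥ ≤ H))).toRingHom.toAlgebra
  let _ : Algebra F' K := ((algebraMap F' (AlgebraicClosure ℚ)).codRestrict K fun x =>
    φ.fixedField_le (bot_le : ⊥ ≤ H') x.2).toAlgebra
  have _ : IsScalarTower F F' K := IsScalarTower.of_algebraMap_eq fun x => rfl
  have _ : IsGaloisGroup H (𝓞 F) (𝓞 K) := isGaloisGroup_ringOfIntegers H fun y =>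
    (forall_galAction_smul_eq_iff φ hφ H y).trans
      ⟨fun hy => ⟨⟨y, hy⟩, rfl⟩, by rintro ⟨x, rfl⟩; exact x.2⟩
  have _ : IsGaloisGroup H' (𝓞 F') (𝓞 K) := isGaloisGroup_ringOfIntegers H' fun y =>
    (forall_galAction_smul_eq_iff φ hφ H' y).trans
      ⟨fun hy => ⟨⟨y, hy⟩, rfl⟩, by rintro ⟨x, rfl⟩; exact x.2⟩
  let P := primeOfEmbedding p (localEmbedding φ ι)
  have hram (i : ℕ) : (φ.restrict ι).ramificationGroup i = (P ^ (i + 1)).inertia Γ := by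
    rw [ramificationGroup_eq_map_galHom]
    exact map_galRamificationGroup (localEmbedding_smul φ hφ ι) (galHom_injective _) i
  have hram0 : Nat.card ((φ.restrict ι).ramificationGroup 0) = Nat.card (P.inertia Γ) := by
    rw [hram, zero_add, pow_one]
  obtain ⟨n₀, hn₀⟩ := exists_ramificationGroup_eq_bot (φ.restrict ι)
  obtain ⟨n, hn, hsum⟩ := ((Filter.eventually_ge_atTop n₀).and
    (sum_card_inertia_inf_eq_factorization F F' H H' p P)).exists
  rw [pairCount_eq_sum H H' _ fun i hi => hn₀ i (hn.trans hi), hram0]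
  simp_rw [hram]
  have h1 : (Nat.card (P.inertia Γ) : ℚ) ≠ 0 := Nat.cast_ne_zero.2 Nat.card_pos.ne'
  have h2 : (Nat.card H' : ℚ) ≠ 0 := Nat.cast_ne_zero.2 Nat.card_pos.ne'
  have h3 := congrArg (Nat.cast : ℕ → ℚ) hsum
  push_cast at h3
  rw [h3, add_sub_cancel_left]
  field_simp
  rfl

end Global

end WeightedDisc

end

/-! ### The product over all primes and the counting function -/

namespace WeightedDisc

theorem zpow_finset_sum {ι F : Type*} [Field F] {x : F} (hx : x ≠ 0) (s : Finset ι) (f : ι → ℤ) :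
    x ^ ∑ i ∈ s, f i = ∏ i ∈ s, x ^ f i := by
  classical
  induction s using Finset.induction_on with
  | empty => simp
  | insert a s ha ih => rw [Finset.sum_insert ha, Finset.prod_insert ha, zpow_add₀ hx, ih]

/-- Using the primes of a common multiple `M` gives several integers the same index set. -/
theorem natCast_eq_prod_primes {N M : ℕ} (hN : N ∣ M) (hM : M ≠ 0) :
    (N : ℚ) = ∏ p ∈ M.primeFactors.subtype Nat.Prime, (p : ℚ) ^ N.factorization p := by
  have hN0 : N ≠ 0 := ne_zero_of_dvd_ne_zero hM hN
  rw [Finset.prod_subtype_of_mem (fun p : ℕ => (p : ℚ) ^ N.factorization p)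
    fun p hp => Nat.prime_of_mem_primeFactors hp]
  conv_lhs => rw [← Nat.prod_factorization_pow_eq_self hN0]
  rw [Finsupp.prod, Nat.support_factorization, Nat.cast_prod]
  simp_rw [Nat.cast_pow]
  refine Finset.prod_subset (Nat.primeFactors_mono hN hM) fun p _ hp => ?_
  rw [← Nat.support_factorization, Finsupp.notMem_support_iff] at hp
  rw [hp, pow_zero]

/-- A finite product of integral powers of positive integers, as a product over all primes. -/
theorem prod_zpow_eq_finprod_primes {ι : Type*} [Fintype ι] {N : ι → ℕ} (hN : ∀ i, N i ≠ 0)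
    (w : ι → ℤ) {c : Nat.Primes → ℤ} (hc : ∀ p, c p = ∑ i, (N i).factorization p * w i) :
    {p | c p ≠ 0}.Finite ∧ ∏ i, (N i : ℚ) ^ w i = ∏ᶠ p : Nat.Primes, (p : ℚ) ^ c p := by
  have hM : ∏ i, N i ≠ 0 := Finset.prod_ne_zero_iff.2 fun i _ => hN i
  have hdvd (i) : N i ∣ ∏ i, N i := Finset.dvd_prod_of_mem N (Finset.mem_univ i)
  let T : Finset Nat.Primes := (∏ i, N i).primeFactors.subtype Nat.Prime
  have hT (p : Nat.Primes) (hp : p ∉ T) : c p = 0 := by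
    rw [hc]
    refine Finset.sum_eq_zero fun i _ => ?_
    have : ¬ (p : ℕ) ∣ N i := fun h => hp (Finset.mem_subtype.2
      (Nat.mem_primeFactors.2 ⟨p.2, h.trans (hdvd i), hM⟩))
    rw [Nat.factorization_eq_zero_of_not_dvd this, Nat.cast_zero, zero_mul]
  refine ⟨T.finite_toSet.subset fun p hp => by_contra fun h => hp (hT p h), ?_⟩
  rw [finprod_eq_prod_of_mulSupport_subset (s := T) _ fun p hp => by_contra fun h => hp (by
    simp only [hT p h, zpow_zero])]
  have hp0 (p : Nat.Primes) : (p : ℚ) ≠ 0 := Nat.cast_ne_zero.2 p.2.ne_zero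
  simp_rw [hc, zpow_finset_sum (hp0 _)]
  rw [Finset.prod_comm]
  refine Finset.prod_congr rfl fun i _ => ?_
  rw [natCast_eq_prod_primes (hdvd i) hM, ← Finset.prod_zpow]
  refine Finset.prod_congr rfl fun p _ => ?_
  rw [zpow_mul, zpow_natCast]

section Count

variable {Γ : Type*} [Group Γ] [TopologicalSpace Γ] [DiscreteTopology Γ] (w : WeightFunction Γ)
  {p : ℕ} [Fact p.Prime]

theorem exists_int_eq_weightedCount [Finite Γ] (φ : LocalHom Γ p) :
    ∃ z : ℤ, weightedCount w φ = z := by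
  have := Fintype.ofFinite Γ
  have := Fintype.ofFinite (MaxPair Γ)
  choose z hz using fun P : MaxPair Γ => exists_int_eq_pairCount P.2.le φ
  refine ⟨∑ P, z P * w P, ?_⟩
  rw [weightedCount, finsum_eq_sum_of_fintype]
  push_cast
  simp_rw [hz]

/-- The counting function of a weight function. -/
noncomputable def weightedCountingFunction [Finite Γ] : CountingFunction Γ where
  toFun _ _ φ := (exists_int_eq_weightedCount w φ).choose
  map_conj p _ γ φ := by
    have := Fintype.ofFinite Γ
    have h1 := (exists_int_eq_weightedCount w φ).choose_spec
    have h2 := (exists_int_eq_weightedCount w (φ.conj γ)).choose_spec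
    have h3 : weightedCount w (φ.conj γ) = weightedCount w φ := by
      simp only [weightedCount, pairCount_conj]
    exact_mod_cast h2.symm.trans (h3.trans h1)
  map_unramified p _ φ h := by
    have := Fintype.ofFinite Γ
    have h1 := (exists_int_eq_weightedCount w φ).choose_spec
    have h2 : weightedCount w φ = 0 := by
      rw [inertiaImage_eq] at h
      simp only [weightedCount, pairCount_eq_zero _ _ φ h, zero_mul, finsum_zero]
    exact_mod_cast h1.symm.trans h2

theorem coe_weightedCountingFunction [Finite Γ] (φ : LocalHom Γ p) :
    ((weightedCountingFunction w).toFun p φ : ℚ) = weightedCount w φ :=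
  (exists_int_eq_weightedCount w φ).choose_spec.symm

/-- Away from `|Γ|` only `I_0` can be nontrivial, and it is the image of inertia. -/
theorem isProper_weightedCountingFunction [Finite Γ] : (weightedCountingFunction w).IsProper := by
  intro p p' _ _ φ φ' hp hp' h
  have := Fintype.ofFinite Γ
  rw [inertiaImage_eq, inertiaImage_eq] at h
  have hram (i : ℕ) : φ.ramificationGroup i = φ'.ramificationGroup i := by
    rcases Nat.eq_zero_or_pos i with rfl | hi
    · exact h
    · rw [ramificationGroup_eq_bot_of_not_dvd φ hp hi,
        ramificationGroup_eq_bot_of_not_dvd φ' hp' hi]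
  have h1 : weightedCount w φ = weightedCount w φ' := by
    simp only [weightedCount, pairCount_congr _ _ φ φ' hram]
  rw [← coe_weightedCountingFunction, ← coe_weightedCountingFunction] at h1
  exact_mod_cast h1

theorem weightedDisc_eq_finprod [Finite Γ] (φ : GlobalHom Γ) (hφ : Function.Surjective φ)
    (ι : ∀ p : Nat.Primes, ClosureEmbedding ℚ ℚ_[p]) :
    {p : Nat.Primes | (weightedCountingFunction w).toFun p (φ.restrict (ι p)) ≠ 0}.Finite ∧
      weightedDisc w φ = ∏ᶠ p : Nat.Primes,
        (p : ℚ) ^ (weightedCountingFunction w).toFun p (φ.restrict (ι p)) := by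
  have := Fintype.ofFinite Γ
  have := Fintype.ofFinite (MaxPair Γ)
  rw [weightedDisc, finprod_eq_prod_of_fintype]
  refine prod_zpow_eq_finprod_primes (fun P => ?_) w fun p => ?_
  · have := numberField_extendScalars φ P.2.le
    rw [Ne, Ideal.absNorm_eq_zero_iff]
    exact relDiscr_ne_bot _ _
  · have h := coe_weightedCountingFunction w (φ.restrict (ι p))
    rw [weightedCount, finsum_eq_sum_of_fintype] at h
    have hp := fun P : MaxPair Γ => pairCount_restrict φ (ι p) hφ P.2.le
    simp only [hp] at h
    exact_mod_cast h

end Count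

end WeightedDisc

theorem corollary4p1 {Γ : Type*} [Group Γ] [Finite Γ] [TopologicalSpace Γ] [DiscreteTopology Γ]
    (w : WeightFunction Γ) :
    ∃ c : CountingFunction Γ,
      (∀ (p : ℕ) [Fact p.Prime] (φ : LocalHom Γ p), (c.toFun p φ : ℚ) = weightedCount w φ) ∧
      (∀ φ : GlobalHom Γ, Function.Surjective φ →
        ∀ ι : ∀ p : Nat.Primes, ClosureEmbedding ℚ ℚ_[p],
          {p : Nat.Primes | c.toFun p (φ.restrict (ι p)) ≠ 0}.Finite ∧
          weightedDisc w φ = ∏ᶠ p : Nat.Primes, (p : ℚ) ^ c.toFun p (φ.restrict (ι p))) ∧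
      c.IsProper :=
  ⟨weightedCountingFunction w, fun _ _ φ => coe_weightedCountingFunction w φ,
    weightedDisc_eq_finprod w, isProper_weightedCountingFunction w⟩
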